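/- **Setting.** Let $m,s\ge 1$ be integers. For $1\le i\le m$ let $\mathcal K_i$ be a separable real Hilbert space and $z_i\in\mathcal K_i$; for $1\le k\le s$ let $\mathcal G_k$ be a separable real Hilbert space, $r_k\in\mathcal G_k$, and let $g_k,\ell_k\colon\mathcal G_k\to\left]-\infty,+\infty\right]$ be proper, convex and lower semicontinuous, with $\ell_k$ strongly convex. Let $L_{k,i}\colon\mathcal K_i\to\mathcal G_k$ be bounded linear operators, let $\boldsymbol{\mathcal K}=\mathcal K_1\oplus\dots\oplus\mathcal K_m$, $\boldsymbol{\mathcal G}=\mathcal G_1\oplus\dots\oplus\mathcal G_s$ be the Hilbert direct sums, and let $\varphi\colon\boldsymbol{\mathcal K}\to\mathbb R$ be convex and differentiable with Lipschitz continuous gradient $\nabla\varphi=(\nabla_1\varphi,\dots,\nabla_m\varphi)$. Write $f^*$ for the Fenchel conjugate, $(f\,\square\,h)(x)=\inf_y(f(y)+h(x-y))$ for infimal convolution, $\partial f$ for the subdifferential, and $A\,\square\,B=(A^{-1}+B^{-1})^{-1}$ for the parallel sum of set-valued operators. Let $\mathcal P$ be the set of solutions of the primal problem $$\min_{x\in\boldsymbol{\mathcal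 K}}\ -\sum_{i=1}^m\langle x_i,z_i\rangle+\sum_{k=1}^s(\ell_k\,\square\,g_k)\Big(\sum_{i=1}^mL_{k,i}x_i-r_k\Big)+\varphi(x),$$ and $\mathcal D$ the set of solutions of the dual problem $$\min_{v\in\boldsymbol{\mathcal G}}\ \Big(\varphi^*\,\square\,\sum_{i=1}^m f_i^*\Big)\Big(\big(z_i-\sum_{k=1}^sL_{k,i}^*v_k\big)_{1\le i\le m}\Big)+\sum_{k=1}^s\big(\ell_k^*(v_k)+g_k^*(v_k)+\langle v_k,r_k\rangle\big),$$ where $f_i=0$ for all $i$ (so $f_i^*$ is the indicator function of $\{0\}$, the sum $\sum_i f_i^*$ is the function $u\mapsto\sum_i f_i^*(u_i)$ on $\boldsymbol{\mathcal K}$, and the first term is just $\varphi^*$). Suppose that $\mathcal P\neq\varnothing$ and that there are $\hat x\in\boldsymbol{\mathcal K}$ and $\hat v\in\boldsymbol{\mathcal G}$ with $$\hat v_k\in(\partial\ell_k\,\square\,\partial g_k)\Big(\sum_{j}L_{k,j}\hat x_j-r_k\Big)\ (1\le k\le s),\qquad z_i=\sum_{k}L_{k,i}^*\hat v_k+\nabla_i\varphi(\hat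 x)\ (1\le i\le m).$$ **Metrics and constants.** A bounded operator $U$ is strongly positive if $\langle Ux,x\rangle\ge\chi\|x\|^2$ for all $x$ and some $\chi>0$; put $\|x\|_U^2=\langle Ux,x\rangle$ and $\operatorname{prox}^U_f x=\operatorname{argmin}_y\big(f(y)+\tfrac12\|x-y\|_U^2\big)$. Let $V_i$ on $\mathcal K_i$ and $W_k$ on $\mathcal G_k$ be bounded, self-adjoint and strongly positive, and let $\nu_0,\mu_0>0$ be such that for all $x,y\in\boldsymbol{\mathcal K}$ and $v,w\in\boldsymbol{\mathcal G}$ $$\sum_i\langle x_i-y_i,\nabla_i\varphi(x)-\nabla_i\varphi(y)\rangle\ge\nu_0\sum_i\|\nabla_i\varphi(x)-\nabla_i\varphi(y)\|_{V_i}^2,$$ $$\sum_k\langle v_k-w_k,\nabla\ell_k^*(v_k)-\nabla\ell_k^*(w_k)\rangle\ge\mu_0\sum_k\|\nabla\ell_k^*(v_k)-\nabla\ell_k^*(w_k)\|_{W_k}^2.$$ Let $\boldsymbol Lx=(\sum_iL_{k,i}x_i)_k$, $\boldsymbol Vx=(V_ix_i)_i$, $\boldsymbol Wv=(W_kv_k)_k$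 and $$\beta=\min\big\{\nu_0,\ \mu_0\big(1-\|\sqrt{\boldsymbol W}\boldsymbol L\sqrt{\boldsymbol V}\|^2\big)\big\}.$$ Assume $2\beta>1$. Let $\varepsilon\in\left]0,\min\{1,\beta\}\right[$, and let $(\lambda_n)_{n\in\mathbb N}$ in $[\varepsilon,1]$ and $(\alpha_n)_{n\in\mathbb N}$ in $[0,1-\varepsilon]$ be sequences of real numbers. **Algorithm.** On a probability space let $(a_{i,n})_{n}$ be $\mathcal K_i$-valued and $(b_{k,n})_{n}$ be $\mathcal G_k$-valued square integrable random processes, and let $x_{i,0}$ and $v_{k,0}$ be square integrable random vectors in $\mathcal K_i$ and $\mathcal G_k$; set $x_{i,-1}=x_{i,0}$, $v_{k,-1}=v_{k,0}$. For every $n\in\mathbb N$ and all $i,k$ iterate $$\begin{aligned} c_{i,n}&=x_{i,n}+\alpha_n(x_{i,n}-x_{i,n-1}),\qquad d_{k,n}=v_{k,n}+\alpha_n(v_{k,n}-v_{k,n-1}),\\ s_{i,n}&=c_{i,n}-V_i(a_{i,n}-z_i),\qquad y_{i,n}=s_{i,n}-V_i\textstyle\sum_kL_{k,i}^*d_{k,n},\\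 q_{k,n}&=\operatorname{prox}_{g_k^*}^{W_k^{-1}}\Big(d_{k,n}+W_k\big(\textstyle\sum_iL_{k,i}y_{i,n}-b_{k,n}-r_k\big)\Big),\qquad v_{k,n+1}=v_{k,n}+\lambda_n(q_{k,n}-v_{k,n}),\\ p_{i,n}&=s_{i,n}-V_i\textstyle\sum_kL_{k,i}^*q_{k,n},\qquad x_{i,n+1}=x_{i,n}+\lambda_n(p_{i,n}-x_{i,n}). \end{aligned}$$ Let $\mathcal F_n$ be the $\sigma$-algebra generated by all $x_{i,j},v_{k,j}$ with $0\le j\le n$, and write $c_n=(c_{1,n},\dots,c_{m,n})$. **Assumptions.** 1. For every $n$, almost surely $\mathsf E[a_{i,n}\mid\mathcal F_n]=\nabla_i\varphi(c_n)$ for all $i$ and $\mathsf E[b_{k,n}\mid\mathcal F_n]=\nabla\ell_k^*(d_{k,n})$ for all $k$. 2. $\sum_{n}\mathsf E\big[\sum_i\|a_{i,n}-\nabla_i\varphi(c_n)\|^2+\sum_k\|b_{k,n}-\nabla\ell_k^*(d_{k,n})\|^2\,\big|\,\mathcal F_n\big]<+\infty$ almost surely. 3. $\sup_n\|x_{i,n}-x_{i,n-1}\|<\infty$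 for all $i$ and $\sup_n\|v_{k,n}-v_{k,n-1}\|<\infty$ for all $k$, almost surely, and $\sum_n\alpha_n<+\infty$. **Conclusion.** There are random vectors $\bar x=(\bar x_1,\dots,\bar x_m)$ and $\bar v=(\bar v_1,\dots,\bar v_s)$ with $(\bar x,\bar v)\in\mathcal P\times\mathcal D$ almost surely, such that the following hold. Here a function $f$ is called uniformly convex at $x\in\operatorname{dom}f$ if there is a nondecreasing $\theta\colon[0,+\infty[\to[0,+\infty]$ vanishing only at $0$ with $f(tx+(1-t)y)+t(1-t)\theta(\|x-y\|)\le tf(x)+(1-t)f(y)$ for all $y\in\operatorname{dom}f$ and $t\in\left]0,1\right[$. 1. Almost surely, $x_{i,n}\rightharpoonup\bar x_i$ weakly for every $i$ and $v_{k,n}\rightharpoonup\bar v_k$ weakly for every $k$. 2. For almost every $\omega$: if $\varphi$ is uniformly convex at $\bar x(\omega)$, then $x_{i,n}(\omega)\to\bar x_i(\omega)$ strongly for every $i$. 3. For every $j\in\{1,\dots,s\}$ and almost every $\omega$: if $\ell_j^*$ is uniformly convex at $\bar v_j(\omega)$, then $v_{j,n}(\omega)\to\bar v_j(\omega)$ strongly.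 4. If $\varphi(x)=\sum_{i=1}^mh_i(x_i)$ for all $x\in\boldsymbol{\mathcal K}$, with convex differentiable functions $h_i\colon\mathcal K_i\to\mathbb R$, then for every $j\in\{1,\dots,m\}$ and almost every $\omega$: if $h_j$ is uniformly convex at $\bar x_j(\omega)$, then $x_{j,n}(\omega)\to\bar x_j(\omega)$ strongly. -/

import Mathlib

open Filter Topology MeasureTheory
open scoped NNReal ENNReal RealInnerProductSpace Pointwise

noncomputable section

namespace StochPD

/-! ### Convex analysis in real Hilbert spaces -/

section Convex

variable {H : Type*} [NormedAddCommGroup H] [InnerProductSpace ℝ H]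

/-- The class `Γ₀(H)` of proper, lower semicontinuous, convex functions `H → ]-∞, +∞]`. -/
structure IsGammaZero (f : H → EReal) : Prop where
  ne_bot : ∀ x, f x ≠ ⊥
  exists_ne_top : ∃ x, f x ≠ ⊤
  lsc : LowerSemicontinuous f
  convex : ∀ x y : H, ∀ a : ℝ, 0 < a → a < 1 →
    f (a • x + (1 - a) • y) ≤ (a : EReal) * f x + ((1 - a : ℝ) : EReal) * f y

/-- Strong convexity (for some modulus `ρ > 0`) of an extended-real-valued function. -/
def IsStronglyConvex (f : H → EReal) : Prop :=
  ∃ ρ : ℝ, 0 < ρ ∧ ∀ x y : H, ∀ a : ℝ, 0 < a → a < 1 →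
    f (a • x + (1 - a) • y) + ((a * (1 - a) * (ρ / 2) * ‖x - y‖ ^ 2 : ℝ) : EReal) ≤
      (a : EReal) * f x + ((1 - a : ℝ) : EReal) * f y

/-- `f` is uniformly convex at the point `x ∈ dom f`: there is an increasing modulus
`θ : [0, +∞[ → [0, +∞]` vanishing only at `0` such that
`f (a x + (1 - a) y) + a (1 - a) θ ‖x - y‖ ≤ a f x + (1 - a) f y`
for all `y ∈ dom f` and all `a ∈ ]0, 1[`. -/
def UniformlyConvexAt (f : H → EReal) (x : H) : Prop :=
  f x ≠ ⊤ ∧ ∃ θ : ℝ≥0 → ℝ≥0∞, Monotone θ ∧ (∀ t, θ t = 0 ↔ t = 0) ∧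
    ∀ y : H, f y ≠ ⊤ → ∀ a : ℝ, 0 < a → a < 1 →
      f (a • x + (1 - a) • y) + ((a * (1 - a) : ℝ) : EReal) * (θ ‖x - y‖₊ : EReal) ≤
        (a : EReal) * f x + ((1 - a : ℝ) : EReal) * f y

/-- The Fenchel conjugate `f* (u) = sup_x (⟪u, x⟫ - f x)`. -/
def conj (f : H → EReal) (u : H) : EReal :=
  ⨆ x : H, ((⟪u, x⟫ : ℝ) : EReal) - f x

/-- The infimal convolution `(f □ g)(x) = inf_y (f y + g (x - y))`. -/
def infConv (f g : H → EReal) (x : H) : EReal :=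
  ⨅ y : H, f y + g (x - y)

/-- The subdifferential of `f`, as a set-valued operator. -/
def subdiff (f : H → EReal) (x : H) : Set H :=
  {u | ∀ y : H, f x + ((⟪y - x, u⟫ : ℝ) : EReal) ≤ f y}

/-- The inverse of a set-valued operator. -/
def opInv (A : H → Set H) (u : H) : Set H :=
  {x | u ∈ A x}

/-- The parallel sum `A □ B = (A⁻¹ + B⁻¹)⁻¹` of two set-valued operators. -/
def parallelSum (A B : H → Set H) : H → Set H :=
  opInv (fun u => opInv A u + opInv B u)

/-- The set of global minimizers. -/
def argminSet (f : H → EReal) : Set H :=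
  {x | ∀ y : H, f x ≤ f y}

/-- The squared norm `‖x‖_U² = ⟪U x, x⟫`. -/
def sqNorm (U : H →L[ℝ] H) (x : H) : ℝ :=
  ⟪U x, x⟫

/-- Self-adjoint and strongly positive bounded operators. -/
structure IsSAStronglyPositive [CompleteSpace H] (U : H →L[ℝ] H) : Prop where
  isSelfAdjoint : IsSelfAdjoint U
  bounded_below : ∃ χ : ℝ, 0 < χ ∧ ∀ x : H, χ * ‖x‖ ^ 2 ≤ ⟪U x, x⟫

/-- The proximity operator `prox_f^U x = argmin_y (f y + ½ ‖x - y‖_U²)` in the metric `U`.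
(For `f ∈ Γ₀(H)` and `U` self-adjoint and strongly positive, the minimizer exists and is unique.) -/
def prox (U : H →L[ℝ] H) (f : H → EReal) (x : H) : H :=
  Classical.epsilon fun p => p ∈ argminSet fun y => f y + ((1 / 2 * sqNorm U (x - y) : ℝ) : EReal)

/-- The gradient of the conjugate of `f`, for those `f` whose conjugate is finite and
differentiable (e.g. `f ∈ Γ₀(H)` strongly convex). -/
def gradConj [CompleteSpace H] (f : H → EReal) (u : H) : H :=
  gradient (fun w => (conj f w).toReal) u

end Convex

/-! ### The positive square root of a positive operator -/

section Sqrt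

variable {H : Type*} [NormedAddCommGroup H] [InnerProductSpace ℝ H]

open Classical in
/-- The positive square root of a bounded positive operator. -/
def opSqrt (T : H →L[ℝ] H) : H →L[ℝ] H :=
  if h : ∃ S : H →L[ℝ] H, S.IsPositive ∧ S ∘L S = T then h.choose else 0

/-- If `‖1 - T‖ < 1` and `T` is self-adjoint, then `T` has a positive square root `1 - B`, where
`B` is the fixed point of `B ↦ ((1 - T) + B²) / 2` in a ball of radius less than one. -/
theorem exists_sqrt_of_norm_lt [CompleteSpace H] (T : H →L[ℝ] H) (hT : IsSelfAdjoint T)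
    (h : ‖1 - T‖ < 1) : ∃ S : H →L[ℝ] H, S.IsPositive ∧ S * S = T := by
  set A : H →L[ℝ] H := 1 - T with hA
  have hAsa : IsSelfAdjoint A := (IsSelfAdjoint.one _).sub hT
  have hA0 : 0 ≤ ‖A‖ := norm_nonneg A
  let F : (H →L[ℝ] H) → (H →L[ℝ] H) := fun B => (1 / 2 : ℝ) • (A + B * B)
  let s : Set (H →L[ℝ] H) := {B | IsSelfAdjoint B} ∩ Metric.closedBall 0 ‖A‖
  have hs : IsComplete s := by
    refine IsClosed.isComplete (IsClosed.inter ?_ Metric.isClosed_closedBall)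
    exact isClosed_eq continuous_star continuous_id
  have hF : Set.MapsTo F s s := by
    rintro B ⟨hB1, hB2⟩
    rw [mem_closedBall_zero_iff] at hB2
    have hB1' : star B = B := hB1
    refine ⟨?_, ?_⟩
    · change star ((1 / 2 : ℝ) • (A + B * B)) = _
      rw [star_smul, star_add, star_mul, hB1', hAsa.star_eq]
      simp [F]
    · rw [mem_closedBall_zero_iff]
      have h1 : ‖B * B‖ ≤ ‖A‖ * ‖A‖ := (norm_mul_le B B).trans (by gcongr)
      have h2 : ‖F B‖ = (1 / 2) * ‖A + B * B‖ := by
        change ‖(1 / 2 : ℝ) • (A + B * B)‖ = _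
        rw [norm_smul]; norm_num
      have h3 := norm_add_le A (B * B)
      nlinarith
  have hK : ContractingWith ‖A‖₊ (hF.restrict F s s) := by
    refine ⟨by exact_mod_cast h, LipschitzWith.of_dist_le_mul ?_⟩
    rintro ⟨B, hB⟩ ⟨C, hC⟩
    have hB2 := mem_closedBall_zero_iff.1 hB.2
    have hC2 := mem_closedBall_zero_iff.1 hC.2
    change dist (F B) (F C) ≤ ‖A‖ * dist B C
    rw [dist_eq_norm, dist_eq_norm]
    have h1 : F B - F C = (1 / 2 : ℝ) • (B * (B - C) + (B - C) * C) := by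
      simp only [F, ← smul_sub]; congr 1; noncomm_ring
    rw [h1, norm_smul]
    have h2 := norm_add_le (B * (B - C)) ((B - C) * C)
    have h3 : ‖B * (B - C)‖ ≤ ‖A‖ * ‖B - C‖ := (norm_mul_le _ _).trans (by gcongr)
    have h4 : ‖(B - C) * C‖ ≤ ‖B - C‖ * ‖A‖ := (norm_mul_le _ _).trans (by gcongr)
    have h5 : ‖(1 / 2 : ℝ)‖ = 1 / 2 := by norm_num
    rw [h5]
    linarith
  obtain ⟨B, hB, hfix, -⟩ := hK.exists_fixedPoint' hs hF (x := 0)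
    ⟨by simp, by simp⟩ (edist_ne_top _ _)
  have hB2 : ‖B‖ ≤ ‖A‖ := mem_closedBall_zero_iff.1 hB.2
  have hsa : IsSelfAdjoint (1 - B) := (IsSelfAdjoint.one _).sub hB.1
  refine ⟨1 - B, ⟨hsa.isSymmetric, fun x => ?_⟩, ?_⟩
  · change 0 ≤ ⟪(1 - B) x, x⟫
    have h1 : ⟪(1 - B) x, x⟫ = ‖x‖ ^ 2 - ⟪B x, x⟫ := by
      simp [inner_sub_left]
    have h2 : ⟪B x, x⟫ ≤ ‖B x‖ * ‖x‖ := real_inner_le_norm _ _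
    have h3 : ‖B x‖ ≤ 1 * ‖x‖ := B.le_of_opNorm_le (hB2.trans h.le) x
    rw [h1]
    nlinarith [norm_nonneg x]
  · have h1 : (1 / 2 : ℝ) • (A + B * B) = B := hfix
    have h2 : A + B * B = (2 : ℝ) • B := by
      rw [← h1, smul_smul, h1]; norm_num
    have h3 : B * B = (2 : ℝ) • B - A := by rw [← h2]; abel
    have h4 : (1 - B) * (1 - B) = 1 - (2 : ℝ) • B + B * B := by
      rw [two_smul]; noncomm_ring
    rw [h4, h3, hA]; abel

/-- A self-adjoint strongly positive operator has a positive square root. -/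
theorem exists_sqrt [CompleteSpace H] (T : H →L[ℝ] H) (hT : IsSAStronglyPositive T) :
    ∃ S : H →L[ℝ] H, S.IsPositive ∧ S ∘L S = T := by
  obtain ⟨χ, hχ, hb⟩ := hT.bounded_below
  set M : ℝ := ‖T‖ + χ with hM
  have hM0 : 0 < M := by positivity
  have hTM : ‖T‖ ≤ M := by rw [hM]; linarith
  set c : ℝ := M ^ 2 / χ with hc
  have hc0 : 0 < c := by positivity
  set κ : ℝ := 1 - χ / c with hκ
  have hχM : χ ≤ M := by rw [hM]; linarith [norm_nonneg T]
  have hχc : χ ≤ c := by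
    rw [hc, le_div_iff₀ hχ]; nlinarith
  have hκ0 : 0 ≤ κ := by
    rw [hκ, sub_nonneg, div_le_one hc0]; exact hχc
  have hκ1 : κ < 1 := by rw [hκ]; linarith [div_pos hχ hc0]
  have hnorm : ‖1 - c⁻¹ • T‖ < 1 := by
    refine lt_of_le_of_lt ((1 - c⁻¹ • T).opNorm_le_bound (Real.sqrt_nonneg κ) fun x => ?_)
      (by rw [← Real.sqrt_one]; exact Real.sqrt_lt_sqrt hκ0 hκ1)
    have h1 : ‖(1 - c⁻¹ • T) x‖ ^ 2 = ‖x‖ ^ 2 - 2 * (c⁻¹ * ⟪T x, x⟫) + (c⁻¹ * ‖T x‖) ^ 2 := by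
      change ‖x - c⁻¹ • T x‖ ^ 2 = _
      rw [norm_sub_sq_real, real_inner_smul_right, real_inner_comm, norm_smul, Real.norm_eq_abs,
        abs_of_pos (inv_pos.2 hc0)]
    have h2 : ‖T x‖ ≤ M * ‖x‖ := T.le_of_opNorm_le hTM x
    have h3 : (c⁻¹ * ‖T x‖) ^ 2 ≤ χ / c * ‖x‖ ^ 2 := by
      calc (c⁻¹ * ‖T x‖) ^ 2 ≤ (c⁻¹ * (M * ‖x‖)) ^ 2 := by gcongr
        _ = χ / c * ‖x‖ ^ 2 := by rw [hc]; field_simp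
    have h4 : c⁻¹ * (χ * ‖x‖ ^ 2) ≤ c⁻¹ * ⟪T x, x⟫ :=
      mul_le_mul_of_nonneg_left (hb x) (inv_pos.2 hc0).le
    have h5 : c⁻¹ * (χ * ‖x‖ ^ 2) = χ / c * ‖x‖ ^ 2 := by ring
    have h6 : ‖(1 - c⁻¹ • T) x‖ ^ 2 ≤ κ * ‖x‖ ^ 2 := by
      rw [h1, hκ]; linarith
    calc ‖(1 - c⁻¹ • T) x‖ = √(‖(1 - c⁻¹ • T) x‖ ^ 2) := (Real.sqrt_sq (norm_nonneg _)).symm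
      _ ≤ √(κ * ‖x‖ ^ 2) := Real.sqrt_le_sqrt h6
      _ = √κ * ‖x‖ := by rw [Real.sqrt_mul hκ0, Real.sqrt_sq (norm_nonneg _)]
  have hsa : IsSelfAdjoint (c⁻¹ • T) := by
    change star (c⁻¹ • T) = _
    rw [star_smul, hT.isSelfAdjoint.star_eq]; simp
  obtain ⟨S, hS, hS2⟩ := exists_sqrt_of_norm_lt (c⁻¹ • T) hsa hnorm
  refine ⟨√c • S, ⟨?_, fun x => ?_⟩, ?_⟩
  · intro x y
    have := hS.1 x y
    change ⟪√c • S x, y⟫ = ⟪x, √c • S y⟫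
    rw [real_inner_smul_left, real_inner_smul_right]
    exact congrArg _ this
  · have := hS.2 x
    change 0 ≤ ⟪S x, x⟫ at this
    change 0 ≤ ⟪√c • S x, x⟫
    rw [real_inner_smul_left]
    exact mul_nonneg (Real.sqrt_nonneg _) this
  · change (√c • S) * (√c • S) = T
    rw [smul_mul_smul_comm, hS2, Real.mul_self_sqrt hc0.le, smul_smul, mul_inv_cancel₀ hc0.ne',
      one_smul]

/-- The defining property of `opSqrt`. -/
theorem opSqrt_spec [CompleteSpace H] (T : H →L[ℝ] H) (hT : IsSAStronglyPositive T) :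
    (opSqrt T).IsPositive ∧ opSqrt T ∘L opSqrt T = T := by
  have h := exists_sqrt T hT
  rw [opSqrt, dif_pos h]
  exact h.choose_spec

end Sqrt

/-! ### Block operators on Hilbert direct sums -/

section Blocks

variable {m s : ℕ} {K : Fin m → Type*} {G : Fin s → Type*}
  [∀ i, NormedAddCommGroup (K i)] [∀ i, InnerProductSpace ℝ (K i)]
  [∀ k, NormedAddCommGroup (G k)] [∀ k, InnerProductSpace ℝ (G k)]

/-- The operator `x ↦ (∑ i, L k i (x i))_k` between the Hilbert direct sums. -/
def blockOp (L : ∀ (k : Fin s) (i : Fin m), K i →L[ℝ] G k) : PiLp 2 K →L[ℝ] PiLp 2 G :=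
  ((PiLp.continuousLinearEquiv 2 ℝ G).symm : (∀ k, G k) →L[ℝ] PiLp 2 G) ∘L
    ContinuousLinearMap.pi fun k => ∑ i, L k i ∘L PiLp.proj 2 K i

/-- The diagonal operator `x ↦ (V i (x i))_i` on the Hilbert direct sum. -/
def blockDiag (V : ∀ i, K i →L[ℝ] K i) : PiLp 2 K →L[ℝ] PiLp 2 K :=
  ((PiLp.continuousLinearEquiv 2 ℝ K).symm : (∀ i, K i) →L[ℝ] PiLp 2 K) ∘L
    ContinuousLinearMap.pi fun i => V i ∘L PiLp.proj 2 K i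

/-- The diagonal operator of self-adjoint strongly positive operators is again one. -/
theorem blockDiag_isSAStronglyPositive [∀ i, CompleteSpace (K i)] (V : ∀ i, K i →L[ℝ] K i)
    (hV : ∀ i, IsSAStronglyPositive (V i)) : IsSAStronglyPositive (blockDiag V) := by
  have happ : ∀ (x : PiLp 2 K) i, blockDiag V x i = V i (x i) := fun _ _ => rfl
  constructor
  · rw [ContinuousLinearMap.isSelfAdjoint_iff_isSymmetric]
    intro x y
    change ⟪blockDiag V x, y⟫ = ⟪x, blockDiag V y⟫
    rw [PiLp.inner_apply, PiLp.inner_apply]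
    exact Finset.sum_congr rfl fun i _ => by
      rw [happ, happ]; exact (hV i).isSelfAdjoint.isSymmetric (x i) (y i)
  · choose χ hχ hb using fun i => (hV i).bounded_below
    obtain ⟨δ, hδ, hδχ⟩ : ∃ δ : ℝ, 0 < δ ∧ ∀ i, δ ≤ χ i := by
      rcases isEmpty_or_nonempty (Fin m) with h | h
      · exact ⟨1, one_pos, fun i => h.elim i⟩
      · obtain ⟨i₀, hi₀⟩ := Finite.exists_min χ
        exact ⟨χ i₀, hχ i₀, hi₀⟩
    refine ⟨δ, hδ, fun x => ?_⟩
    rw [PiLp.inner_apply, PiLp.norm_sq_eq_of_L2, Finset.mul_sum]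
    refine Finset.sum_le_sum fun i _ => ?_
    rw [happ]
    exact (mul_le_mul_of_nonneg_right (hδχ i) (sq_nonneg _)).trans (hb i (x i))

/-- The constant `β = min {ν₀, μ₀ (1 - ‖√W L √V‖²)}`. -/
def betaConst (V : ∀ i, K i →L[ℝ] K i) (W : ∀ k, G k →L[ℝ] G k)
    (L : ∀ (k : Fin s) (i : Fin m), K i →L[ℝ] G k) (ν₀ μ₀ : ℝ) : ℝ :=
  min ν₀ (μ₀ * (1 - ‖opSqrt (blockDiag W) ∘L blockOp L ∘L opSqrt (blockDiag V)‖ ^ 2))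

end Blocks

/-! ### The primal and dual minimization problems -/

section Problems

variable {m s : ℕ} {K : Fin m → Type*} {G : Fin s → Type*}
  [∀ i, NormedAddCommGroup (K i)] [∀ i, InnerProductSpace ℝ (K i)] [∀ i, CompleteSpace (K i)]
  [∀ k, NormedAddCommGroup (G k)] [∀ k, InnerProductSpace ℝ (G k)] [∀ k, CompleteSpace (G k)]

/-- The primal objective
`∑ i, (f i (x i) - ⟪x i, z i⟫) + ∑ k, (ℓ k □ g k) (∑ i, L k i (x i) - r k) + φ x`. -/
def primalObjective (f : ∀ i, K i → EReal) (g ℓ : ∀ k, G k → EReal)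
    (L : ∀ (k : Fin s) (i : Fin m), K i →L[ℝ] G k) (z : ∀ i, K i) (r : ∀ k, G k)
    (φ : PiLp 2 K → ℝ) (x : PiLp 2 K) : EReal :=
  ∑ i, (f i (x i) - ((⟪x i, z i⟫ : ℝ) : EReal)) +
    ∑ k, infConv (ℓ k) (g k) (∑ i, L k i (x i) - r k) + (φ x : EReal)

/-- The dual objective
`(φ* □ (∑ i, f i *)) ((z i - ∑ k, (L k i)* (v k))_i) + ∑ k, (ℓ k * (v k) + g k * (v k) + ⟪v k, r k⟫)`,
where `∑ i, f i *` is the function `u ↦ ∑ i, f i * (u i)` on the direct sum. -/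
def dualObjective (f : ∀ i, K i → EReal) (g ℓ : ∀ k, G k → EReal)
    (L : ∀ (k : Fin s) (i : Fin m), K i →L[ℝ] G k) (z : ∀ i, K i) (r : ∀ k, G k)
    (φ : PiLp 2 K → ℝ) (v : PiLp 2 G) : EReal :=
  infConv (conj fun x : PiLp 2 K => (φ x : EReal)) (fun u : PiLp 2 K => ∑ i, conj (f i) (u i))
      (WithLp.toLp 2 fun i => z i - ∑ k, ContinuousLinearMap.adjoint (L k i) (v k)) +
    ∑ k, (conj (ℓ k) (v k) + conj (g k) (v k) + ((⟪v k, r k⟫ : ℝ) : EReal))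

/-- The set of solutions of the primal problem. -/
def primalSolutions (f : ∀ i, K i → EReal) (g ℓ : ∀ k, G k → EReal)
    (L : ∀ (k : Fin s) (i : Fin m), K i →L[ℝ] G k) (z : ∀ i, K i) (r : ∀ k, G k)
    (φ : PiLp 2 K → ℝ) : Set (PiLp 2 K) :=
  argminSet (primalObjective f g ℓ L z r φ)

/-- The set of solutions of the dual problem. -/
def dualSolutions (f : ∀ i, K i → EReal) (g ℓ : ∀ k, G k → EReal)
    (L : ∀ (k : Fin s) (i : Fin m), K i →L[ℝ] G k) (z : ∀ i, K i) (r : ∀ k, G k)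
    (φ : PiLp 2 K → ℝ) : Set (PiLp 2 G) :=
  argminSet (dualObjective f g ℓ L z r φ)

/-- The system of inclusions
`z i ∈ ∂(f i)(x i) + ∑ k, (L k i)* ((∂ℓ k □ ∂g k)(∑ j, L k j (x j) - r k)) + ∇_i φ(x)`, `i = 1, …, m`,
read as one inclusion in the direct sum: one selection `v k` of the `k`-th parallel sum serves
all the indices `i`. -/
def SolvesInclusion (f : ∀ i, K i → EReal) (g ℓ : ∀ k, G k → EReal)
    (L : ∀ (k : Fin s) (i : Fin m), K i →L[ℝ] G k) (z : ∀ i, K i) (r : ∀ k, G k)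
    (φ : PiLp 2 K → ℝ) (x : PiLp 2 K) : Prop :=
  ∃ v : ∀ k, G k,
    (∀ k, v k ∈ parallelSum (subdiff (ℓ k)) (subdiff (g k)) (∑ j, L k j (x j) - r k)) ∧
    ∀ i, z i ∈ subdiff (f i) (x i) +
      {∑ k, ContinuousLinearMap.adjoint (L k i) (v k) + gradient φ x i}

end Problems

/-! ### The algorithm -/

section Algorithm

variable {m s : ℕ} {K : Fin m → Type*} {G : Fin s → Type*}
  [∀ i, NormedAddCommGroup (K i)] [∀ i, InnerProductSpace ℝ (K i)] [∀ i, CompleteSpace (K i)]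
  [∀ k, NormedAddCommGroup (G k)] [∀ k, InnerProductSpace ℝ (G k)] [∀ k, CompleteSpace (G k)]

/-- The inertial extrapolation `x_n + α_n (x_n - x_{n-1})`, with the convention `x_{-1} = x_0`
(which is what truncated subtraction in `ℕ` gives). -/
def extrapolate {H : Type*} [NormedAddCommGroup H] [InnerProductSpace ℝ H] (α : ℕ → ℝ)
    (x : ℕ → H) (n : ℕ) : H :=
  x n + α n • (x n - x (n - 1))

/-- The sequences `x i n`, `v k n` are generated by the inertial primal-dual iteration
from the inputs `a i n` and `b k n`:
`c_{i,n} = x_{i,n} + α_n (x_{i,n} - x_{i,n-1})`, `d_{k,n} = v_{k,n} + α_n (v_{k,n} - v_{k,n-1})`,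
followed by the steps listed as fields. -/
structure IsIteration (V : ∀ i, K i →L[ℝ] K i) (W : ∀ k, G k →L[ℝ] G k)
    (L : ∀ (k : Fin s) (i : Fin m), K i →L[ℝ] G k) (z : ∀ i, K i) (r : ∀ k, G k)
    (g : ∀ k, G k → EReal) (α lam : ℕ → ℝ) (a : ∀ i, ℕ → K i) (b : ∀ k, ℕ → G k)
    (x σ y p c : ∀ i, ℕ → K i) (v q d : ∀ k, ℕ → G k) : Prop where
  eq_c : ∀ i n, c i n = extrapolate α (x i) n
  eq_d : ∀ k n, d k n = extrapolate α (v k) n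
  eq_s : ∀ i n, σ i n = c i n - V i (a i n - z i)
  eq_y : ∀ i n, y i n = σ i n - V i (∑ k, ContinuousLinearMap.adjoint (L k i) (d k n))
  eq_q : ∀ k n, q k n = prox (W k).inverse (conj (g k))
    (d k n + W k (∑ i, L k i (y i n) - b k n - r k))
  eq_v : ∀ k n, v k (n + 1) = v k n + lam n • (q k n - v k n)
  eq_p : ∀ i n, p i n = σ i n - V i (∑ k, ContinuousLinearMap.adjoint (L k i) (q k n))
  eq_x : ∀ i n, x i (n + 1) = x i n + lam n • (p i n - x i n)

/-- The σ-algebra `σ(x_0, …, x_n)` generated by all the components of the first `n + 1` iterates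
`(x_{1,j}, …, x_{m,j}, v_{1,j}, …, v_{s,j})`. -/
abbrev historySigma {Ω : Type*} [∀ i, MeasurableSpace (K i)] [∀ k, MeasurableSpace (G k)]
    (x : ∀ i, ℕ → Ω → K i) (v : ∀ k, ℕ → Ω → G k) (n : ℕ) : MeasurableSpace Ω :=
  ⨆ j : Fin (n + 1),
    (⨆ i, MeasurableSpace.comap (x i j) inferInstance) ⊔
    (⨆ k, MeasurableSpace.comap (v k j) inferInstance)

end Algorithm

/-- Weak convergence of a sequence in a real Hilbert space. -/
def WeaklyTendsto {H : Type*} [NormedAddCommGroup H] [InnerProductSpace ℝ H] (u : ℕ → H)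
    (l : H) : Prop :=
  Tendsto (fun n => toWeakSpace ℝ H (u n)) atTop (𝓝 (toWeakSpace ℝ H l))

end StochPD

end

open StochPD

/-! Write `L`, `V`, `W` for the block operators. On the primal-dual space put A(x, v) = (-z + L* v)
× (r - L x + (∂g)⁻¹ v), which is monotone, and B(x, v) = (∇φ(x), ∇ℓ*(v)), which is cocoercive. The
zeros of A + B are the Kuhn–Tucker points, and subgradient inequalities alone show that each of them
solves both problems (`mem_primalSolutions`, `mem_dualSolutions`).

In the metric M = diag(V⁻¹, W⁻¹ - L V L*) the algorithm is a relaxed inertial forward-backward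
method: (p, q) = (M + A)⁻¹(M w - a), where w = (c, d) is the extrapolated point and the random input
a replaces B w (`IsIteration.mem_pdOperator`). The term L V L* in M makes this implicit system
triangular: one proximity step gives q, and then p is explicit. Positivity of β forces ‖√W L √V‖ <
1, hence M is strongly positive (`opSqrt_bound`); 2β > 1 is the step-size condition in this metric
(`exists_metricInclusion`).

For a zero s, one step bounds ‖z_{n+1} - s‖_M² plus the squared residuals by (1 + α_n)‖z_n - s‖_M²,
plus summable terms, plus a noise term of zero conditional mean (`MetricInclusion.step_le`). The
Robbins–Siegmund theorem (`robbinsSiegmund`) then gives, almost surely, convergence of the distances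
to s and vanishing residuals. The exceptional null set depends on s, so this is used on a countable
dense set of zeros only, which suffices for `opial`. Weak cluster points are zeros by
`MetricInclusion.mem_zeroSet_of_tendsto`, so the iterates converge weakly.

The same estimate makes B(w_n) converge strongly to B at the limit. Subgradients that converge
strongly force strong convergence of the points wherever the function is uniformly convex at the
limit (`UniformlyConvexAt.tendsto`), which yields the last three assertions. -/

namespace StochPD

/-! ### Almost supermartingales and the Robbins–Siegmund theorem. -/

section RobbinsSiegmund

variable {Ω : Type*} {m0 : MeasurableSpace Ω} {P : Measure Ω}

/-- Nonnegative functions whose integrals have bounded partial sums are almost surely summable. -/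
theorem ae_summable_of_sum_integral_le {D : ℕ → Ω → ℝ} (hDi : ∀ n, Integrable (D n) P)
    (hD0 : ∀ n ω, 0 ≤ D n ω) {c : ℝ} (h : ∀ n, ∑ j ∈ Finset.range n, ∫ ω, D j ω ∂P ≤ c) :
    ∀ᵐ ω ∂P, Summable fun n => D n ω := by
  have hs : Summable fun j => ∫ ω, D j ω ∂P :=
    summable_of_sum_range_le (fun j => integral_nonneg (hD0 j)) h
  have hmeas : ∀ j, AEMeasurable (fun ω => ENNReal.ofReal (D j ω)) P := fun j =>
    (hDi j).aestronglyMeasurable.aemeasurable.ennreal_ofReal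
  have h1 : ∫⁻ ω, ∑' j, ENNReal.ofReal (D j ω) ∂P ≠ ∞ := by
    rw [lintegral_tsum hmeas]
    have h2 : ∀ j, ∫⁻ ω, ENNReal.ofReal (D j ω) ∂P = ENNReal.ofReal (∫ ω, D j ω ∂P) := fun j =>
      (ofReal_integral_eq_lintegral_ofReal (hDi j) (ae_of_all _ (hD0 j))).symm
    simp_rw [h2]
    exact hs.tsum_ofReal_ne_top
  filter_upwards [ae_lt_top' (AEMeasurable.tsum hmeas) h1] with ω hω
  have := ENNReal.summable_toReal hω.ne
  simpa only [ENNReal.toReal_ofReal (hD0 _ ω)] using this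

variable [IsProbabilityMeasure P] {ℱ : Filtration ℕ m0}

/-- Convergence of nonnegative almost supermartingales without perturbation. -/
theorem ae_tendsto_of_condExp_add_le {Y D : ℕ → Ω → ℝ} (hY : StronglyAdapted ℱ Y)
    (hYi : ∀ n, Integrable (Y n) P) (hY0 : ∀ n ω, 0 ≤ Y n ω) (hDi : ∀ n, Integrable (D n) P)
    (hD0 : ∀ n ω, 0 ≤ D n ω) (h : ∀ n, P[Y (n + 1) + D n | ℱ n] ≤ᵐ[P] Y n) :
    ∀ᵐ ω ∂P, (∃ l, Tendsto (fun n => Y n ω) atTop (𝓝 l)) ∧ Summable fun n => D n ω := by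
  have hint : ∀ n, ∫ ω, Y (n + 1) ω ∂P + ∫ ω, D n ω ∂P ≤ ∫ ω, Y n ω ∂P := by
    intro n
    have h1 := integral_mono_ae integrable_condExp (hYi n) (h n)
    rw [integral_condExp (ℱ.le n)] at h1
    rwa [← integral_add (hYi _) (hDi _)]
  have hsum : ∀ n, ∫ ω, Y n ω ∂P + ∑ j ∈ Finset.range n, ∫ ω, D j ω ∂P ≤ ∫ ω, Y 0 ω ∂P := by
    intro n
    induction n with
    | zero => simp
    | succ n ih => rw [Finset.sum_range_succ]; linarith [hint n]
  have hDnn : ∀ n, 0 ≤ ∑ j ∈ Finset.range n, ∫ ω, D j ω ∂P := fun n =>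
    Finset.sum_nonneg fun j _ => integral_nonneg (hD0 j)
  have hD := ae_summable_of_sum_integral_le hDi hD0 (c := ∫ ω, Y 0 ω ∂P) fun n => by
    linarith [hsum n, integral_nonneg (μ := P) (f := Y n) (hY0 n)]
  have hsup : Supermartingale Y ℱ P := by
    refine supermartingale_nat hY hYi fun n => ?_
    have h1 : P[Y (n + 1) | ℱ n] ≤ᵐ[P] P[Y (n + 1) + D n | ℱ n] :=
      condExp_mono (hYi _) ((hYi _).add (hDi _)) (ae_of_all _ fun ω => by
        simpa using hD0 n ω)
    exact h1.trans (h n)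
  have hconv := hsup.neg.exists_ae_tendsto_of_bdd (R := (∫ ω, Y 0 ω ∂P).toNNReal) fun n => by
    rw [eLpNorm_one_eq_lintegral_enorm]
    have h2 : ∫⁻ ω, ‖(-Y) n ω‖ₑ ∂P = ENNReal.ofReal (∫ ω, Y n ω ∂P) := by
      rw [ofReal_integral_eq_lintegral_ofReal (hYi n) (ae_of_all _ (hY0 n))]
      refine lintegral_congr fun ω => ?_
      simp [Real.enorm_of_nonneg (hY0 n ω)]
    rw [h2]
    exact ENNReal.ofReal_le_ofReal (by linarith [hsum n, hDnn n])
  filter_upwards [hD, hconv] with ω h1 ⟨l, hl⟩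
  exact ⟨⟨-l, by simpa using hl.neg⟩, h1⟩

/-- Robbins–Siegmund with an additive perturbation. -/
theorem ae_tendsto_of_condExp_add_le_add {X C b : ℕ → Ω → ℝ} (hX : StronglyAdapted ℱ X)
    (hXi : ∀ n, Integrable (X n) P) (hX0 : ∀ n ω, 0 ≤ X n ω) (hCi : ∀ n, Integrable (C n) P)
    (hC0 : ∀ n ω, 0 ≤ C n ω) (hb : StronglyAdapted ℱ b) (hbi : ∀ n, Integrable (b n) P)
    (hbs : ∀ᵐ ω ∂P, Summable fun n => b n ω)
    (h : ∀ n, P[X (n + 1) + C n | ℱ n] ≤ᵐ[P] X n + b n) :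
    ∀ᵐ ω ∂P, (∃ l, Tendsto (fun n => X n ω) atTop (𝓝 l)) ∧ Summable fun n => C n ω := by
  -- Localization: the process is stopped once the accumulated |b| exceeds k. Membership in `A k n`
  -- is known at time n, and absolute values are taken because b may change sign.
  let A : ℕ → ℕ → Set Ω := fun k n => {ω | ∑ j ∈ Finset.range (n + 1), |b j ω| ≤ k}
  have hAm : ∀ k n, MeasurableSet[ℱ n] (A k n) := by
    intro k n
    refine StronglyMeasurable.measurableSet_le ?_ stronglyMeasurable_const
    refine Finset.stronglyMeasurable_fun_sum _ fun j hj => ?_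
    exact ((hb j).mono (ℱ.mono (by simpa [Nat.lt_succ_iff] using hj))).norm
  have hAanti : ∀ k n, A k (n + 1) ⊆ A k n := by
    intro k n ω hω
    have h1 : ∑ j ∈ Finset.range (n + 1 + 1), |b j ω| ≤ k := hω
    rw [Finset.sum_range_succ] at h1
    change ∑ j ∈ Finset.range (n + 1), |b j ω| ≤ k
    linarith [abs_nonneg (b (n + 1) ω)]
  have key : ∀ k : ℕ, ∀ᵐ ω ∂P, (∀ n, ω ∈ A k n) →
      (∃ l, Tendsto (fun n => X n ω) atTop (𝓝 l)) ∧ Summable fun n => C n ω := by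
    intro k
    let β : ℕ → Ω → ℝ := fun n => (A k n).indicator fun ω => |b n ω|
    -- X (n + 1) is cut by the event of time n, not n + 1, so that the indicator can be pulled out
    -- of the conditional expectation given ℱ n.
    let Z : ℕ → Ω → ℝ := fun n => n.casesOn (X 0) fun n => (A k n).indicator (X (n + 1))
    let S : ℕ → Ω → ℝ := fun n ω => ∑ j ∈ Finset.range n, β j ω
    have hβ0 : ∀ n ω, 0 ≤ β n ω := fun n ω => Set.indicator_nonneg (fun _ _ => abs_nonneg _) _
    have hβi : ∀ n, Integrable (β n) P := fun n =>
      (hbi n).abs.indicator (ℱ.le n _ (hAm k n))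
    have hβm : ∀ n, StronglyMeasurable[ℱ n] (β n) := fun n =>
      (hb n).norm.indicator (hAm k n)
    have hSm : ∀ n, StronglyMeasurable[ℱ n] (S (n + 1)) := fun n =>
      Finset.stronglyMeasurable_fun_sum _ fun j hj =>
        (hβm j).mono (ℱ.mono (by simpa [Nat.lt_succ_iff] using hj))
    have hSi : ∀ n, Integrable (S n) P := fun n => integrable_finsetSum _ fun j _ => hβi j
    -- Off `A k n` the increment is zero, so S stays below k forever. Hence Z - S + k is a
    -- nonnegative process to which the unperturbed case applies.
    have hSk : ∀ n ω, S n ω ≤ k := by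
      intro n ω
      induction n with
      | zero => simp [S]
      | succ n ih =>
        by_cases hω : ω ∈ A k n
        · refine le_trans (Finset.sum_le_sum fun j _ => ?_) hω
          exact Set.indicator_le_self' (fun _ _ => abs_nonneg _) _
        · have : β n ω = 0 := Set.indicator_of_notMem hω _
          simp only [S, Finset.sum_range_succ, this] at ih ⊢
          simpa using ih
    have hZm : StronglyAdapted ℱ Z := by
      rintro (_ | n)
      · exact hX 0
      · exact (hX (n + 1)).indicator (ℱ.mono n.le_succ _ (hAm k n))
    have hZi : ∀ n, Integrable (Z n) P := by
      rintro (_ | n)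
      · exact hXi 0
      · exact (hXi (n + 1)).indicator (ℱ.le n _ (hAm k n))
    have hZ0 : ∀ n ω, 0 ≤ Z n ω := by
      rintro (_ | n) ω
      · exact hX0 0 ω
      · exact Set.indicator_nonneg (fun _ _ => hX0 _ _) _
    have hZX : ∀ n ω, ω ∈ A k n → Z n ω = X n ω := by
      rintro (_ | n) ω hω
      · rfl
      · exact Set.indicator_of_mem (hAanti k n hω) _
    have hmain := ae_tendsto_of_condExp_add_le (P := P) (ℱ := ℱ)
      (Y := fun n ω => Z n ω - S n ω + k) (D := fun n => (A k n).indicator (C n))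
      (by
        rintro (_ | n)
        · simpa [S, Z, Pi.add_def] using (hX 0).add (stronglyMeasurable_const (b := (k : ℝ)))
        · exact ((hZm (n + 1)).sub ((hSm n).mono (ℱ.mono n.le_succ))).add stronglyMeasurable_const)
      (fun n => ((hZi n).sub (hSi n)).add (integrable_const _))
      (fun n ω => by linarith [hZ0 n ω, hSk n ω])
      (fun n => (hCi n).indicator (ℱ.le n _ (hAm k n)))
      (fun n ω => Set.indicator_nonneg (fun _ _ => hC0 _ _) _)
      (by
        intro n
        have e : (fun ω => Z (n + 1) ω - S (n + 1) ω + k) + (A k n).indicator (C n)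
            = (A k n).indicator (X (n + 1) + C n) + (fun ω => k - S (n + 1) ω) := by
          funext ω
          by_cases hω : ω ∈ A k n <;> simp [Z, hω] <;> ring
        have hm : StronglyMeasurable[ℱ n] fun ω => (k : ℝ) - S (n + 1) ω :=
          stronglyMeasurable_const.sub (hSm n)
        have hi : Integrable (fun ω => (k : ℝ) - S (n + 1) ω) P :=
          (integrable_const _).sub (hSi _)
        have hXC := (hXi (n + 1)).add (hCi n)
        rw [e]
        filter_upwards [condExp_add (hXC.indicator (ℱ.le n _ (hAm k n))) hi (ℱ n),
          condExp_indicator hXC (hAm k n), h n] with ω h1 h2 h3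
        rw [h1, Pi.add_apply, h2, condExp_of_stronglyMeasurable (ℱ.le n) hm hi]
        have hS : S (n + 1) ω = S n ω + β n ω := Finset.sum_range_succ _ _
        by_cases hω : ω ∈ A k n
        · have hβ : β n ω = |b n ω| := Set.indicator_of_mem hω _
          rw [Set.indicator_of_mem hω, hZX n ω hω]
          have h3' : (P[X (n + 1) + C n | ℱ n]) ω ≤ X n ω + b n ω := h3
          linarith [le_abs_self (b n ω)]
        · have hβ : β n ω = 0 := Set.indicator_of_notMem hω _
          rw [Set.indicator_of_notMem hω]
          linarith [hZ0 n ω])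
    filter_upwards [hmain] with ω ⟨⟨l, hl⟩, hD⟩ hω
    constructor
    · have hSc : ∃ l', Tendsto (fun n => S n ω) atTop (𝓝 l') :=
        ⟨_, tendsto_atTop_ciSup (monotone_nat_of_le_succ fun n => by
          simp only [S, Finset.sum_range_succ]; linarith [hβ0 n ω])
          ⟨k, by rintro _ ⟨n, rfl⟩; exact hSk n ω⟩⟩
      obtain ⟨l', hl'⟩ := hSc
      refine ⟨l + l' - k, ((hl.add hl').sub_const _).congr fun n => ?_⟩
      rw [hZX n ω (hω n)]; ring
    · refine hD.congr fun n => ?_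
      exact Set.indicator_of_mem (hω n) _
  filter_upwards [ae_all_iff.2 key, hbs] with ω h1 h2
  -- Almost every path has finite total |b|, so for some k it is never stopped.
  obtain ⟨k, hk⟩ := exists_nat_ge (∑' n, |b n ω|)
  exact h1 k fun n => (h2.abs.sum_le_tsum _ fun _ _ => abs_nonneg _).trans hk

/-- The Robbins–Siegmund theorem on almost supermartingales. -/
theorem robbinsSiegmund {X C b : ℕ → Ω → ℝ} {α : ℕ → ℝ} (hα0 : ∀ n, 0 ≤ α n)
    (hα : Summable α) (hX : StronglyAdapted ℱ X)
    (hXi : ∀ n, Integrable (X n) P) (hX0 : ∀ n ω, 0 ≤ X n ω) (hCi : ∀ n, Integrable (C n) P)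
    (hC0 : ∀ n ω, 0 ≤ C n ω) (hb : StronglyAdapted ℱ b) (hbi : ∀ n, Integrable (b n) P)
    (hbs : ∀ᵐ ω ∂P, Summable fun n => b n ω)
    (h : ∀ n, P[X (n + 1) + C n | ℱ n] ≤ᵐ[P] fun ω => (1 + α n) * X n ω + b n ω) :
    ∀ᵐ ω ∂P, (∃ l, Tendsto (fun n => X n ω) atTop (𝓝 l)) ∧ Summable fun n => C n ω := by
  -- Dividing by this product absorbs the factor 1 + α n. It lies between 1 and exp (∑ α), so the
  -- rescaling affects neither convergence nor summability.
  let p : ℕ → ℝ := fun n => ∏ j ∈ Finset.range n, (1 + α j)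
  have hp1 : ∀ n, 1 ≤ p n := fun n => by
    induction n with
    | zero => simp [p]
    | succ n ih =>
      simp only [p, Finset.prod_range_succ] at ih ⊢
      nlinarith [hα0 n]
  have hp0 : ∀ n, 0 < p n := fun n => one_pos.trans_le (hp1 n)
  have hps : ∀ n, p (n + 1) = (1 + α n) * p n := fun n => by
    simp only [p, Finset.prod_range_succ, mul_comm]
  have hpmono : Monotone p := monotone_nat_of_le_succ fun n => by
    rw [hps]; nlinarith [hα0 n, hp0 n]
  have hpR : ∀ n, p n ≤ Real.exp (∑' j, α j) := fun n => by
    refine le_trans (Finset.prod_le_prod (fun j _ => by linarith [hα0 j]) fun j _ => ?_)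
      ((Real.exp_sum _ _).symm.le.trans
        (Real.exp_le_exp.2 (hα.sum_le_tsum (Finset.range n) fun j _ => hα0 j)))
    linarith [Real.add_one_le_exp (α j)]
  have hmain := ae_tendsto_of_condExp_add_le_add (P := P) (ℱ := ℱ)
    (X := fun n ω => (p n)⁻¹ * X n ω) (C := fun n ω => (p (n + 1))⁻¹ * C n ω)
    (b := fun n ω => (p (n + 1))⁻¹ * b n ω)
    (fun n => (hX n).const_mul _) (fun n => (hXi n).const_mul _)
    (fun n ω => mul_nonneg (inv_nonneg.2 (hp0 n).le) (hX0 n ω)) (fun n => (hCi n).const_mul _)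
    (fun n ω => mul_nonneg (inv_nonneg.2 (hp0 _).le) (hC0 n ω))
    (fun n => (hb n).const_mul _) (fun n => (hbi n).const_mul _)
    (by
      filter_upwards [hbs] with ω hω
      refine Summable.of_norm_bounded hω.abs fun n => ?_
      rw [Real.norm_eq_abs, abs_mul, abs_of_pos (inv_pos.2 (hp0 _))]
      exact mul_le_of_le_one_left (abs_nonneg _) (inv_le_one_of_one_le₀ (hp1 _)))
    (by
      intro n
      have e : ((fun ω => (p (n + 1))⁻¹ * X (n + 1) ω) + fun ω => (p (n + 1))⁻¹ * C n ω)
          = (p (n + 1))⁻¹ • (X (n + 1) + C n) := by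
        funext ω; simp [mul_add]
      rw [e]
      filter_upwards [condExp_smul (μ := P) (p (n + 1))⁻¹ (X (n + 1) + C n) (ℱ n), h n] with ω h1 h2
      rw [h1]
      change (p (n + 1))⁻¹ * (P[X (n + 1) + C n | ℱ n]) ω ≤ (p n)⁻¹ * X n ω + (p (n + 1))⁻¹ * b n ω
      have h3 : (p n)⁻¹ = (p (n + 1))⁻¹ * (1 + α n) := by
        have := hα0 n
        rw [hps, mul_inv, mul_comm (1 + α n)⁻¹, mul_assoc, inv_mul_cancel₀ (by linarith), mul_one]
      rw [h3, mul_assoc, ← mul_add]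
      exact mul_le_mul_of_nonneg_left h2 (inv_nonneg.2 (hp0 _).le))
  filter_upwards [hmain] with ω ⟨⟨l, hl⟩, hC⟩
  have hpt := tendsto_atTop_ciSup hpmono ⟨_, by rintro _ ⟨n, rfl⟩; exact hpR n⟩
  constructor
  · refine ⟨_, (hpt.mul hl).congr fun n => ?_⟩
    rw [← mul_assoc, mul_inv_cancel₀ (hp0 n).ne', one_mul]
  · refine Summable.of_nonneg_of_le (hC0 · ω) (fun n => ?_) (hC.mul_left (Real.exp (∑' j, α j)))
    have h4 : C n ω = p (n + 1) * ((p (n + 1))⁻¹ * C n ω) := by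
      rw [← mul_assoc, mul_inv_cancel₀ (hp0 _).ne', one_mul]
    calc C n ω = p (n + 1) * ((p (n + 1))⁻¹ * C n ω) := h4
      _ ≤ _ := mul_le_mul_of_nonneg_right (hpR _)
        (mul_nonneg (inv_nonneg.2 (hp0 _).le) (hC0 n ω))

end RobbinsSiegmund

/-! ### Weak limits, weak measurability and Opial's lemma. -/

section Weak

variable {H : Type*} [NormedAddCommGroup H] [InnerProductSpace ℝ H]

/-- A map into a separable Hilbert space is measurable as soon as it is weakly measurable. -/
theorem measurable_of_measurable_inner [CompleteSpace H] [TopologicalSpace.SeparableSpace H]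
    [MeasurableSpace H] [BorelSpace H] {Ω : Type*} [MeasurableSpace Ω] {f : Ω → H}
    (hf : ∀ y, Measurable fun ω => ⟪f ω, y⟫) : Measurable f := by
  let d := TopologicalSpace.denseSeq H
  have hd : DenseRange d := TopologicalSpace.denseRange_denseSeq H
  let Φ : H → ℕ → ℝ := fun v n => ⟪v, d n⟫
  have hΦ : Continuous Φ := by fun_prop
  have hinj : Function.Injective Φ := by
    intro u v huv
    refine ext_inner_right ℝ fun y => ?_
    have h1 : (fun y => ⟪u, y⟫) = fun y => ⟪v, y⟫ :=
      hd.equalizer (by fun_prop) (by fun_prop) (funext fun n => congrFun huv n)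
    exact congrFun h1 y
  -- Lusin–Souslin: a continuous injection of a Polish space is a measurable embedding, so
  -- measurability can be tested on countably many inner products.
  exact (hΦ.measurableEmbedding hinj).measurable_comp_iff.1 (measurable_pi_lambda _ fun n => hf _)

theorem weaklyTendsto_iff [CompleteSpace H] {u : ℕ → H} {l : H} :
    WeaklyTendsto u l ↔ ∀ y, Tendsto (fun n => ⟪u n, y⟫) atTop (𝓝 ⟪l, y⟫) := by
  have h0 : WeaklyTendsto u l ↔
      ∀ f : StrongDual ℝ H, Tendsto (fun n => f (u n)) atTop (𝓝 (f l)) :=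
    WeakBilin.tendsto_iff_forall_eval_tendsto (B := (topDualPairing ℝ H).flip)
      (by
        intro x y hxy
        refine ext_inner_left ℝ fun v => ?_
        exact LinearMap.congr_fun hxy (InnerProductSpace.toDual ℝ H v))
  rw [h0]
  constructor
  · intro h y
    simpa [InnerProductSpace.toDual_apply_apply, real_inner_comm] using h (InnerProductSpace.toDual ℝ H y)
  · intro h f
    obtain ⟨y, rfl⟩ := (InnerProductSpace.toDual ℝ H).surjective f
    simpa [InnerProductSpace.toDual_apply_apply, real_inner_comm] using h y

/-- The inner product of a bounded weakly convergent family with a strongly convergent one. -/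
theorem tendsto_inner_of_weak_of_strong {ι : Type*} {F : Filter ι} {u v : ι → H} {x y : H} {C : ℝ}
    (hu : ∀ n, ‖u n‖ ≤ C) (hw : ∀ y, Tendsto (fun n => ⟪u n, y⟫) F (𝓝 ⟪x, y⟫))
    (hv : Tendsto v F (𝓝 y)) : Tendsto (fun n => ⟪u n, v n⟫) F (𝓝 ⟪x, y⟫) := by
  have h1 : Tendsto (fun n => ⟪u n, v n - y⟫) F (𝓝 0) := by
    have h2 : Tendsto (fun n => C * ‖v n - y‖) F (𝓝 0) := by
      simpa using (tendsto_iff_norm_sub_tendsto_zero.1 hv).const_mul C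
    refine squeeze_zero_norm (fun n => ?_) h2
    exact (norm_inner_le_norm _ _).trans (mul_le_mul_of_nonneg_right (hu n) (norm_nonneg _))
  have h3 := h1.add (hw y)
  simpa [inner_sub_right] using h3

/-- Bounded families have weak limits along ultrafilters. -/
theorem exists_weak_limit_ultrafilter [CompleteSpace H] {ι : Type*} (U : Ultrafilter ι)
    {u : ι → H} {C : ℝ} (hu : ∀ n, ‖u n‖ ≤ C) :
    ∃ x, ∀ y, Tendsto (fun n => ⟪u n, y⟫) U (𝓝 ⟪x, y⟫) := by
  have hb : ∀ n y, |⟪u n, y⟫| ≤ C * ‖y‖ := fun n y =>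
    (abs_real_inner_le_norm _ _).trans (mul_le_mul_of_nonneg_right (hu n) (norm_nonneg _))
  -- Every scalar sequence lives in a compact interval and so converges along the ultrafilter. The
  -- limits form a bounded linear functional, which Riesz represents by a vector.
  have hlim : ∀ y, ∃ c ∈ Set.Icc (-(C * ‖y‖)) (C * ‖y‖),
      Tendsto (fun n => ⟪u n, y⟫) U (𝓝 c) := fun y =>
    isCompact_Icc.ultrafilter_le_nhds (U.map fun n => ⟪u n, y⟫)
      (le_principal_iff.2 (Filter.mem_map.2 (Filter.univ_mem' fun n => abs_le.1 (hb n y))))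
  choose c hcI hc using hlim
  let f : H →ₗ[ℝ] ℝ :=
    { toFun := c
      map_add' := fun y y' => tendsto_nhds_unique (hc (y + y'))
        (((hc y).add (hc y')).congr fun n => (inner_add_right _ _ _).symm)
      map_smul' := fun r y => tendsto_nhds_unique (hc (r • y))
        (((hc y).const_mul r).congr fun n => (real_inner_smul_right _ _ _).symm) }
  let g : StrongDual ℝ H := f.mkContinuous C fun y => abs_le.2 (hcI y)
  refine ⟨(InnerProductSpace.toDual ℝ H).symm g, fun y => ?_⟩
  rw [InnerProductSpace.toDual_symm_apply]
  exact hc y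

/-- Opial's lemma in the metric of a self-adjoint strongly positive operator; convergence of the
distances is only needed on a dense part of the target set. -/
theorem opial [CompleteSpace H] {M : H →L[ℝ] H} {κ C : ℝ} (hκ : 0 < κ)
    (hM : ∀ x y, ⟪M x, y⟫ = ⟪x, M y⟫) (hMκ : ∀ x, κ * ‖x‖ ^ 2 ≤ ⟪M x, x⟫) {S Z : Set H}
    (hSZ : Z ⊆ closure S) {u : ℕ → H} (hu : ∀ n, ‖u n‖ ≤ C)
    (hS : ∀ s ∈ S, ∃ l, Tendsto (fun n => ⟪M (u n - s), u n - s⟫) atTop (𝓝 l))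
    (hZ : ∀ U : Ultrafilter ℕ, (U : Filter ℕ) ≤ atTop →
      ∀ x, (∀ y, Tendsto (fun n => ⟪u n, y⟫) U (𝓝 ⟪x, y⟫)) → x ∈ Z) :
    ∃ x ∈ Z, ∀ y, Tendsto (fun n => ⟪u n, y⟫) atTop (𝓝 ⟪x, y⟫) := by
  -- Polarization: in the difference of the squared distances to s and s' the quadratic term in u n
  -- cancels.
  have hpair : ∀ s ∈ S, ∀ s' ∈ S, ∃ l, Tendsto (fun n => ⟪u n, M (s - s')⟫) atTop (𝓝 l) := by
    intro s hs s' hs'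
    obtain ⟨l, hl⟩ := hS s hs
    obtain ⟨l', hl'⟩ := hS s' hs'
    refine ⟨(l' - l + ⟪M s, s⟫ - ⟪M s', s'⟫) / 2,
      ((((hl'.sub hl).add_const _).sub_const _).div_const 2).congr fun n => ?_⟩
    have e1 := hM (u n) s
    have e2 := hM (u n) s'
    have e3 := real_inner_comm (M s) (u n)
    have e4 := real_inner_comm (M s') (u n)
    simp only [map_sub, inner_sub_left, inner_sub_right] at *
    linarith
  -- Two cluster points x, x' satisfy ⟪x - x', M (s - s')⟫ = 0 on S × S, hence on its closure;
  -- taking s = x and s' = x' there gives x = x'.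
  have huniq : ∀ x ∈ Z, ∀ x' ∈ Z, ∀ U U' : Ultrafilter ℕ, (U : Filter ℕ) ≤ atTop →
      (U' : Filter ℕ) ≤ atTop → (∀ y, Tendsto (fun n => ⟪u n, y⟫) U (𝓝 ⟪x, y⟫)) →
      (∀ y, Tendsto (fun n => ⟪u n, y⟫) U' (𝓝 ⟪x', y⟫)) → x = x' := by
    intro x hx x' hx' U U' hU hU' h h'
    have h0 : ∀ s ∈ S, ∀ s' ∈ S, ⟪x - x', M (s - s')⟫ = 0 := by
      intro s hs s' hs'
      obtain ⟨l, hl⟩ := hpair s hs s' hs'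
      rw [inner_sub_left, tendsto_nhds_unique (h _) (hl.mono_left hU),
        tendsto_nhds_unique (h' _) (hl.mono_left hU'), sub_self]
    have h1 : (x, x') ∈ closure (S ×ˢ S) := by
      rw [closure_prod_eq]; exact ⟨hSZ hx, hSZ hx'⟩
    have hcl : IsClosed {q : H × H | ⟪x - x', M (q.1 - q.2)⟫ = 0} :=
      isClosed_eq (by fun_prop) continuous_const
    have h2 : ⟪x - x', M (x - x')⟫ = 0 :=
      closure_minimal (fun q hq => h0 _ hq.1 _ hq.2) hcl h1
    rw [← hM] at h2
    have h3 := hMκ (x - x')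
    have h4 : ‖x - x'‖ ^ 2 ≤ 0 := by nlinarith [sq_nonneg ‖x - x'‖]
    have h5 : ‖x - x'‖ = 0 := by nlinarith [norm_nonneg (x - x')]
    exact sub_eq_zero.1 (norm_eq_zero.1 h5)
  let U₀ : Ultrafilter ℕ := Ultrafilter.of atTop
  obtain ⟨x, hx⟩ := exists_weak_limit_ultrafilter U₀ hu
  have hxZ := hZ U₀ (Ultrafilter.of_le _) x hx
  refine ⟨x, hxZ, fun y => ?_⟩
  rw [tendsto_iff_ultrafilter]
  intro U hU
  obtain ⟨x', hx'⟩ := exists_weak_limit_ultrafilter U hu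
  rw [huniq x hxZ x' (hZ U hU x' hx') U₀ U (Ultrafilter.of_le _) hU hx hx']
  exact hx' y

end Weak

/-! ### Deterministic analysis of the forward-backward step in a variable metric. -/

section Inclusion

variable {H : Type*} [NormedAddCommGroup H] [InnerProductSpace ℝ H]

/-- The hypotheses under which the forward-backward iteration for `0 ∈ A z + B z` in the metric of
`M` is analyzed. -/
structure MetricInclusion (A : H → Set H) (B : H → H) (M : H →L[ℝ] H) (κ c γ : ℝ) : Prop where
  kappa_pos : 0 < κ
  c_pos : 0 < c
  gamma_pos : 0 < γ
  mono : ∀ x y u v, u ∈ A x → v ∈ A y → 0 ≤ ⟪x - y, u - v⟫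
  surj : ∀ u, ∃ t, u - M t ∈ A t
  symm : ∀ x y, ⟪M x, y⟫ = ⟪x, M y⟫
  pos : ∀ x, κ * ‖x‖ ^ 2 ≤ ⟪M x, x⟫
  coco : ∀ x y, c * ‖B x - B y‖ ^ 2 ≤ ⟪x - y, B x - B y⟫
  descent : ∀ w t y, γ * (‖w - t‖ ^ 2 + ‖B w - B y‖ ^ 2) ≤
    ⟪M (w - t), w - t⟫ - 2 * ⟪w - t, B w - B y⟫ + 2 * ⟪w - y, B w - B y⟫

/-- The zeros of `A + B`. -/
def zeroSet (A : H → Set H) (B : H → H) : Set H :=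
  {z | -B z ∈ A z}

namespace MetricInclusion

variable {A : H → Set H} {B : H → H} {M : H →L[ℝ] H} {κ c γ : ℝ}

/-- Monotonicity of `A` leaves ⟪M (t - t'), t - t'⟫ ≤ ⟪t - t', u - v⟫, and strong positivity of `M`
divides out one factor. This gives both the uniqueness and the Lipschitz continuity of the
resolvent. -/
theorem norm_sub_le (h : MetricInclusion A B M κ c γ) {u v t t' : H} (ht : u - M t ∈ A t)
    (ht' : v - M t' ∈ A t') : ‖t - t'‖ ≤ κ⁻¹ * ‖u - v‖ := by
  have h1 := h.mono _ _ _ _ ht ht'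
  have h2 : ⟪t - t', u - M t - (v - M t')⟫ = ⟪t - t', u - v⟫ - ⟪M (t - t'), t - t'⟫ := by
    rw [h.symm, ← inner_sub_right, map_sub]; congr 1; abel
  have h3 := h.pos (t - t')
  have h4 := real_inner_le_norm (t - t') (u - v)
  have h5 : ‖t - t'‖ * (κ * ‖t - t'‖) ≤ ‖t - t'‖ * ‖u - v‖ := by nlinarith
  rw [inv_mul_eq_div, le_div_iff₀' h.kappa_pos]
  rcases (norm_nonneg (t - t')).eq_or_lt with h6 | h6
  · rw [← h6]; simp
  · exact le_of_mul_le_mul_left h5 h6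

/-- The resolvent `(M + A)⁻¹`. -/
noncomputable def resolvent (h : MetricInclusion A B M κ c γ) (u : H) : H :=
  (h.surj u).choose

theorem resolvent_spec (h : MetricInclusion A B M κ c γ) (u : H) :
    u - M (h.resolvent u) ∈ A (h.resolvent u) :=
  (h.surj u).choose_spec

theorem eq_resolvent (h : MetricInclusion A B M κ c γ) {u t : H} (ht : u - M t ∈ A t) :
    t = h.resolvent u := by
  have := h.norm_sub_le ht (h.resolvent_spec u)
  rw [sub_self, norm_zero, mul_zero] at this
  exact sub_eq_zero.1 (norm_le_zero_iff.1 this)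

theorem lipschitz_resolvent (h : MetricInclusion A B M κ c γ) :
    LipschitzWith (Real.toNNReal κ⁻¹) h.resolvent :=
  LipschitzWith.of_dist_le_mul fun u v => by
    rw [dist_eq_norm, dist_eq_norm, Real.coe_toNNReal _ (inv_nonneg.2 h.kappa_pos.le)]
    exact h.norm_sub_le (h.resolvent_spec u) (h.resolvent_spec v)

theorem lipschitz_forward (h : MetricInclusion A B M κ c γ) :
    LipschitzWith (Real.toNNReal c⁻¹) B :=
  LipschitzWith.of_dist_le_mul fun u v => by
    rw [dist_eq_norm, dist_eq_norm, Real.coe_toNNReal _ (inv_nonneg.2 h.c_pos.le)]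
    have h1 := h.coco u v
    have h2 := real_inner_le_norm (u - v) (B u - B v)
    have h5 : ‖B u - B v‖ * (c * ‖B u - B v‖) ≤ ‖B u - B v‖ * ‖u - v‖ := by nlinarith
    rw [inv_mul_eq_div, le_div_iff₀' h.c_pos]
    rcases (norm_nonneg (B u - B v)).eq_or_lt with h6 | h6
    · rw [← h6]; simp
    · exact le_of_mul_le_mul_left h5 h6

/-- Demiclosedness: weak limits of approximate solutions are zeros of `A + B`. -/
theorem mem_zeroSet_of_tendsto (h : MetricInclusion A B M κ c γ) {ι : Type*} {F : Filter ι}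
    [F.NeBot] {w t u : ι → H} {C : ℝ} {x b : H} (hw : ∀ n, ‖w n‖ ≤ C)
    (hwx : ∀ y, Tendsto (fun n => ⟪w n, y⟫) F (𝓝 ⟪x, y⟫))
    (hwt : Tendsto (fun n => w n - t n) F (𝓝 0)) (hu : ∀ n, u n ∈ A (t n))
    (hub : Tendsto u F (𝓝 (-b))) (hB : Tendsto (fun n => B (w n)) F (𝓝 b)) :
    B x = b ∧ x ∈ zeroSet A B := by
  -- Cocoercivity passes to the limit: its right side pairs a weakly convergent family with a
  -- strongly convergent one and tends to 0.
  have hb : B x = b := by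
    have h1 : Tendsto (fun n => ⟪w n, B (w n) - B x⟫ - ⟪x, B (w n) - B x⟫) F
        (𝓝 (⟪x, b - B x⟫ - ⟪x, b - B x⟫)) :=
      (tendsto_inner_of_weak_of_strong hw hwx (hB.sub_const _)).sub
        (tendsto_const_nhds.inner (hB.sub_const _))
    have h2 : Tendsto (fun n => c * ‖B (w n) - B x‖ ^ 2) F (𝓝 (c * ‖b - B x‖ ^ 2)) :=
      ((hB.sub_const _).norm.pow 2).const_mul c
    have h3 := le_of_tendsto_of_tendsto' h2 h1 fun n => by
      rw [← inner_sub_left]; exact h.coco _ _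
    rw [sub_self] at h3
    have h4 : ‖b - B x‖ ^ 2 ≤ 0 := by nlinarith [h.c_pos, sq_nonneg ‖b - B x‖]
    have h5 : ‖b - B x‖ = 0 := by nlinarith [norm_nonneg (b - B x)]
    exact (sub_eq_zero.1 (norm_eq_zero.1 h5)).symm
  refine ⟨hb, ?_⟩
  -- Minty's trick: s is the resolvent point that x would be if -b ∈ A x. Monotonicity tested
  -- against s leaves 0 ≤ -⟪M (x - s), x - s⟫ in the limit, so x = s.
  obtain ⟨s, hs⟩ := h.surj (-b + M x)
  have h1 : Tendsto (fun n => ⟪w n, u n - (-b + M x - M s)⟫ -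
      ⟪w n - t n + s, u n - (-b + M x - M s)⟫) F
      (𝓝 (⟪x, -b - (-b + M x - M s)⟫ - ⟪0 + s, -b - (-b + M x - M s)⟫)) :=
    (tendsto_inner_of_weak_of_strong hw hwx (hub.sub_const _)).sub
      ((hwt.add_const s).inner (hub.sub_const _))
  have h2 := ge_of_tendsto' h1 (b := 0) fun n => by
    rw [← inner_sub_left]
    have := h.mono _ _ _ _ (hu n) hs
    have e : w n - (w n - t n + s) = t n - s := by abel
    rwa [e]
  have h3 : ⟪x, -b - (-b + M x - M s)⟫ - ⟪0 + s, -b - (-b + M x - M s)⟫ =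
      -⟪M (x - s), x - s⟫ := by
    rw [zero_add, ← inner_sub_left, h.symm, ← inner_neg_right, map_sub]
    congr 1; abel
  have h4 := h.pos (x - s)
  have h5 : ‖x - s‖ ^ 2 ≤ 0 := by nlinarith [h.kappa_pos, sq_nonneg ‖x - s‖]
  have h6 : ‖x - s‖ = 0 := by nlinarith [norm_nonneg (x - s)]
  have h7 : x = s := sub_eq_zero.1 (norm_eq_zero.1 h6)
  rw [← h7, add_sub_cancel_right] at hs
  change -B x ∈ A x
  rw [hb]; exact hs

/-- The one-step estimate of the inertial forward-backward iteration with inexact forward step. -/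
theorem step_le (h : MetricInclusion A B M κ c γ) {ε α l : ℝ} (hε : ε ≤ l) (hε0 : 0 < ε)
    (hl : l ≤ 1) (hα0 : 0 ≤ α) (hα1 : α ≤ 1) {z d w a t s z' : H} (hs : s ∈ zeroSet A B)
    (hw : w = z + α • d) (ht : M w - a - M t ∈ A t) (hz' : z' = z + l • (t - z)) :
    ⟪M (z' - s), z' - s⟫ + (ε * γ * (‖w - t‖ ^ 2 + ‖B w - B s‖ ^ 2) + ‖a - B w‖ ^ 2) ≤
      (1 + α) * ⟪M (z - s), z - s⟫ + 2 * α * ⟪M d, d⟫ + (2 * κ⁻¹ + 1) * ‖a - B w‖ ^ 2 -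
        2 * l * ⟪h.resolvent (M w - B w) - s, a - B w⟫ := by
  have hN0 : ∀ x, 0 ≤ ⟪M x, x⟫ := fun x =>
    (mul_nonneg h.kappa_pos.le (sq_nonneg _)).trans (h.pos x)
  have hadd : ∀ x y, ⟪M (x + y), x + y⟫ = ⟪M x, x⟫ + 2 * ⟪M x, y⟫ + ⟪M y, y⟫ := fun x y => by
    have : ⟪M y, x⟫ = ⟪M x, y⟫ := by rw [h.symm, real_inner_comm]
    rw [map_add, inner_add_left, inner_add_right, inner_add_right, this]; ring
  have hsmul : ∀ (r : ℝ) x, ⟪M (r • x), r • x⟫ = r ^ 2 * ⟪M x, x⟫ := fun r x => by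
    rw [map_smul, real_inner_smul_left, real_inner_smul_right]; ring
  have hyoung : ∀ x y, 2 * ⟪M x, y⟫ ≤ ⟪M x, x⟫ + ⟪M y, y⟫ := fun x y => by
    have h1 := hN0 (x - y)
    have h2 : ⟪M y, x⟫ = ⟪M x, y⟫ := by rw [h.symm, real_inner_comm]
    simp only [map_sub, inner_sub_left, inner_sub_right] at h1
    linarith
  -- the inertial term
  have hws : ⟪M (w - s), w - s⟫ ≤ (1 + α) * ⟪M (z - s), z - s⟫ + 2 * α * ⟪M d, d⟫ := by
    have e : w - s = (z - s) + α • d := by rw [hw]; abel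
    rw [e, hadd, hsmul, real_inner_smul_right]
    have h1 := hyoung (z - s) d
    nlinarith [hN0 d, mul_nonneg hα0 (hN0 d)]
  -- the relaxation
  have hrel : ⟪M (z' - s), z' - s⟫ ≤ (1 - l) * ⟪M (z - s), z - s⟫ + l * ⟪M (t - s), t - s⟫ := by
    have e : z' - s = (1 - l) • (z - s) + l • (t - s) := by
      rw [hz', smul_sub, smul_sub, smul_sub, sub_smul, sub_smul, one_smul, one_smul]; abel
    have h1 := hyoung (z - s) (t - s)
    rw [e, hadd, hsmul, hsmul, map_smul, real_inner_smul_left, real_inner_smul_right]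
    nlinarith [mul_nonneg (sub_nonneg.2 hl) (hε0.le.trans hε)]
  -- the forward-backward step
  have hmono := h.mono _ _ _ _ ht hs
  have hexp : ⟪M (w - s), w - s⟫ =
      ⟪M (w - t), w - t⟫ + 2 * ⟪M (w - t), t - s⟫ + ⟪M (t - s), t - s⟫ := by
    rw [← hadd]; congr 2 <;> simp
  have hinn : ⟪t - s, M w - a - M t - -B s⟫ =
      ⟪M (w - t), t - s⟫ - (⟪w - s, B w - B s⟫ - ⟪w - t, B w - B s⟫) - ⟪t - s, a - B w⟫ := by
    rw [← inner_sub_left, real_inner_comm (t - s) (M (w - t)), sub_sub_sub_cancel_left,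
      ← inner_sub_right, ← inner_sub_right, map_sub]
    congr 1; abel
  -- The cross terms in B w - B s left by monotonicity are exactly those absorbed by this
  -- inequality, which is where the step-size condition enters.
  have hdesc := h.descent w t s
  have hts : ⟪M (t - s), t - s⟫ + γ * (‖w - t‖ ^ 2 + ‖B w - B s‖ ^ 2) ≤
      ⟪M (w - s), w - s⟫ - 2 * ⟪t - s, a - B w⟫ := by linarith
  -- the noise
  have hnoise : -2 * ⟪t - s, a - B w⟫ ≤
      2 * κ⁻¹ * ‖a - B w‖ ^ 2 - 2 * ⟪h.resolvent (M w - B w) - s, a - B w⟫ := by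
    -- The point t depends on the noise a - B w. It is exchanged for the noise-free resolvent point,
    -- which does not, at the cost of κ⁻¹ ‖a - B w‖².
    have h1 := h.norm_sub_le (h.resolvent_spec (M w - B w)) ht
    have h2 := real_inner_le_norm (h.resolvent (M w - B w) - t) (a - B w)
    have e1 : M w - B w - (M w - a) = a - B w := by abel
    rw [e1] at h1
    have e2 : ⟪t - s, a - B w⟫ = ⟪h.resolvent (M w - B w) - s, a - B w⟫ -
        ⟪h.resolvent (M w - B w) - t, a - B w⟫ := by
      rw [← inner_sub_left]; congr 1; abel
    nlinarith [norm_nonneg (a - B w)]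
  have hl0 : 0 ≤ l := hε0.le.trans hε
  have hG : 0 ≤ γ * (‖w - t‖ ^ 2 + ‖B w - B s‖ ^ 2) :=
    mul_nonneg h.gamma_pos.le (by positivity)
  -- The estimate is assembled with weight l. A full ‖a - B w‖² is then added on both sides, so that
  -- its almost sure summability comes out together with that of the residuals.
  have hF := mul_le_mul_of_nonneg_left (hts.trans (add_le_add_left hws _)) hl0
  have hεG := mul_le_mul_of_nonneg_right hε hG
  have hln := mul_le_mul_of_nonneg_left hnoise hl0
  have hR0 : 0 ≤ α * ⟪M (z - s), z - s⟫ + 2 * α * ⟪M d, d⟫ :=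
    add_nonneg (mul_nonneg hα0 (hN0 _)) (mul_nonneg (by linarith) (hN0 _))
  have hR := mul_le_mul_of_nonneg_right hl hR0
  have hE : 0 ≤ 2 * κ⁻¹ * ‖a - B w‖ ^ 2 := by
    have := h.kappa_pos
    positivity
  have hE2 := mul_le_mul_of_nonneg_right hl hE
  nlinarith

end MetricInclusion

end Inclusion

/-! ### Almost sure weak convergence of the stochastic iteration. -/

section Stochastic

/-- Subtracting `f 0` gives a Lipschitz map that fixes 0, and constants are square integrable for a
probability measure. -/
theorem memLp_comp_lipschitz {Ω : Type*} {m0 : MeasurableSpace Ω} {P : Measure Ω}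
    [IsProbabilityMeasure P] {E : Type*} [NormedAddCommGroup E] {f : E → E} {C : ℝ≥0} (hf : LipschitzWith C f) {u : Ω → E}
    (hu : MemLp u 2 P) : MemLp (fun ω => f (u ω)) 2 P := by
  have h1 : MemLp ((fun v => f v - f 0) ∘ u) 2 P :=
    LipschitzWith.comp_memLp (K := C) (by
      refine LipschitzWith.of_dist_le_mul fun x y => ?_
      rw [dist_sub_right]; exact hf.dist_le_mul x y) (by simp) hu
  have h2 := h1.add (memLp_const (f 0))
  refine h2.ae_eq (ae_of_all _ fun ω => ?_)
  simp

variable {H : Type*} [NormedAddCommGroup H] [InnerProductSpace ℝ H]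

theorem memLp_integrable_inner {Ω : Type*} {m0 : MeasurableSpace Ω} {P : Measure Ω}
    {u v : Ω → H} (hu : MemLp u 2 P) (hv : MemLp v 2 P) :
    Integrable (fun ω => ⟪u ω, v ω⟫) P :=
  (MemLp.integrable_mul hu.norm hv.norm).mono'
    (hu.aestronglyMeasurable.inner hv.aestronglyMeasurable)
    (ae_of_all _ fun _ => norm_inner_le_norm _ _)

variable [CompleteSpace H]

/-- Almost sure weak convergence of the inertial stochastic forward-backward iteration. -/
theorem MetricInclusion.ae_weaklyTendsto [TopologicalSpace.SeparableSpace H]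
    {A : H → Set H} {B : H → H} {M : H →L[ℝ] H} {κ c γ : ℝ} (h : MetricInclusion A B M κ c γ)
    (hne : (zeroSet A B).Nonempty) {ε : ℝ} (hε : 0 < ε) {lam α : ℕ → ℝ}
    (hlam : ∀ n, lam n ∈ Set.Icc ε 1) (hα : ∀ n, α n ∈ Set.Icc (0 : ℝ) 1) (hαs : Summable α)
    {Ω : Type*} {m0 : MeasurableSpace Ω} {P : Measure Ω} [IsProbabilityMeasure P]
    {ℱ : Filtration ℕ m0} {z w t a : ℕ → Ω → H} (hzad : StronglyAdapted ℱ z)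
    (hz0 : MemLp (z 0) 2 P) (ha : ∀ n, MemLp (a n) 2 P)
    (hw : ∀ n ω, w n ω = z n ω + α n • (z n ω - z (n - 1) ω))
    (ht : ∀ n ω, M (w n ω) - a n ω - M (t n ω) ∈ A (t n ω))
    (hz : ∀ n ω, z (n + 1) ω = z n ω + lam n • (t n ω - z n ω))
    (hmean : ∀ n, P[a n | ℱ n] =ᵐ[P] fun ω => B (w n ω))
    (hvar : ∀ᵐ ω ∂P, Summable fun n => (P[fun ω' => ‖a n ω' - B (w n ω')‖ ^ 2 | ℱ n]) ω)
    (hbdd : ∀ᵐ ω ∂P, BddAbove (Set.range fun n => ‖z n ω - z (n - 1) ω‖)) :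
    ∀ᵐ ω ∂P, ∃ x ∈ zeroSet A B, (∀ y, Tendsto (fun n => ⟪z n ω, y⟫) atTop (𝓝 ⟪x, y⟫)) ∧
      Tendsto (fun n => B (w n ω)) atTop (𝓝 (B x)) ∧
      Tendsto (fun n => w n ω - z n ω) atTop (𝓝 0) ∧ ∃ C, ∀ n, ‖w n ω‖ ≤ C := by
  have hBc : Continuous B := h.lipschitz_forward.continuous
  have hJc : Continuous h.resolvent := h.lipschitz_resolvent.continuous
  -- square integrability
  have hteq : ∀ n ω, t n ω = h.resolvent (M (w n ω) - a n ω) := fun n ω =>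
    h.eq_resolvent (ht n ω)
  -- Inertia makes this a two-term recursion, so consecutive iterates are carried together. At n = 0
  -- truncated subtraction gives z (0 - 1) = z 0.
  have hz2 : ∀ n, MemLp (z n) 2 P ∧ MemLp (z (n - 1)) 2 P := by
    intro n
    induction n with
    | zero => exact ⟨hz0, hz0⟩
    | succ n ih =>
      refine ⟨?_, ih.1⟩
      have h1 : MemLp (w n) 2 P := (ih.1.add ((ih.1.sub ih.2).const_smul (α n))).ae_eq
        (ae_of_all _ fun ω => (hw n ω).symm)
      have h2 : MemLp (fun ω => M (w n ω) - a n ω) 2 P := (M.comp_memLp' h1).sub (ha n)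
      have h3 : MemLp (t n) 2 P := (memLp_comp_lipschitz h.lipschitz_resolvent h2).ae_eq
        (ae_of_all _ fun ω => (hteq n ω).symm)
      exact (ih.1.add ((h3.sub ih.1).const_smul (lam n))).ae_eq
        (ae_of_all _ fun ω => (hz n ω).symm)
  have hd2 : ∀ n, MemLp (fun ω => z n ω - z (n - 1) ω) 2 P := fun n => (hz2 n).1.sub (hz2 n).2
  have hw2 : ∀ n, MemLp (w n) 2 P := fun n =>
    ((hz2 n).1.add ((hd2 n).const_smul (α n))).ae_eq (ae_of_all _ fun ω => (hw n ω).symm)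
  have hB2 : ∀ n, MemLp (fun ω => B (w n ω)) 2 P := fun n =>
    memLp_comp_lipschitz h.lipschitz_forward (hw2 n)
  have he2 : ∀ n, MemLp (fun ω => a n ω - B (w n ω)) 2 P := fun n => (ha n).sub (hB2 n)
  have ht2 : ∀ n, MemLp (t n) 2 P := fun n =>
    (memLp_comp_lipschitz h.lipschitz_resolvent ((M.comp_memLp' (hw2 n)).sub (ha n))).ae_eq
      (ae_of_all _ fun ω => (hteq n ω).symm)
  -- adaptedness
  have hdm : ∀ n, StronglyMeasurable[ℱ n] fun ω => z n ω - z (n - 1) ω := fun n =>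
    (hzad n).sub ((hzad (n - 1)).mono (ℱ.mono (Nat.sub_le n 1)))
  have hwm : ∀ n, StronglyMeasurable[ℱ n] (w n) := fun n => by
    have h1 : w n = fun ω => z n ω + α n • (z n ω - z (n - 1) ω) := funext (hw n)
    rw [h1]
    exact (hzad n).add ((hdm n).const_smul (α n))
  have hBm : ∀ n, StronglyMeasurable[ℱ n] fun ω => B (w n ω) := fun n =>
    hBc.comp_stronglyMeasurable (hwm n)
  have hquad : ∀ {u : Ω → H}, MemLp u 2 P → Integrable (fun ω => ⟪M (u ω), u ω⟫) P := fun hu =>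
    memLp_integrable_inner (M.comp_memLp' hu) hu
  have hsq : ∀ {u : Ω → H}, MemLp u 2 P → Integrable (fun ω => ‖u ω‖ ^ 2) P := fun hu => by
    simpa using hu.integrable_norm_rpow (by simp) (by simp)
  have hquadm : ∀ {n} {u : Ω → H}, StronglyMeasurable[ℱ n] u →
      StronglyMeasurable[ℱ n] fun ω => ⟪M (u ω), u ω⟫ := fun hu =>
    (M.continuous.comp_stronglyMeasurable hu).inner hu
  have hN0 : ∀ x, 0 ≤ ⟪M x, x⟫ := fun x =>
    (mul_nonneg h.kappa_pos.le (sq_nonneg _)).trans (h.pos x)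
  -- the almost supermartingale property
  have key : ∀ s ∈ zeroSet A B, ∀ᵐ ω ∂P,
      (∃ l, Tendsto (fun n => ⟪M (z n ω - s), z n ω - s⟫) atTop (𝓝 l)) ∧
      Summable fun n => ε * γ * (‖w n ω - t n ω‖ ^ 2 + ‖B (w n ω) - B s‖ ^ 2) +
        ‖a n ω - B (w n ω)‖ ^ 2 := by
    intro s hs
    let V : ℕ → Ω → ℝ := fun n => P[fun ω' => ‖a n ω' - B (w n ω')‖ ^ 2 | ℱ n]
    -- The perturbation collects the inertial term, summable by the bounded increments and the
    -- summable α, and a multiple of the conditional variance.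
    let b : ℕ → Ω → ℝ := fun n ω =>
      2 * α n * ⟪M (z n ω - z (n - 1) ω), z n ω - z (n - 1) ω⟫ + (2 * κ⁻¹ + 1) * V n ω
    have hCi : ∀ n, Integrable (fun ω =>
        ε * γ * (‖w n ω - t n ω‖ ^ 2 + ‖B (w n ω) - B s‖ ^ 2) + ‖a n ω - B (w n ω)‖ ^ 2) P :=
      fun n => (((hsq ((hw2 n).sub (ht2 n))).add
        (hsq ((hB2 n).sub (memLp_const (B s))))).const_mul _).add (hsq (he2 n))
    refine robbinsSiegmund (P := P) (ℱ := ℱ) (b := b) (fun n => (hα n).1) hαs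
      (fun n => hquadm ((hzad n).sub stronglyMeasurable_const))
      (fun n => hquad ((hz2 n).1.sub (memLp_const s))) (fun n ω => hN0 _) hCi
      (fun n ω => ?_) (fun n => ?_) (fun n => ?_) ?_ (fun n => ?_)
    · have := h.gamma_pos
      positivity
    · exact ((hquadm (hdm n)).const_mul _).add (stronglyMeasurable_condExp.const_mul _)
    · exact ((hquad (hd2 n)).const_mul _).add (integrable_condExp.const_mul _)
    · filter_upwards [hvar, hbdd] with ω hω ⟨R, hR⟩
      have hR' : ∀ n, ‖z n ω - z (n - 1) ω‖ ≤ R := fun n => hR ⟨n, rfl⟩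
      refine Summable.add ?_ (hω.mul_left _)
      refine Summable.of_nonneg_of_le (fun n => mul_nonneg (by linarith [(hα n).1]) (hN0 _))
        (fun n => ?_) (hαs.mul_right (2 * (‖M‖ * R * R)))
      have h1 : ⟪M (z n ω - z (n - 1) ω), z n ω - z (n - 1) ω⟫ ≤ ‖M‖ * R * R := by
        refine (real_inner_le_norm _ _).trans ?_
        have := hR' n
        have h2 := M.le_opNorm (z n ω - z (n - 1) ω)
        have h3 := norm_nonneg (z n ω - z (n - 1) ω)
        refine mul_le_mul (h2.trans (by gcongr)) this h3 ?_
        exact mul_nonneg (norm_nonneg _) (h3.trans this)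
      nlinarith [(hα n).1, mul_le_mul_of_nonneg_left h1 (hα n).1]
    · -- conditional expectation of the one-step estimate
      let t' : Ω → H := fun ω => h.resolvent (M (w n ω) - B (w n ω))
      have ht'm : StronglyMeasurable[ℱ n] t' :=
        hJc.comp_stronglyMeasurable ((M.continuous.comp_stronglyMeasurable (hwm n)).sub (hBm n))
      have ht'2 : MemLp t' 2 P :=
        memLp_comp_lipschitz h.lipschitz_resolvent ((M.comp_memLp' (hw2 n)).sub (hB2 n))
      let D : Ω → ℝ := fun ω => ⟪t' ω - s, a n ω - B (w n ω)⟫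
      have hDi : Integrable D P := memLp_integrable_inner (ht'2.sub (memLp_const s)) (he2 n)
      have hei : Integrable (fun ω => a n ω - B (w n ω)) P := (he2 n).integrable (by norm_num)
      have hai : Integrable (a n) P := (ha n).integrable (by norm_num)
      have hBi : Integrable (fun ω => B (w n ω)) P := (hB2 n).integrable (by norm_num)
      -- The noise-free resolvent point is ℱ n-measurable and comes out of the conditional
      -- expectation; the noise itself has conditional mean zero.
      have hD0 : P[D | ℱ n] =ᵐ[P] 0 := by
        have h1 := condExp_bilin_of_stronglyMeasurable_left (μ := P) (m := ℱ n)
          (innerSL ℝ : H →L[ℝ] H →L[ℝ] ℝ) (f := fun ω => t' ω - s)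
          (g := fun ω => a n ω - B (w n ω)) (ht'm.sub stronglyMeasurable_const) hDi hei
        have h2 := condExp_sub hai hBi (ℱ n)
        filter_upwards [h1, h2, hmean n] with ω e1 e2 e3
        have e4 : (P[fun ω => a n ω - B (w n ω) | ℱ n]) ω = 0 := by
          rw [show (fun ω => a n ω - B (w n ω)) = a n - fun ω => B (w n ω) from rfl, e2,
            Pi.sub_apply, e3, condExp_of_stronglyMeasurable (ℱ.le n) (hBm n) hBi, sub_self]
        refine e1.trans ?_
        rw [e4]; simp
      let Rm : Ω → ℝ := fun ω => (1 + α n) * ⟪M (z n ω - s), z n ω - s⟫ +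
        2 * α n * ⟪M (z n ω - z (n - 1) ω), z n ω - z (n - 1) ω⟫
      have hRmm : StronglyMeasurable[ℱ n] Rm :=
        ((hquadm ((hzad n).sub stronglyMeasurable_const)).const_mul _).add
          ((hquadm (hdm n)).const_mul _)
      have hRmi : Integrable Rm P :=
        ((hquad ((hz2 n).1.sub (memLp_const s))).const_mul _).add ((hquad (hd2 n)).const_mul _)
      let E : Ω → ℝ := fun ω => ‖a n ω - B (w n ω)‖ ^ 2
      have hEi : Integrable E P := hsq (he2 n)
      have hle := condExp_mono (m := ℱ n)
        ((hquad ((hz2 (n + 1)).1.sub (memLp_const s))).add (hCi n))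
        ((hRmi.add (hEi.smul (2 * κ⁻¹ + 1))).sub (hDi.smul (2 * lam n)))
        (ae_of_all P fun ω => h.step_le (hlam n).1 hε (hlam n).2 (hα n).1 (hα n).2 hs
          (hw n ω) (ht n ω) (hz n ω))
      filter_upwards [hle, hD0, condExp_sub (hRmi.add (hEi.smul (2 * κ⁻¹ + 1)))
          (hDi.smul (2 * lam n)) (ℱ n), condExp_add hRmi (hEi.smul (2 * κ⁻¹ + 1)) (ℱ n),
        condExp_smul (μ := P) (2 * κ⁻¹ + 1) E (ℱ n), condExp_smul (μ := P) (2 * lam n) D (ℱ n)]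
        with ω h1 h2 h3 h4 h5 h6
      refine h1.trans (le_of_eq ?_)
      rw [h3, Pi.sub_apply, h4, Pi.add_apply, h5, h6, Pi.smul_apply, Pi.smul_apply, h2,
        condExp_of_stronglyMeasurable (ℱ.le n) hRmm hRmi]
      simp only [Rm, b, V, E, smul_eq_mul, Pi.zero_apply, mul_zero, sub_zero]
      ring
  -- a countable dense set of zeros
  have : Nonempty (zeroSet A B) := hne.to_subtype
  let s : ℕ → H := fun k => (TopologicalSpace.denseSeq (zeroSet A B) k : H)
  have hsZ : ∀ k, s k ∈ zeroSet A B := fun k => (TopologicalSpace.denseSeq (zeroSet A B) k).2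
  have hdense : zeroSet A B ⊆ closure (Set.range s) := by
    intro x hx
    have h1 : (⟨x, hx⟩ : zeroSet A B) ∈
        closure (Set.range (TopologicalSpace.denseSeq (zeroSet A B))) :=
      TopologicalSpace.denseRange_denseSeq _ _
    rw [closure_subtype] at h1
    rwa [← Set.range_comp] at h1
  filter_upwards [ae_all_iff.2 fun k => key (s k) (hsZ k), hbdd] with ω hω ⟨R, hR⟩
  have hR' : ∀ n, ‖z n ω - z (n - 1) ω‖ ≤ R := fun n => hR ⟨n, rfl⟩
  -- boundedness
  obtain ⟨C, hC⟩ : ∃ C, ∀ n, ‖z n ω‖ ≤ C := by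
    obtain ⟨l, hl⟩ := (hω 0).1
    obtain ⟨Q, hQ⟩ := hl.bddAbove_range
    refine ⟨Q / κ + 1 + ‖s 0‖, fun n => ?_⟩
    have h1 : κ * ‖z n ω - s 0‖ ^ 2 ≤ Q := (h.pos _).trans (hQ ⟨n, rfl⟩)
    have h2 : ‖z n ω - s 0‖ ^ 2 ≤ Q / κ := by
      rw [le_div_iff₀' h.kappa_pos]; exact h1
    have h3 : ‖z n ω‖ ≤ ‖z n ω - s 0‖ + ‖s 0‖ := by
      simpa using norm_add_le (z n ω - s 0) (s 0)
    nlinarith [sq_nonneg (‖z n ω - s 0‖ - 1)]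
  have hwz : Tendsto (fun n => w n ω - z n ω) atTop (𝓝 0) := by
    refine squeeze_zero_norm (fun n => ?_)
      (show Tendsto (fun n => α n * R) atTop (𝓝 0) by
        simpa using hαs.tendsto_atTop_zero.mul_const R)
    rw [hw, add_sub_cancel_left, norm_smul, Real.norm_of_nonneg (hα n).1]
    exact mul_le_mul_of_nonneg_left (hR' n) (hα n).1
  have hCw : ∀ n, ‖w n ω‖ ≤ C + R := fun n => by
    rw [hw]
    refine (norm_add_le _ _).trans (add_le_add (hC n) ?_)
    rw [norm_smul, Real.norm_of_nonneg (hα n).1]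
    exact (mul_le_of_le_one_left (norm_nonneg _) (hα n).2).trans (hR' n)
  -- asymptotics of the residuals
  have hεγ : 0 < ε * γ := mul_pos hε h.gamma_pos
  have hsum0 := (hω 0).2.tendsto_atTop_zero
  have hsmall : ∀ {u : ℕ → H} {K : ℝ}, 0 < K → (∀ n, K * ‖u n‖ ^ 2 ≤
      ε * γ * (‖w n ω - t n ω‖ ^ 2 + ‖B (w n ω) - B (s 0)‖ ^ 2) + ‖a n ω - B (w n ω)‖ ^ 2) →
      Tendsto u atTop (𝓝 0) := by
    intro u K hK hu
    rw [tendsto_zero_iff_norm_tendsto_zero]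
    have h1 : Tendsto (fun n => K * ‖u n‖ ^ 2) atTop (𝓝 0) :=
      squeeze_zero (fun n => by positivity) hu hsum0
    have h2 := (h1.const_mul K⁻¹).sqrt
    simpa [← mul_assoc, inv_mul_cancel₀ hK.ne'] using h2
  have hwt : Tendsto (fun n => w n ω - t n ω) atTop (𝓝 0) := hsmall hεγ fun n => by
    nlinarith [sq_nonneg ‖B (w n ω) - B (s 0)‖, sq_nonneg ‖a n ω - B (w n ω)‖]
  have hBs : Tendsto (fun n => B (w n ω) - B (s 0)) atTop (𝓝 0) := hsmall hεγ fun n => by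
    nlinarith [sq_nonneg ‖w n ω - t n ω‖, sq_nonneg ‖a n ω - B (w n ω)‖]
  have hes : Tendsto (fun n => a n ω - B (w n ω)) atTop (𝓝 0) := hsmall one_pos fun n => by
    have : 0 ≤ ε * γ * (‖w n ω - t n ω‖ ^ 2 + ‖B (w n ω) - B (s 0)‖ ^ 2) := by positivity
    linarith
  have hBw : Tendsto (fun n => B (w n ω)) atTop (𝓝 (B (s 0))) := tendsto_sub_nhds_zero_iff.1 hBs
  -- The selected elements of A (t n) equal M (w n - t n) minus the noise minus B (w n), and the
  -- first two parts vanish.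
  have hu : Tendsto (fun n => M (w n ω) - a n ω - M (t n ω)) atTop (𝓝 (-B (s 0))) := by
    have h1 := (((M.continuous.tendsto 0).comp hwt).sub hes).sub hBw
    simp only [map_zero, sub_zero, zero_sub] at h1
    refine h1.congr fun n => ?_
    simp only [Function.comp, map_sub]; abel
  -- Stated for any filter because it serves twice: along ultrafilters for Opial's lemma, and along
  -- `atTop` to identify the strong limit of B (w n) with B at the weak limit.
  have hlimit : ∀ U : Filter ℕ, U.NeBot → U ≤ atTop → ∀ x,
      (∀ y, Tendsto (fun n => ⟪z n ω, y⟫) U (𝓝 ⟪x, y⟫)) → B x = B (s 0) ∧ x ∈ zeroSet A B := by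
    intro U hUne hU x hx
    refine h.mem_zeroSet_of_tendsto (F := U) hCw (fun y => ?_) (hwt.mono_left hU)
      (fun n => ht n ω) (hu.mono_left hU) (hBw.mono_left hU)
    have h1 := ((hwz.mono_left hU).inner (tendsto_const_nhds (x := y))).add (hx y)
    simpa [inner_sub_left] using h1
  obtain ⟨x, hxZ, hx⟩ := opial h.kappa_pos h.symm h.pos hdense hC
    (by rintro _ ⟨k, rfl⟩; exact (hω k).1) fun U hU x hx => (hlimit U inferInstance hU x hx).2
  refine ⟨x, hxZ, hx, ?_, hwz, _, hCw⟩
  rw [(hlimit atTop inferInstance le_rfl x hx).1]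
  exact hBw

end Stochastic

/-! ### Subdifferentials, conjugates, proximity operators and uniform convexity. -/

section ConvexAnalysis

variable {H : Type*} [NormedAddCommGroup H] [InnerProductSpace ℝ H]

/-- Letting t decrease to 0 extracts a first-order condition from minimality along a segment, where
the error is quadratic in t. -/
theorem nonpos_of_forall_le_mul {A q : ℝ} (h : ∀ t : ℝ, 0 < t → t < 1 → A ≤ t * q) : A ≤ 0 := by
  have h1 : Tendsto (fun t : ℝ => t * q) (𝓝[>] 0) (𝓝 0) := by
    have : Tendsto (fun t : ℝ => t * q) (𝓝 0) (𝓝 (0 * q)) := tendsto_id.mul_const q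
    rw [zero_mul] at this
    exact this.mono_left nhdsWithin_le_nhds
  refine ge_of_tendsto h1 ?_
  filter_upwards [Ioo_mem_nhdsGT (zero_lt_one (α := ℝ))] with t ht
  exact h t ht.1 ht.2

/-- A lower semicontinuous function that is bounded below and uniformly midpoint convex has a
minimizer. -/
theorem exists_mem_argminSet [CompleteSpace H] {F : H → EReal} (hlsc : LowerSemicontinuous F)
    {c ρ : ℝ} (hc : ∀ x, (c : EReal) ≤ F x) {x₀ : H} (hx₀ : F x₀ ≠ ⊤) (hρ : 0 < ρ)
    (hmid : ∀ x y (r s : ℝ), F x ≤ r → F y ≤ s →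
      F ((1 / 2 : ℝ) • x + (1 - 1 / 2 : ℝ) • y) ≤ (((r + s) / 2 - ρ * ‖x - y‖ ^ 2 : ℝ) : EReal)) :
    ∃ x, x ∈ argminSet F := by
  -- The infimum is taken over real upper bounds of values, so the minimizing sequence is handled
  -- with real arithmetic.
  let R : Set ℝ := {r | ∃ x, F x ≤ r}
  have hRc : ∀ r ∈ R, c ≤ r := by
    rintro r ⟨x, hx⟩
    exact EReal.coe_le_coe_iff.1 ((hc x).trans hx)
  have hRne : R.Nonempty := by
    refine ⟨(F x₀).toReal, x₀, EReal.le_coe_toReal hx₀⟩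
  have hRb : BddBelow R := ⟨c, hRc⟩
  set m := sInf R with hm
  have hmle : ∀ r ∈ R, m ≤ r := fun r hr => csInf_le hRb hr
  have hseq : ∀ n : ℕ, ∃ x, F x ≤ ((m + 1 / ((n : ℝ) + 1) : ℝ) : EReal) := by
    intro n
    obtain ⟨r, ⟨x, hx⟩, hr⟩ := exists_lt_of_csInf_lt hRne
      (show sInf R < m + 1 / ((n : ℝ) + 1) by rw [← hm]; linarith [Nat.one_div_pos_of_nat (α := ℝ) (n := n)])
    exact ⟨x, hx.trans (EReal.coe_le_coe_iff.2 hr.le)⟩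
  choose x hx using hseq
  have hcau : CauchySeq x := by
    refine Metric.cauchySeq_iff'.2 fun δ hδ => ?_
    obtain ⟨N, hN⟩ := exists_nat_one_div_lt (show 0 < ρ * δ ^ 2 by positivity)
    refine ⟨N, fun n hn => ?_⟩
    -- The midpoint cannot fall below the infimum, so uniform midpoint convexity bounds ρ ‖x n - x
    -- N‖² by the mean of the two defects.
    have h1 := hmle _ ⟨_, hmid (x n) (x N) _ _ (hx n) (hx N)⟩
    have h2 : 1 / ((n : ℝ) + 1) ≤ 1 / ((N : ℝ) + 1) := Nat.one_div_le_one_div hn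
    have h3 : ρ * ‖x n - x N‖ ^ 2 < ρ * δ ^ 2 := by linarith
    rw [dist_eq_norm]
    exact lt_of_pow_lt_pow_left₀ 2 hδ.le (lt_of_mul_lt_mul_left h3 hρ.le)
  obtain ⟨l, hl⟩ := cauchySeq_tendsto_of_complete hcau
  have hFl : F l ≤ m := by
    by_contra! hlt
    obtain ⟨q, hq1, hq2⟩ := EReal.lt_iff_exists_real_btwn.1 hlt
    have h1 : ∀ᶠ n in atTop, (q : EReal) < F (x n) := hl.eventually (hlsc l q hq2)
    have h2 : ∀ᶠ n : ℕ in atTop, 1 / ((n : ℝ) + 1) < q - m :=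
      tendsto_one_div_add_atTop_nhds_zero_nat.eventually
        (gt_mem_nhds (sub_pos.2 (EReal.coe_lt_coe_iff.1 hq1)))
    obtain ⟨n, hn1, hn2⟩ := (h1.and h2).exists
    have := EReal.coe_lt_coe_iff.1 (hn1.trans_le (hx n))
    linarith
  refine ⟨l, fun y => hFl.trans ?_⟩
  induction hy : F y using EReal.rec with
  | bot => have := hc y; rw [hy] at this; exact absurd (le_bot_iff.1 this) (EReal.coe_ne_bot c)
  | coe r => exact EReal.coe_le_coe_iff.2 (hmle r ⟨y, hy.le⟩)
  | top => exact le_top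

/-- Real upper bounds in place of the values confine the extended-real arithmetic of convexity to
this one place. -/
theorem IsGammaZero.le_of_le {f : H → EReal} (hf : IsGammaZero f) {x y : H} {r s a : ℝ}
    (hx : f x ≤ r) (hy : f y ≤ s) (ha0 : 0 < a) (ha1 : a < 1) :
    f (a • x + (1 - a) • y) ≤ ((a * r + (1 - a) * s : ℝ) : EReal) := by
  refine (hf.convex x y a ha0 ha1).trans ?_
  rw [EReal.coe_add, EReal.coe_mul, EReal.coe_mul]
  exact add_le_add (mul_le_mul_of_nonneg_left hx (EReal.coe_nonneg.2 ha0.le))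
    (mul_le_mul_of_nonneg_left hy (EReal.coe_nonneg.2 (by linarith)))

theorem IsGammaZero.exists_real {f : H → EReal} (hf : IsGammaZero f) {x : H} (hx : f x ≠ ⊤) :
    ∃ r : ℝ, f x = r :=
  ⟨(f x).toReal, (EReal.coe_toReal hx (hf.ne_bot x)).symm⟩

/-- Were the value infinite, the subgradient inequality would make `f` infinite everywhere, against
properness. So a subgradient always carries a real affine minorant. -/
theorem IsGammaZero.exists_real_of_mem_subdiff {f : H → EReal} (hf : IsGammaZero f) {x u : H}
    (hu : u ∈ subdiff f x) :
    ∃ r : ℝ, f x = r ∧ ∀ y, ((r + ⟪y - x, u⟫ : ℝ) : EReal) ≤ f y := by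
  obtain ⟨y, hy⟩ := hf.exists_ne_top
  have hx : f x ≠ ⊤ := by
    intro hx
    have h1 := hu y
    rw [hx, EReal.top_add_coe] at h1
    exact hy (top_le_iff.1 h1)
  obtain ⟨r, hr⟩ := hf.exists_real hx
  refine ⟨r, hr, fun y => ?_⟩
  have h1 := hu y
  rwa [hr, ← EReal.coe_add] at h1

theorem mem_subdiff_of_real {f : H → EReal} {x u : H} {r : ℝ} (hr : f x = r)
    (h : ∀ y, ∀ r' : ℝ, f y = r' → r + ⟪y - x, u⟫ ≤ r') (hb : ∀ y, f y ≠ ⊥) : u ∈ subdiff f x := by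
  intro y
  rw [hr, ← EReal.coe_add]
  induction hy : f y using EReal.rec with
  | bot => exact absurd hy (hb y)
  | coe r' => exact EReal.coe_le_coe_iff.2 (h y r' hy)
  | top => exact le_top

theorem subdiff_monotone {f : H → EReal} (hf : IsGammaZero f) {x y u v : H}
    (hu : u ∈ subdiff f x) (hv : v ∈ subdiff f y) : 0 ≤ ⟪x - y, u - v⟫ := by
  obtain ⟨r, hr, h1⟩ := hf.exists_real_of_mem_subdiff hu
  obtain ⟨s, hs, h2⟩ := hf.exists_real_of_mem_subdiff hv
  have h3 := h1 y
  have h4 := h2 x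
  rw [hs, EReal.coe_le_coe_iff] at h3
  rw [hr, EReal.coe_le_coe_iff] at h4
  simp only [inner_sub_left, inner_sub_right] at *
  linarith

theorem lowerSemicontinuous_add_coe {X : Type*} [TopologicalSpace X] {f : X → EReal} (hf : LowerSemicontinuous f) {Q : X → ℝ}
    (hQ : Continuous Q) : LowerSemicontinuous fun y => f y + (Q y : EReal) :=
  hf.add' (continuous_coe_real_ereal.comp hQ).lowerSemicontinuous fun _ =>
    EReal.continuousAt_add (.inr (EReal.coe_ne_bot _)) (.inr (EReal.coe_ne_top _))

/-- Surjectivity of `∂f + T` for `T` self-adjoint and strongly positive. -/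
theorem IsGammaZero.exists_sub_mem_subdiff [CompleteSpace H] {f : H → EReal} (hf : IsGammaZero f)
    {x₀ u₀ : H} (hu₀ : u₀ ∈ subdiff f x₀) {T : H →L[ℝ] H} (hT : IsSAStronglyPositive T) (x : H) :
    ∃ y, x - T y ∈ subdiff f y := by
  obtain ⟨κ, hκ, hb⟩ := hT.bounded_below
  have hsymm : ∀ a b, ⟪T a, b⟫ = ⟪a, T b⟫ := fun a b => hT.isSelfAdjoint.isSymmetric a b
  -- The given subgradient supplies an affine minorant directly, with no separation argument. The
  -- point sought minimizes f + Q for the quadratic Q below.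
  obtain ⟨r₀, hr₀, hminor⟩ := hf.exists_real_of_mem_subdiff hu₀
  let Q : H → ℝ := fun y => 1 / 2 * ⟪T y, y⟫ - ⟪x, y⟫
  have hQc : Continuous Q := by fun_prop
  have hQmid : ∀ y y' : H, Q ((1 / 2 : ℝ) • y + (1 - 1 / 2 : ℝ) • y') =
      (Q y + Q y') / 2 - 1 / 8 * ⟪T (y - y'), y - y'⟫ := by
    intro y y'
    have h1 : ⟪T y', y⟫ = ⟪T y, y'⟫ := by rw [hsymm, real_inner_comm]
    simp only [Q, map_add, map_sub, map_smul, inner_add_left, inner_add_right, inner_sub_left,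
      inner_sub_right, real_inner_smul_left, real_inner_smul_right, h1]
    ring
  obtain ⟨y, hy⟩ := exists_mem_argminSet (F := fun y => f y + (Q y : EReal))
    -- The lower bound is the minimum of the affine minorant plus κ/2 ‖y‖² - ⟪x, y⟫; the modulus κ/8
    -- comes from the factor 1/8 in `hQmid`.
    (c := r₀ - ⟪x₀, u₀⟫ - ‖u₀ - x‖ ^ 2 / (2 * κ)) (ρ := κ / 8) (x₀ := x₀)
    (lowerSemicontinuous_add_coe hf.lsc hQc)
    (by
      intro y
      refine le_trans ?_ (add_le_add_left (hminor y) (Q y : EReal))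
      rw [← EReal.coe_add, EReal.coe_le_coe_iff]
      have h1 := hb y
      have h2 : -(‖u₀ - x‖ * ‖y‖) ≤ ⟪y, u₀ - x⟫ := by
        have := neg_le_of_abs_le (abs_real_inner_le_norm y (u₀ - x))
        linarith [mul_comm ‖y‖ ‖u₀ - x‖]
      have h3 : ⟪y, u₀ - x⟫ = ⟪y, u₀⟫ - ⟪x, y⟫ := by rw [inner_sub_right, real_inner_comm x y]
      have h4 : ‖u₀ - x‖ * ‖y‖ ≤ κ / 2 * ‖y‖ ^ 2 + ‖u₀ - x‖ ^ 2 / (2 * κ) := by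
        have h5 : κ / 2 * ‖y‖ ^ 2 + ‖u₀ - x‖ ^ 2 / (2 * κ) - ‖u₀ - x‖ * ‖y‖ =
            (κ * ‖y‖ - ‖u₀ - x‖) ^ 2 / (2 * κ) := by field_simp; ring
        have h6 : 0 ≤ (κ * ‖y‖ - ‖u₀ - x‖) ^ 2 / (2 * κ) := by positivity
        linarith
      simp only [Q, inner_sub_left]
      linarith)
    (by rw [hr₀, ← EReal.coe_add]; exact EReal.coe_ne_top _) (by positivity)
    (by
      intro y y' r s hr hs
      have hr' : f y ≤ ((r - Q y : ℝ) : EReal) := by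
        rw [EReal.coe_sub]
        exact EReal.le_sub_iff_add_le (.inl (EReal.coe_ne_bot _)) (.inl (EReal.coe_ne_top _)) |>.2 hr
      have hs' : f y' ≤ ((s - Q y' : ℝ) : EReal) := by
        rw [EReal.coe_sub]
        exact EReal.le_sub_iff_add_le (.inl (EReal.coe_ne_bot _)) (.inl (EReal.coe_ne_top _)) |>.2 hs
      have h1 := hf.le_of_le hr' hs' (a := 1 / 2) (by norm_num) (by norm_num)
      refine (add_le_add_left h1 _).trans ?_
      rw [← EReal.coe_add, EReal.coe_le_coe_iff, hQmid]
      have := hb (y - y')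
      linarith)
  refine ⟨y, ?_⟩
  have hytop : f y ≠ ⊤ := by
    intro h
    have h1 := hy x₀
    simp only [h, hr₀, EReal.top_add_coe, ← EReal.coe_add] at h1
    exact EReal.coe_ne_top _ (top_le_iff.1 h1)
  obtain ⟨r, hr⟩ := hf.exists_real hytop
  refine mem_subdiff_of_real hr (fun y' r' hr' => ?_) hf.ne_bot
  have h0 : r - r' + ⟪y' - y, x - T y⟫ ≤ 0 := by
    refine nonpos_of_forall_le_mul (q := 1 / 2 * ⟪T (y' - y), y' - y⟫) fun t ht0 ht1 => ?_
    have h1 := hy (t • y' + (1 - t) • y)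
    have h2 := h1.trans (add_le_add_left (hf.le_of_le hr'.le hr.le ht0 ht1) _)
    simp only [hr] at h2
    rw [← EReal.coe_add, ← EReal.coe_add, EReal.coe_le_coe_iff] at h2
    have h3 : Q (t • y' + (1 - t) • y) = Q y + t * ⟪y' - y, T y - x⟫ +
        t * (t * (1 / 2 * ⟪T (y' - y), y' - y⟫)) := by
      have e1 : ⟪T y', y⟫ = ⟪T y, y'⟫ := by rw [hsymm, real_inner_comm]
      have e2 : ⟪y', T y⟫ = ⟪T y, y'⟫ := real_inner_comm _ _
      have e3 : ⟪y, T y⟫ = ⟪T y, y⟫ := real_inner_comm _ _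
      have e4 : ⟪y', x⟫ = ⟪x, y'⟫ := real_inner_comm _ _
      have e5 : ⟪y, x⟫ = ⟪x, y⟫ := real_inner_comm _ _
      simp only [Q, map_add, map_sub, map_smul, inner_add_left, inner_add_right, inner_sub_left,
        inner_sub_right, real_inner_smul_left, real_inner_smul_right, e1, e2, e3, e4, e5]
      ring
    rw [h3] at h2
    have h4 : ⟪y' - y, T y - x⟫ = -⟪y' - y, x - T y⟫ := by rw [← inner_neg_right, neg_sub]
    rw [h4] at h2
    refine le_of_mul_le_mul_left ?_ ht0
    linarith
  linarith

/-- The Fenchel–Young inequality at a point where the value is real. -/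
theorem coe_inner_sub_le_conj {f : H → EReal} {x : H} {r : ℝ} (hr : f x = r) (u : H) :
    ((⟪u, x⟫ - r : ℝ) : EReal) ≤ conj f u := by
  refine le_trans ?_ (le_iSup (fun x => ((⟪u, x⟫ : ℝ) : EReal) - f x) x)
  rw [hr, EReal.coe_sub]

/-- The equality case of Fenchel–Young: a subgradient at x makes x a maximizer in the supremum
defining the conjugate. -/
theorem conj_eq_of_mem_subdiff {f : H → EReal} {x u : H} {r : ℝ} (hr : f x = r)
    (hu : u ∈ subdiff f x) : conj f u = ((⟪u, x⟫ - r : ℝ) : EReal) := by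
  refine le_antisymm (iSup_le fun y => ?_) (coe_inner_sub_le_conj hr u)
  have h1 := hu y
  rw [hr, ← EReal.coe_add] at h1
  refine (EReal.sub_le_sub le_rfl h1).trans ?_
  rw [← EReal.coe_sub, EReal.coe_le_coe_iff, inner_sub_left, real_inner_comm u y,
    real_inner_comm u x]
  linarith

/-- The easy half of Fenchel duality for subdifferentials. -/
theorem mem_subdiff_conj {f : H → EReal} {x u : H} {r : ℝ} (hr : f x = r)
    (hu : u ∈ subdiff f x) : x ∈ subdiff (conj f) u := by
  intro v
  rw [conj_eq_of_mem_subdiff hr hu, ← EReal.coe_add]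
  refine le_trans (le_of_eq ?_) (coe_inner_sub_le_conj hr v)
  rw [inner_sub_left]; congr 1; ring

/-- Lax–Milgram: the form (u, v) ↦ ⟪T u, v⟫ is coercive, and the continuous equivalence representing
it can only be `T`. -/
theorem IsSAStronglyPositive.isInvertible [CompleteSpace H] {T : H →L[ℝ] H}
    (hT : IsSAStronglyPositive T) : T.IsInvertible := by
  obtain ⟨χ, hχ, hb⟩ := hT.bounded_below
  have hco : IsCoercive ((innerSL ℝ : H →L[ℝ] H →L[ℝ] ℝ) ∘L T) := by
    refine ⟨χ, hχ, fun u => ?_⟩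
    have := hb u
    rw [mul_assoc, ← sq]
    exact this
  refine ⟨hco.continuousLinearEquivOfBilin, ?_⟩
  ext v
  exact (hco.unique_continuousLinearEquivOfBilin fun w => rfl).symm

/-- The proximity operator of a conjugate function through the subdifferential of the function. -/
theorem exists_prox_conj_eq [CompleteSpace H] {f : H → EReal} (hf : IsGammaZero f)
    {x₀ u₀ : H} (hu₀ : u₀ ∈ subdiff f x₀) {W : H →L[ℝ] H} (hW : IsSAStronglyPositive W) (x : H) :
    ∃ y, prox W.inverse (conj f) x = x - W y ∧ x - W y ∈ subdiff f y := by
  obtain ⟨y, hy⟩ := hf.exists_sub_mem_subdiff hu₀ hW x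
  refine ⟨y, ?_, hy⟩
  obtain ⟨χ, hχ, hb⟩ := hW.bounded_below
  have hinv := hW.isInvertible
  have hsymm : ∀ a b, ⟪W a, b⟫ = ⟪a, W b⟫ := fun a b => hW.isSelfAdjoint.isSymmetric a b
  obtain ⟨r, hr, -⟩ := hf.exists_real_of_mem_subdiff hy
  -- Moreau's decomposition in the metric of W: q ∈ ∂f(y), while W⁻¹ (x - q) = y, which is the
  -- optimality condition at q.
  set q := x - W y with hq
  have hconj := conj_eq_of_mem_subdiff hr hy
  have hsq : ∀ q', sqNorm W.inverse (x - q') = sqNorm W.inverse (x - q) +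
      2 * ⟪q - q', y⟫ + sqNorm W.inverse (q - q') := by
    intro q'
    obtain ⟨d, hd⟩ := hinv.surjective (q - q')
    have h1 : x - q = W y := by rw [hq]; abel
    have h2 : x - q' = W (y + d) := by rw [map_add, hd, ← h1]; abel
    rw [h2, h1, ← hd]
    simp only [sqNorm, hinv.inverse_apply_self, map_add, inner_add_left, inner_add_right]
    rw [← hsymm y d, hsymm d y, real_inner_comm d (W y)]
    ring
  have hpos : ∀ q', sqNorm W.inverse (q - q') ≤ 0 → q' = q := by
    intro q' h
    obtain ⟨d, hd⟩ := hinv.surjective (q - q')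
    rw [← hd, sqNorm, hinv.inverse_apply_self, real_inner_comm] at h
    have h1 := hb d
    have h2 : ‖d‖ = 0 := by
      have : ‖d‖ ^ 2 ≤ 0 := by nlinarith [sq_nonneg ‖d‖]
      nlinarith [norm_nonneg d]
    rw [norm_eq_zero.1 h2, map_zero] at hd
    exact (sub_eq_zero.1 hd.symm).symm
  have hnn : ∀ q', 0 ≤ sqNorm W.inverse (q - q') := by
    intro q'
    obtain ⟨d, hd⟩ := hinv.surjective (q - q')
    rw [← hd, sqNorm, hinv.inverse_apply_self, real_inner_comm]
    exact (mul_nonneg hχ.le (sq_nonneg _)).trans (hb d)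
  -- By Fenchel–Young the objective at q' exceeds its value at q by at least half of ‖q - q'‖² in
  -- the metric W⁻¹. This gives minimality of q and also uniqueness, which is needed because the
  -- proximity operator is an arbitrary choice among minimizers.
  have hlow : ∀ q', ((⟪q, y⟫ - r + 1 / 2 * sqNorm W.inverse (x - q) +
      1 / 2 * sqNorm W.inverse (q - q') : ℝ) : EReal) ≤
      conj f q' + ((1 / 2 * sqNorm W.inverse (x - q') : ℝ) : EReal) := by
    intro q'
    refine le_trans ?_ (add_le_add_left (coe_inner_sub_le_conj hr q') _)
    rw [← EReal.coe_add, EReal.coe_le_coe_iff, hsq q', inner_sub_left q q' y]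
    linarith
  have hmem : q ∈ argminSet fun y => conj f y + ((1 / 2 * sqNorm W.inverse (x - y) : ℝ) : EReal) := by
    intro q'
    refine le_trans ?_ (hlow q')
    simp only [hconj]
    rw [← EReal.coe_add, EReal.coe_le_coe_iff]
    linarith [hnn q']
  refine hpos _ ?_
  have hmem' := Classical.epsilon_spec (p := fun p => p ∈ argminSet fun y =>
    conj f y + ((1 / 2 * sqNorm W.inverse (x - y) : ℝ) : EReal)) ⟨q, hmem⟩
  have h1 := (hlow _).trans (hmem' q)
  simp only [hconj] at h1
  rw [← EReal.coe_add, EReal.coe_le_coe_iff] at h1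
  change sqNorm W.inverse (q - Classical.epsilon _) ≤ 0
  linarith

/-- The quadratic growth of a strongly convex function over its affine minorants. -/
theorem IsStronglyConvex.exists_growth {f : H → EReal} (hsc : IsStronglyConvex f) : ∃ ρ : ℝ, 0 < ρ ∧ (∀ x y (r s : ℝ), f x ≤ r → f y ≤ s →
      f ((1 / 2 : ℝ) • x + (1 - 1 / 2 : ℝ) • y) ≤ (((r + s) / 2 - ρ * ‖x - y‖ ^ 2 : ℝ) : EReal)) ∧
      ∀ x u, u ∈ subdiff f x → ∀ r s : ℝ, f x = r → ∀ y, f y = s →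
        r + ⟪y - x, u⟫ + 2 * ρ * ‖x - y‖ ^ 2 ≤ s := by
  obtain ⟨ρ, hρ, h⟩ := hsc
  have hmid : ∀ x y (r s : ℝ), f x ≤ r → f y ≤ s → f ((1 / 2 : ℝ) • x + (1 - 1 / 2 : ℝ) • y) ≤
      (((r + s) / 2 - ρ / 8 * ‖x - y‖ ^ 2 : ℝ) : EReal) := by
    intro x y r s hr hs
    have h1 := h x y (1 / 2) (by norm_num) (by norm_num)
    have h2 : ((1 / 2 : ℝ) : EReal) * f x + ((1 - 1 / 2 : ℝ) : EReal) * f y ≤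
        (((r + s) / 2 : ℝ) : EReal) := by
      have e : (r + s) / 2 = 1 / 2 * r + (1 - 1 / 2) * s := by ring
      rw [e, EReal.coe_add, EReal.coe_mul, EReal.coe_mul]
      exact add_le_add (mul_le_mul_of_nonneg_left hr (EReal.coe_nonneg.2 (by norm_num)))
        (mul_le_mul_of_nonneg_left hs (EReal.coe_nonneg.2 (by norm_num)))
    have h3 := h1.trans h2
    rw [EReal.coe_sub]
    refine (EReal.le_sub_iff_add_le (.inl (EReal.coe_ne_bot _)) (.inl (EReal.coe_ne_top _))).2 ?_
    convert h3 using 4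
    ring
  -- The value ρ/8 is a (1 - a) ρ/2 at a = 1/2. Applying the subgradient inequality at the midpoint
  -- and doubling produces the growth constant 2 (ρ/8).
  refine ⟨ρ / 8, by positivity, hmid, fun x u hu r s hr y hs => ?_⟩
  have h1 := hu ((1 / 2 : ℝ) • x + (1 - 1 / 2 : ℝ) • y)
  have h2 := h1.trans (hmid x y r s hr.le hs.le)
  rw [hr, ← EReal.coe_add, EReal.coe_le_coe_iff] at h2
  have e : (1 / 2 : ℝ) • x + (1 - 1 / 2 : ℝ) • y - x = (1 / 2 : ℝ) • (y - x) := by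
    module
  rw [e, real_inner_smul_left] at h2
  linarith

/-- The conjugate of a strongly convex function is finite and differentiable, and its gradient
inverts the subdifferential. -/
theorem IsStronglyConvex.mem_subdiff_gradConj [CompleteSpace H] {f : H → EReal}
    (hf : IsGammaZero f) (hsc : IsStronglyConvex f) {x₀ u₀ : H} (hu₀ : u₀ ∈ subdiff f x₀) (v : H) :
    v ∈ subdiff f (gradConj f v) ∧ ∀ y, v ∈ subdiff f y → y = gradConj f v := by
  obtain ⟨ρ, hρ, hmid, hgrow⟩ := hsc.exists_growth
  have hex : ∀ v, ∃ y, v ∈ subdiff f y := by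
    intro v
    obtain ⟨r₀, hr₀, -⟩ := hf.exists_real_of_mem_subdiff hu₀
    have hQc : Continuous fun y => -⟪v, y⟫ := by fun_prop
    obtain ⟨y, hy⟩ := exists_mem_argminSet (F := fun y => f y + ((-⟪v, y⟫ : ℝ) : EReal))
      -- A minimizer of f - ⟪v, ·⟫ has v as a subgradient. This lower bound is the minimum of the
      -- quadratic growth 2ρ ‖y - x₀‖² against the linear term ⟪y - x₀, u₀ - v⟫.
      (c := r₀ - ⟪v, x₀⟫ - ‖u₀ - v‖ ^ 2 / (8 * ρ)) (ρ := ρ) (x₀ := x₀)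
      (lowerSemicontinuous_add_coe hf.lsc hQc)
      (by
        intro y
        induction hy : f y using EReal.rec with
        | bot => exact absurd hy (hf.ne_bot y)
        | top => rw [EReal.top_add_coe]; exact le_top
        | coe s =>
          rw [← EReal.coe_add, EReal.coe_le_coe_iff]
          have h1 := hgrow x₀ u₀ hu₀ r₀ s hr₀ y hy
          have h2 : -(‖y - x₀‖ * ‖u₀ - v‖) ≤ ⟪y - x₀, u₀ - v⟫ :=
            neg_le_of_abs_le (abs_real_inner_le_norm _ _)
          have h3 : ⟪y - x₀, u₀ - v⟫ = ⟪y - x₀, u₀⟫ - ⟪v, y⟫ + ⟪v, x₀⟫ := by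
            rw [inner_sub_right, inner_sub_left y x₀ v, real_inner_comm v y, real_inner_comm v x₀]
            ring
          have h4 : ‖y - x₀‖ * ‖u₀ - v‖ ≤
              2 * ρ * ‖x₀ - y‖ ^ 2 + ‖u₀ - v‖ ^ 2 / (8 * ρ) := by
            rw [norm_sub_rev x₀ y]
            have h5 : 2 * ρ * ‖y - x₀‖ ^ 2 + ‖u₀ - v‖ ^ 2 / (8 * ρ) - ‖y - x₀‖ * ‖u₀ - v‖ =
                (4 * ρ * ‖y - x₀‖ - ‖u₀ - v‖) ^ 2 / (8 * ρ) := by field_simp; ring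
            have h6 : 0 ≤ (4 * ρ * ‖y - x₀‖ - ‖u₀ - v‖) ^ 2 / (8 * ρ) := by positivity
            linarith
          linarith)
      (by rw [hr₀, ← EReal.coe_add]; exact EReal.coe_ne_top _) hρ
      (by
        intro y y' r s hr hs
        have hr' : f y ≤ ((r + ⟪v, y⟫ : ℝ) : EReal) := by
          rw [← sub_neg_eq_add, EReal.coe_sub]
          exact EReal.le_sub_iff_add_le (.inl (EReal.coe_ne_bot _)) (.inl (EReal.coe_ne_top _)) |>.2 hr
        have hs' : f y' ≤ ((s + ⟪v, y'⟫ : ℝ) : EReal) := by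
          rw [← sub_neg_eq_add, EReal.coe_sub]
          exact EReal.le_sub_iff_add_le (.inl (EReal.coe_ne_bot _)) (.inl (EReal.coe_ne_top _)) |>.2 hs
        refine (add_le_add_left (hmid y y' _ _ hr' hs') _).trans ?_
        rw [← EReal.coe_add, EReal.coe_le_coe_iff, inner_add_right, real_inner_smul_right,
          real_inner_smul_right]
        linarith)
    refine ⟨y, ?_⟩
    have hytop : f y ≠ ⊤ := by
      intro h
      have h1 := hy x₀
      simp only [h, hr₀, EReal.top_add_coe, ← EReal.coe_add] at h1
      exact EReal.coe_ne_top _ (top_le_iff.1 h1)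
    obtain ⟨r, hr⟩ := hf.exists_real hytop
    refine mem_subdiff_of_real hr (fun y' r' hr' => ?_) hf.ne_bot
    have h1 := hy y'
    simp only [hr, hr', ← EReal.coe_add, EReal.coe_le_coe_iff] at h1
    rw [inner_sub_left, real_inner_comm v y, real_inner_comm v y']
    linarith
  choose Y hY using hex
  have hYr : ∀ v, ∃ r : ℝ, f (Y v) = r := fun v =>
    (hf.exists_real_of_mem_subdiff (hY v)).imp fun r h => h.1
  choose R hR using hYr
  have hmono : ∀ x x' u u', u ∈ subdiff f x → u' ∈ subdiff f x' →
      4 * ρ * ‖x' - x‖ ^ 2 ≤ ⟪u' - u, x' - x⟫ := by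
    intro x x' u u' hu hu'
    obtain ⟨r, hr, -⟩ := hf.exists_real_of_mem_subdiff hu
    obtain ⟨r', hr', -⟩ := hf.exists_real_of_mem_subdiff hu'
    have h1 := hgrow x u hu r r' hr x' hr'
    have h2 := hgrow x' u' hu' r' r hr' x hr
    rw [norm_sub_rev] at h1
    have h3 : ⟪u' - u, x' - x⟫ = -⟪x' - x, u⟫ - ⟪x - x', u'⟫ := by
      rw [real_inner_comm, inner_sub_right, ← neg_sub x' x, inner_neg_left]; ring
    linarith
  have hlip : ∀ u v, 4 * ρ * ‖Y u - Y v‖ ≤ ‖u - v‖ := by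
    intro u v
    have h1 := hmono _ _ _ _ (hY v) (hY u)
    have h2 := h1.trans (real_inner_le_norm _ _)
    rcases (norm_nonneg (Y u - Y v)).eq_or_lt with h0 | h0
    · rw [← h0, mul_zero]; exact norm_nonneg _
    · refine le_of_mul_le_mul_right ?_ h0
      linarith
  have hconj : ∀ v, conj f v = ((⟪v, Y v⟫ - R v : ℝ) : EReal) := fun v =>
    conj_eq_of_mem_subdiff (hR v) (hY v)
  have hcr : ∀ v, (conj f v).toReal = ⟪v, Y v⟫ - R v := fun v => by
    rw [hconj, EReal.toReal_coe]
  have hle : ∀ u v, ⟪v, Y u⟫ - R u ≤ ⟪v, Y v⟫ - R v := fun u v => by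
    rw [← EReal.coe_le_coe_iff, ← hconj]
    exact coe_inner_sub_le_conj (hR u) v
  have hgrad : ∀ v, gradConj f v = Y v := by
    intro v
    refine HasGradientAt.gradient ?_
    rw [hasGradientAt_iff_isLittleO]
    -- The two inequalities from `hle` squeeze the remainder of the conjugate between 0 and ⟪w - v,
    -- Y w - Y v⟫, which is O(‖w - v‖²) as Y is Lipschitz.
    refine Asymptotics.IsBigO.trans_isLittleO (g := fun w => ‖w - v‖ ^ 2) ?_ ?_
    · refine Asymptotics.IsBigO.of_bound (1 / (4 * ρ)) (Eventually.of_forall fun w => ?_)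
      rw [hcr, hcr]
      have h1 := hle v w
      have h2 := hle w v
      have h3 : ⟪w - v, Y w - Y v⟫ ≤ 1 / (4 * ρ) * ‖w - v‖ ^ 2 := by
        refine (real_inner_le_norm _ _).trans ?_
        have := hlip w v
        rw [one_div_mul_eq_div, le_div_iff₀ (by positivity)]
        nlinarith [norm_nonneg (w - v)]
      have e1 := real_inner_comm (Y v) w
      have e2 := real_inner_comm (Y v) v
      rw [Real.norm_eq_abs, Real.norm_eq_abs, abs_of_nonneg (sq_nonneg ‖w - v‖), abs_of_nonneg]
      · simp only [inner_sub_left, inner_sub_right] at *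
        linarith
      · simp only [inner_sub_left, inner_sub_right] at *
        linarith
    · have h1 : Tendsto (fun w => w - v) (𝓝 v) (𝓝 0) := tendsto_sub_nhds_zero_iff.2 tendsto_id
      exact (Asymptotics.isLittleO_norm_pow_id one_lt_two).comp_tendsto h1
  rw [hgrad]
  refine ⟨hY v, fun y hy => ?_⟩
  have h1 := hmono _ _ _ _ (hY v) hy
  rw [sub_self, inner_zero_left] at h1
  have h2 : ‖y - Y v‖ ^ 2 ≤ 0 := by nlinarith [sq_nonneg ‖y - Y v‖]
  have h3 : ‖y - Y v‖ = 0 := by nlinarith [norm_nonneg (y - Y v)]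
  exact sub_eq_zero.1 (norm_eq_zero.1 h3)

/-- The gradient inequality for convex functions. -/
theorem ConvexOn.add_inner_gradient_le [CompleteSpace H] {φ : H → ℝ}
    (hφ : ConvexOn ℝ Set.univ φ) (hd : Differentiable ℝ φ) (x y : H) :
    φ x + ⟪y - x, gradient φ x⟫ ≤ φ y := by
  have h1 : HasDerivAt (fun t : ℝ => φ (x + t • (y - x))) ⟪y - x, gradient φ x⟫ 0 := by
    have h2 : HasLineDerivAt ℝ φ (fderiv ℝ φ x (y - x)) x (y - x) :=
      (hd x).hasFDerivAt.hasLineDerivAt _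
    have h3 : fderiv ℝ φ x (y - x) = ⟪y - x, gradient φ x⟫ := by
      rw [real_inner_comm, inner_gradient_left]
    rw [← h3]; exact h2
  have h2 := hasDerivAt_iff_tendsto_slope_zero.1 h1
  have h3 : Tendsto (fun t : ℝ => t⁻¹ • (φ (x + (0 + t) • (y - x)) - φ (x + (0 : ℝ) • (y - x))))
      (𝓝[>] 0) (𝓝 ⟪y - x, gradient φ x⟫) :=
    h2.mono_left (nhdsWithin_mono _ fun t ht => ne_of_gt ht)
  have h4 : ⟪y - x, gradient φ x⟫ ≤ φ y - φ x := by
    refine le_of_tendsto h3 ?_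
    filter_upwards [Ioo_mem_nhdsGT (zero_lt_one (α := ℝ))] with t ht
    have h5 := hφ.2 (Set.mem_univ x) (Set.mem_univ y) (by linarith [ht.2] : 0 ≤ 1 - t) ht.1.le
      (by ring)
    have e : x + (0 + t) • (y - x) = (1 - t) • x + t • y := by module
    rw [e, zero_smul, add_zero, smul_eq_mul, inv_mul_le_iff₀ ht.1]
    simp only [smul_eq_mul] at h5
    linarith
  linarith

/-- Strong convergence from uniform convexity at the limit. -/
theorem UniformlyConvexAt.tendsto {F : H → ℝ} {x u : H}
    (hF : UniformlyConvexAt (fun y => (F y : EReal)) x)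
    (hu : ∀ y, F x + ⟪y - x, u⟫ ≤ F y) {y : ℕ → H} {v : ℕ → H}
    (hv : ∀ n y', F (y n) + ⟪y' - y n, v n⟫ ≤ F y') {C : ℝ} (hC : ∀ n, ‖y n‖ ≤ C)
    (hvu : Tendsto v atTop (𝓝 u)) : Tendsto y atTop (𝓝 x) := by
  obtain ⟨-, θ, hθm, hθ0, hθ⟩ := hF
  -- Uniform convexity at the midpoint gives θ/4 on the left. The subgradients u at x and v n at y n
  -- bound the rest by half of ⟪y n - x, v n - u⟫, whence the factor 2.
  have h1 : ∀ n, θ ‖x - y n‖₊ ≤ ENNReal.ofReal (2 * ((C + ‖x‖) * ‖v n - u‖)) := by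
    intro n
    have h2 := hθ (y n) (EReal.coe_ne_top _) (1 / 2) (by norm_num) (by norm_num)
    have e1 : ((1 / 2 : ℝ) : EReal) * (F x : EReal) + ((1 - 1 / 2 : ℝ) : EReal) * (F (y n) : EReal) =
        ((1 / 2 * F x + (1 - 1 / 2) * F (y n) : ℝ) : EReal) := by
      rw [EReal.coe_add, EReal.coe_mul, EReal.coe_mul]
    rw [e1] at h2
    have h3 := hu ((1 / 2 : ℝ) • x + (1 - 1 / 2 : ℝ) • y n)
    have e2 : (1 / 2 : ℝ) • x + (1 - 1 / 2 : ℝ) • y n - x = (1 / 2 : ℝ) • (y n - x) := by module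
    rw [e2, real_inner_smul_left] at h3
    have h4 := hv n x
    have h5 : ⟪y n - x, v n - u⟫ ≤ (C + ‖x‖) * ‖v n - u‖ := by
      refine (real_inner_le_norm _ _).trans (mul_le_mul_of_nonneg_right ?_ (norm_nonneg _))
      exact (norm_sub_le _ _).trans (by linarith [hC n])
    have h6 : ⟪x - y n, v n⟫ = -⟪y n - x, v n⟫ := by rw [← neg_sub, inner_neg_left]
    rw [inner_sub_right] at h5
    induction hθv : θ ‖x - y n‖₊ using ENNReal.recTopCoe with
    | top =>
      rw [hθv] at h2
      exfalso
      have e3 : ((1 / 2 * (1 - 1 / 2) : ℝ) : EReal) * ((⊤ : ℝ≥0∞) : EReal) = ⊤ := by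
        rw [EReal.coe_ennreal_top]
        exact EReal.coe_mul_top_of_pos (by norm_num)
      rw [e3, EReal.coe_add_top] at h2
      exact EReal.coe_ne_top _ (top_le_iff.1 h2)
    | coe τ =>
      rw [hθv] at h2
      have e3 : (((τ : ℝ≥0∞)) : EReal) = ((τ : ℝ) : EReal) := rfl
      rw [e3, ← EReal.coe_mul, ← EReal.coe_add, EReal.coe_le_coe_iff] at h2
      rw [← ENNReal.ofReal_coe_nnreal]
      refine ENNReal.ofReal_le_ofReal ?_
      linarith
  rw [tendsto_iff_norm_sub_tendsto_zero, Metric.tendsto_atTop]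
  intro δ hδ
  have h2 : Tendsto (fun n => ENNReal.ofReal (2 * ((C + ‖x‖) * ‖v n - u‖))) atTop (𝓝 0) := by
    have h3 := ((tendsto_iff_norm_sub_tendsto_zero.1 hvu).const_mul (C + ‖x‖)).const_mul 2
    simp only [mul_zero] at h3
    rw [← ENNReal.ofReal_zero]
    exact (ENNReal.continuous_ofReal.tendsto 0).comp h3
  -- If ‖x - y n‖ ≥ δ, monotonicity of θ would keep θ above the positive number θ δ, although it
  -- tends to 0.
  have h3 : 0 < θ ⟨δ, hδ.le⟩ := pos_iff_ne_zero.2 fun h => hδ.ne' (congrArg NNReal.toReal ((hθ0 _).1 h))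
  obtain ⟨N, hN⟩ := eventually_atTop.1 (h2.eventually (gt_mem_nhds h3))
  refine ⟨N, fun n hn => ?_⟩
  rw [dist_zero_right, norm_norm, norm_sub_rev]
  by_contra! hcon
  exact absurd ((hθm (show (⟨δ, hδ.le⟩ : ℝ≥0) ≤ ‖x - y n‖₊ from hcon)).trans (h1 n))
    (not_le.2 (hN n hn))

end ConvexAnalysis

/-! ### The primal-dual operator and its metric. -/

section PrimalDual

variable {E F : Type*} [NormedAddCommGroup E] [InnerProductSpace ℝ E] [CompleteSpace E]
  [NormedAddCommGroup F] [InnerProductSpace ℝ F] [CompleteSpace F]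

theorem IsSAStronglyPositive.inner_comm {T : E →L[ℝ] E} (hT : IsSAStronglyPositive T) (x y : E) :
    ⟪T x, y⟫ = ⟪x, T y⟫ :=
  hT.isSelfAdjoint.isSymmetric x y

theorem IsSAStronglyPositive.inverse {T : E →L[ℝ] E} (hT : IsSAStronglyPositive T) :
    IsSAStronglyPositive T.inverse := by
  have hinv := hT.isInvertible
  constructor
  · rw [ContinuousLinearMap.isSelfAdjoint_iff_isSymmetric]
    intro x y
    obtain ⟨u, rfl⟩ := hinv.surjective x
    obtain ⟨v, rfl⟩ := hinv.surjective y
    change ⟪T.inverse (T u), T v⟫ = ⟪T u, T.inverse (T v)⟫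
    rw [hinv.inverse_apply_self, hinv.inverse_apply_self, hT.inner_comm]
  · obtain ⟨χ, hχ, hb⟩ := hT.bounded_below
    -- With x = T u the form equals ⟪T u, u⟫ ≥ χ ‖u‖², and ‖T u‖ ≤ (‖T‖ + 1) ‖u‖; the added 1 avoids
    -- a zero denominator.
    refine ⟨χ / (‖T‖ + 1) ^ 2, by positivity, fun x => ?_⟩
    obtain ⟨u, rfl⟩ := hinv.surjective x
    rw [hinv.inverse_apply_self, ← hT.inner_comm]
    refine le_trans ?_ (hb u)
    have h1 : ‖T u‖ ≤ (‖T‖ + 1) * ‖u‖ := (T.le_opNorm u).trans (by gcongr; linarith)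
    rw [div_mul_eq_mul_div, div_le_iff₀ (by positivity), mul_assoc]
    refine mul_le_mul_of_nonneg_left ?_ hχ.le
    rw [← mul_pow, mul_comm ‖u‖]
    exact pow_le_pow_left₀ (norm_nonneg _) h1 2

/-- Young's inequality in the metric of `T` and its inverse. -/
theorem IsSAStronglyPositive.two_mul_inner_le {T : E →L[ℝ] E} (hT : IsSAStronglyPositive T)
    {δ : ℝ} (hδ : 0 < δ) (x y : E) :
    2 * ⟪x, y⟫ ≤ δ * ⟪T.inverse x, x⟫ + δ⁻¹ * ⟪T y, y⟫ := by
  have hinv := hT.isInvertible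
  obtain ⟨χ, hχ, hb⟩ := hT.bounded_below
  obtain ⟨u, rfl⟩ := hinv.surjective x
  have h1 := (mul_nonneg hχ.le (sq_nonneg _)).trans (hb (δ • u - y))
  have h2 : ⟪T y, u⟫ = ⟪T u, y⟫ := by rw [hT.inner_comm, real_inner_comm]
  have h3 := mul_nonneg (inv_nonneg.2 hδ.le) h1
  rw [hinv.inverse_apply_self, ← hT.inner_comm]
  simp only [map_sub, map_smul, inner_sub_left, inner_sub_right, real_inner_smul_left,
    real_inner_smul_right, h2] at h3
  have h4 : δ⁻¹ * (δ * (δ * ⟪T u, u⟫) - δ * ⟪T u, y⟫ - (δ * ⟪T u, y⟫ - ⟪T y, y⟫)) =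
      δ * ⟪T u, u⟫ - 2 * ⟪T u, y⟫ + δ⁻¹ * ⟪T y, y⟫ := by field_simp; ring
  linarith

/-- The operator `(x, v) ↦ (V⁻¹ x, W⁻¹ v - L V L* v)`. -/
noncomputable def pdMetric (V : E →L[ℝ] E) (W : F →L[ℝ] F) (L : E →L[ℝ] F) :
    WithLp 2 (E × F) →L[ℝ] WithLp 2 (E × F) :=
  ((WithLp.prodContinuousLinearEquiv 2 ℝ E F).symm : E × F →L[ℝ] WithLp 2 (E × F)) ∘L
    (V.inverse.prodMap (W.inverse - L ∘L V ∘L ContinuousLinearMap.adjoint L)) ∘L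
    (WithLp.prodContinuousLinearEquiv 2 ℝ E F : WithLp 2 (E × F) →L[ℝ] E × F)

/-- The set-valued primal-dual operator
`(x, v) ↦ (-z + L* v) × (r - L x + S⁻¹ v)`. -/
def pdOperator (L : E →L[ℝ] F) (S : F → Set F) (z : E) (r : F) (w : WithLp 2 (E × F)) :
    Set (WithLp 2 (E × F)) :=
  {u | u.fst = -z + ContinuousLinearMap.adjoint L w.snd ∧ w.snd ∈ S (u.snd - r + L w.fst)}

/-- The primal-dual operator formulation satisfies the hypotheses of the abstract analysis. -/
theorem exists_metricInclusion {V : E →L[ℝ] E} (hV : IsSAStronglyPositive V) {W : F →L[ℝ] F}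
    (hW : IsSAStronglyPositive W) {L : E →L[ℝ] F} {S : F → Set F}
    (hSmono : ∀ x y u v, u ∈ S x → v ∈ S y → 0 ≤ ⟪x - y, u - v⟫)
    (hSsurj : ∀ x, ∃ y, x - W y ∈ S y) (z : E) (r : F) {B₁ : E → E} {B₂ : F → F}
    {ν μ θ β : ℝ} (hν : 0 < ν) (hμ : 0 < μ)
    (hB₁ : ∀ x y, ν * ⟪V (B₁ x - B₁ y), B₁ x - B₁ y⟫ ≤ ⟪x - y, B₁ x - B₁ y⟫)
    (hB₂ : ∀ x y, μ * ⟪W (B₂ x - B₂ y), B₂ x - B₂ y⟫ ≤ ⟪x - y, B₂ x - B₂ y⟫)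
    (hθ : ∀ q, θ * ⟪W.inverse q, q⟫ ≤ ⟪W.inverse q, q⟫ -
      ⟪V (ContinuousLinearMap.adjoint L q), ContinuousLinearMap.adjoint L q⟫)
    (hβν : β ≤ ν) (hβμ : β ≤ μ * θ) (hβ : 1 < 2 * β) :
    ∃ κ c γ, MetricInclusion (pdOperator L S z r)
      (fun w => WithLp.toLp 2 (B₁ w.fst, B₂ w.snd)) (pdMetric V W L) κ c γ := by
  have hVi := hV.isInvertible
  have hWi := hW.isInvertible
  have hθ0 : 0 < θ := by
    by_contra! h
    nlinarith
  obtain ⟨χV, hχV, hbV⟩ := hV.bounded_below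
  obtain ⟨χW, hχW, hbW⟩ := hW.bounded_below
  obtain ⟨ηV, hηV, hcV⟩ := hV.inverse.bounded_below
  obtain ⟨ηW, hηW, hcW⟩ := hW.inverse.bounded_below
  -- Exactly 2β > 1 leaves room for such a δ: part δ of the metric pays for Young's inequality, and
  -- the excess 2β - δ⁻¹ of cocoercivity survives.
  obtain ⟨δ, hδ0, hδ1, hδβ⟩ : ∃ δ : ℝ, 0 < δ ∧ δ < 1 ∧ δ⁻¹ < 2 * β := by
    refine ⟨2 / (2 * β + 1), by positivity, by rw [div_lt_one (by linarith)]; linarith, ?_⟩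
    rw [inv_div, div_lt_iff₀ two_pos]; linarith
  obtain ⟨γ, hγ, hγ1, hγ2, hγ3, hγ4⟩ : ∃ γ : ℝ, 0 < γ ∧ γ ≤ (1 - δ) * ηV ∧
      γ ≤ (1 - δ) * θ * ηW ∧ γ ≤ (2 * β - δ⁻¹) * χV ∧ γ ≤ (2 * β - δ⁻¹) / θ * χW := by
    have h1 : 0 < 1 - δ := by linarith
    have h2 : 0 < 2 * β - δ⁻¹ := by linarith
    refine ⟨min (min ((1 - δ) * ηV) ((1 - δ) * θ * ηW))
      (min ((2 * β - δ⁻¹) * χV) ((2 * β - δ⁻¹) / θ * χW)), by positivity, ?_, ?_, ?_, ?_⟩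
    · exact (min_le_left _ _).trans (min_le_left _ _)
    · exact (min_le_left _ _).trans (min_le_right _ _)
    · exact (min_le_right _ _).trans (min_le_left _ _)
    · exact (min_le_right _ _).trans (min_le_right _ _)
  have hquad : ∀ w : WithLp 2 (E × F), ⟪V.inverse w.fst, w.fst⟫ + θ * ⟪W.inverse w.snd, w.snd⟫ ≤
      ⟪pdMetric V W L w, w⟫ := by
    intro w
    rw [WithLp.prod_inner_apply]
    change _ ≤ ⟪V.inverse w.fst, w.fst⟫ +
      ⟪W.inverse w.snd - L (V (ContinuousLinearMap.adjoint L w.snd)), w.snd⟫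
    rw [inner_sub_left, ← ContinuousLinearMap.adjoint_inner_right L]
    linarith [hθ w.snd]
  refine ⟨min ηV (θ * ηW), min (ν * χV) (μ * χW), γ, by positivity, by positivity, hγ,
    ?_, ?_, ?_, ?_, ?_, ?_⟩
  · rintro x y u v ⟨hu1, hu2⟩ ⟨hv1, hv2⟩
    have h1 := hSmono _ _ _ _ hu2 hv2
    rw [WithLp.prod_inner_apply]
    change 0 ≤ ⟪x.fst - y.fst, u.fst - v.fst⟫ + ⟪x.snd - y.snd, u.snd - v.snd⟫
    have e1 : u.fst - v.fst = ContinuousLinearMap.adjoint L (x.snd - y.snd) := by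
      rw [hu1, hv1, map_sub]; abel
    have e2 : u.snd - r + L x.fst - (v.snd - r + L y.fst) =
        (u.snd - v.snd) + L (x.fst - y.fst) := by rw [map_sub]; abel
    -- The couplings L* v and -L x are skew and cancel, so only the monotonicity of S remains.
    rw [e2, inner_add_left] at h1
    rw [e1, ContinuousLinearMap.adjoint_inner_right, real_inner_comm (u.snd - v.snd)]
    linarith
  · intro u
    obtain ⟨y, hy⟩ := hSsurj (W (u.snd - r + L (V (u.fst + z))))
    -- Eliminating the primal component V (u.fst + z - L* q) cancels L V L* q against the metric, so
    -- the dual equation involves only W and S and is solved by `hSsurj`.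
    set q := W (u.snd - r + L (V (u.fst + z))) - W y with hq
    refine ⟨WithLp.toLp 2 (V (u.fst + z - ContinuousLinearMap.adjoint L q), q), ?_, ?_⟩
    · change u.fst - V.inverse (V (u.fst + z - ContinuousLinearMap.adjoint L q)) =
        -z + ContinuousLinearMap.adjoint L q
      rw [hVi.inverse_apply_self]; abel
    · change q ∈ S (u.snd - (W.inverse q - L (V (ContinuousLinearMap.adjoint L q))) - r +
        L (V (u.fst + z - ContinuousLinearMap.adjoint L q)))
      have h1 : W.inverse q = u.snd - r + L (V (u.fst + z)) - y := by
        rw [hq, ← map_sub, hWi.inverse_apply_self]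
      rw [h1]
      convert hy using 2
      simp only [map_sub, map_add]; abel
  · intro x y
    rw [WithLp.prod_inner_apply, WithLp.prod_inner_apply]
    change ⟪V.inverse x.fst, y.fst⟫ +
        ⟪W.inverse x.snd - L (V (ContinuousLinearMap.adjoint L x.snd)), y.snd⟫ =
      ⟪x.fst, V.inverse y.fst⟫ +
        ⟪x.snd, W.inverse y.snd - L (V (ContinuousLinearMap.adjoint L y.snd))⟫
    rw [inner_sub_left, inner_sub_right, hV.inverse.inner_comm, hW.inverse.inner_comm,
      ← ContinuousLinearMap.adjoint_inner_right L, ← ContinuousLinearMap.adjoint_inner_left L,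
      hV.inner_comm]
  · intro w
    refine le_trans ?_ (hquad w)
    have h1 := hcV w.fst
    have h2 := mul_le_mul_of_nonneg_left (hcW w.snd) hθ0.le
    have h3 := mul_le_mul_of_nonneg_right (min_le_left ηV (θ * ηW)) (sq_nonneg ‖w.fst‖)
    have h4 := mul_le_mul_of_nonneg_right (min_le_right ηV (θ * ηW)) (sq_nonneg ‖w.snd‖)
    rw [WithLp.prod_norm_sq_eq_of_L2]
    linarith
  · intro x y
    rw [WithLp.prod_inner_apply, WithLp.prod_norm_sq_eq_of_L2]
    change _ * (‖B₁ x.fst - B₁ y.fst‖ ^ 2 + ‖B₂ x.snd - B₂ y.snd‖ ^ 2) ≤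
      ⟪x.fst - y.fst, B₁ x.fst - B₁ y.fst⟫ + ⟪x.snd - y.snd, B₂ x.snd - B₂ y.snd⟫
    have h1 := mul_le_mul_of_nonneg_left (hbV (B₁ x.fst - B₁ y.fst)) hν.le
    have h2 := mul_le_mul_of_nonneg_left (hbW (B₂ x.snd - B₂ y.snd)) hμ.le
    have h3 := mul_le_mul_of_nonneg_right (min_le_left (ν * χV) (μ * χW))
      (sq_nonneg ‖B₁ x.fst - B₁ y.fst‖)
    have h4 := mul_le_mul_of_nonneg_right (min_le_right (ν * χV) (μ * χW))
      (sq_nonneg ‖B₂ x.snd - B₂ y.snd‖)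
    linarith [hB₁ x.fst y.fst, hB₂ x.snd y.snd]
  · intro w t y
    have h0 := hquad (w - t)
    simp only [WithLp.prod_inner_apply, WithLp.prod_norm_sq_eq_of_L2] at h0 ⊢
    change γ * (‖w.fst - t.fst‖ ^ 2 + ‖w.snd - t.snd‖ ^ 2 +
        (‖B₁ w.fst - B₁ y.fst‖ ^ 2 + ‖B₂ w.snd - B₂ y.snd‖ ^ 2)) ≤
      _ - 2 * (⟪w.fst - t.fst, B₁ w.fst - B₁ y.fst⟫ + ⟪w.snd - t.snd, B₂ w.snd - B₂ y.snd⟫) +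
        2 * (⟪w.fst - y.fst, B₁ w.fst - B₁ y.fst⟫ + ⟪w.snd - y.snd, B₂ w.snd - B₂ y.snd⟫)
    change ⟪V.inverse (w.fst - t.fst), w.fst - t.fst⟫ +
      θ * ⟪W.inverse (w.snd - t.snd), w.snd - t.snd⟫ ≤ _ at h0
    have h1 := hV.two_mul_inner_le hδ0 (w.fst - t.fst) (B₁ w.fst - B₁ y.fst)
    -- On the dual side the parameter is δ θ, since the metric controls only θ times the W⁻¹-form
    -- there. The resulting loss (δ θ)⁻¹ is matched by β ≤ μ θ.
    have h2 := hW.two_mul_inner_le (mul_pos hδ0 hθ0) (w.snd - t.snd) (B₂ w.snd - B₂ y.snd)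
    have h3 := hB₁ w.fst y.fst
    have h4 := hB₂ w.snd y.snd
    have c1 := hcV (w.fst - t.fst)
    have c2 := hcW (w.snd - t.snd)
    have b1 := hbV (B₁ w.fst - B₁ y.fst)
    have b2 := hbW (B₂ w.snd - B₂ y.snd)
    set a₁ := ⟪V.inverse (w.fst - t.fst), w.fst - t.fst⟫
    set a₂ := ⟪W.inverse (w.snd - t.snd), w.snd - t.snd⟫
    set d₁ := ⟪V (B₁ w.fst - B₁ y.fst), B₁ w.fst - B₁ y.fst⟫
    set d₂ := ⟪W (B₂ w.snd - B₂ y.snd), B₂ w.snd - B₂ y.snd⟫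
    have hd₁ : 0 ≤ d₁ := (mul_nonneg hχV.le (sq_nonneg _)).trans b1
    have hd₂ : 0 ≤ d₂ := (mul_nonneg hχW.le (sq_nonneg _)).trans b2
    have hδ' : 0 < 1 - δ := by linarith
    have hβδ : 0 < 2 * β - δ⁻¹ := by linarith
    have p1 : γ * ‖w.fst - t.fst‖ ^ 2 ≤ (1 - δ) * a₁ :=
      (mul_le_mul_of_nonneg_right hγ1 (sq_nonneg _)).trans (by
        rw [mul_assoc]; exact mul_le_mul_of_nonneg_left c1 hδ'.le)
    have p2 : γ * ‖w.snd - t.snd‖ ^ 2 ≤ (1 - δ) * θ * a₂ :=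
      (mul_le_mul_of_nonneg_right hγ2 (sq_nonneg _)).trans (by
        rw [mul_assoc]; exact mul_le_mul_of_nonneg_left c2 (by positivity))
    have p3 : γ * ‖B₁ w.fst - B₁ y.fst‖ ^ 2 ≤ (2 * β - δ⁻¹) * d₁ :=
      (mul_le_mul_of_nonneg_right hγ3 (sq_nonneg _)).trans (by
        rw [mul_assoc]; exact mul_le_mul_of_nonneg_left b1 hβδ.le)
    have p4 : γ * ‖B₂ w.snd - B₂ y.snd‖ ^ 2 ≤ (2 * β - δ⁻¹) / θ * d₂ :=
      (mul_le_mul_of_nonneg_right hγ4 (sq_nonneg _)).trans (by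
        rw [mul_assoc]; exact mul_le_mul_of_nonneg_left b2 (by positivity))
    have p5 : (2 * β - δ⁻¹) * d₁ ≤ (2 * ν - δ⁻¹) * d₁ :=
      mul_le_mul_of_nonneg_right (by linarith) hd₁
    have p6 : (2 * β - δ⁻¹) / θ * d₂ ≤ (2 * μ - (δ * θ)⁻¹) * d₂ := by
      refine mul_le_mul_of_nonneg_right ?_ hd₂
      rw [div_le_iff₀ hθ0, sub_mul, mul_inv, mul_assoc δ⁻¹, inv_mul_cancel₀ hθ0.ne']
      linarith
    linarith

end PrimalDual

/-! ### The norm condition on the coupling, and sufficiency of the Kuhn–Tucker conditions. -/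

section BlockLemmas

/-- The bound behind the strong positivity of `W⁻¹ - L V L*` when `‖√W L √V‖ < 1`. -/
theorem opSqrt_bound {E F : Type*} [NormedAddCommGroup E] [InnerProductSpace ℝ E] [CompleteSpace E]
    [NormedAddCommGroup F] [InnerProductSpace ℝ F] [CompleteSpace F] {V : E →L[ℝ] E}
    (hV : IsSAStronglyPositive V) {W : F →L[ℝ] F} (hW : IsSAStronglyPositive W) (L : E →L[ℝ] F)
    (q : F) : (1 - ‖opSqrt W ∘L L ∘L opSqrt V‖ ^ 2) * ⟪W.inverse q, q⟫ ≤ ⟪W.inverse q, q⟫ -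
      ⟪V (ContinuousLinearMap.adjoint L q), ContinuousLinearMap.adjoint L q⟫ := by
  obtain ⟨hVp, hVs⟩ := opSqrt_spec V hV
  obtain ⟨hWp, hWs⟩ := opSqrt_spec W hW
  have hVa : ∀ x y, ⟪opSqrt V x, y⟫ = ⟪x, opSqrt V y⟫ := hVp.1
  have hWa : ∀ x y, ⟪opSqrt W x, y⟫ = ⟪x, opSqrt W y⟫ := hWp.1
  have hVV : ∀ x, opSqrt V (opSqrt V x) = V x := fun x => congrArg (fun T => T x) hVs
  have hWW : ∀ x, opSqrt W (opSqrt W x) = W x := fun x => congrArg (fun T => T x) hWs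
  set T := opSqrt W ∘L L ∘L opSqrt V with hT
  -- With q = W u and T = √W L √V one has √V L* q = T* (√W u), while ‖√W u‖² = ⟪W⁻¹ q, q⟫; the bound
  -- is then ‖T*‖ = ‖T‖.
  obtain ⟨u, rfl⟩ := hW.isInvertible.surjective q
  have h1 : opSqrt V (ContinuousLinearMap.adjoint L (W u)) =
      ContinuousLinearMap.adjoint T (opSqrt W u) := by
    refine ext_inner_right ℝ fun y => ?_
    rw [ContinuousLinearMap.adjoint_inner_left, hVa, ContinuousLinearMap.adjoint_inner_left, ← hWW,
      hWa]
    rfl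
  have h2 : ‖opSqrt W u‖ ^ 2 = ⟪W.inverse (W u), W u⟫ := by
    rw [hW.isInvertible.inverse_apply_self, ← hWW, ← hWa, real_inner_self_eq_norm_sq]
  have h3 : ⟪V (ContinuousLinearMap.adjoint L (W u)), ContinuousLinearMap.adjoint L (W u)⟫ =
      ‖ContinuousLinearMap.adjoint T (opSqrt W u)‖ ^ 2 := by
    rw [← hVV, hVa, ← h1, real_inner_self_eq_norm_sq]
  have h4 : ‖ContinuousLinearMap.adjoint T (opSqrt W u)‖ ≤ ‖T‖ * ‖opSqrt W u‖ := by
    have := (ContinuousLinearMap.adjoint T).le_opNorm (opSqrt W u)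
    rwa [LinearIsometryEquiv.norm_map] at this
  have h5 := pow_le_pow_left₀ (norm_nonneg _) h4 2
  rw [mul_pow] at h5
  rw [h3, ← h2]
  linarith

variable {m s : ℕ} {K : Fin m → Type*} {G : Fin s → Type*}
  [∀ i, NormedAddCommGroup (K i)] [∀ i, InnerProductSpace ℝ (K i)]
  [∀ k, NormedAddCommGroup (G k)] [∀ k, InnerProductSpace ℝ (G k)]

theorem blockOp_apply (L : ∀ (k : Fin s) (i : Fin m), K i →L[ℝ] G k) (x : PiLp 2 K) (k : Fin s) :
    blockOp L x k = ∑ i, L k i (x i) := by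
  simp [blockOp]

variable [∀ i, CompleteSpace (K i)] [∀ k, CompleteSpace (G k)]

theorem adjoint_blockOp_apply (L : ∀ (k : Fin s) (i : Fin m), K i →L[ℝ] G k) (v : PiLp 2 G)
    (i : Fin m) : ContinuousLinearMap.adjoint (blockOp L) v i =
      ∑ k, ContinuousLinearMap.adjoint (L k i) (v k) := by
  have h : ContinuousLinearMap.adjoint (blockOp L) v =
      WithLp.toLp 2 fun i => ∑ k, ContinuousLinearMap.adjoint (L k i) (v k) := by
    refine ext_inner_right ℝ fun x => ?_
    rw [ContinuousLinearMap.adjoint_inner_left, PiLp.inner_apply, PiLp.inner_apply]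
    simp_rw [blockOp_apply, inner_sum, sum_inner, ContinuousLinearMap.adjoint_inner_left]
    exact Finset.sum_comm
  rw [h]

theorem ereal_coe_sum {ι : Type*} (t : Finset ι) (f : ι → ℝ) :
    ((∑ i ∈ t, f i : ℝ) : EReal) = ∑ i ∈ t, (f i : EReal) := by
  classical
  induction t using Finset.induction_on with
  | empty => simp
  | insert i t hi ih => rw [Finset.sum_insert hi, Finset.sum_insert hi, EReal.coe_add, ih]

/-- Only the value at the origin is needed exactly: elsewhere Fenchel–Young bounds the conjugate of
0 from below. -/
theorem conj_zero {H : Type*} [NormedAddCommGroup H] [InnerProductSpace ℝ H] :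
    conj (fun _ : H => (0 : EReal)) 0 = 0 := by
  simp [conj]

/-- The Kuhn–Tucker conditions imply primal optimality. -/
theorem mem_primalSolutions {g ℓ : ∀ k, G k → EReal} (hg : ∀ k, IsGammaZero (g k))
    (hℓ : ∀ k, IsGammaZero (ℓ k)) {L : ∀ (k : Fin s) (i : Fin m), K i →L[ℝ] G k} {z : ∀ i, K i}
    {r : ∀ k, G k} {φ : PiLp 2 K → ℝ} (hφ : ConvexOn ℝ Set.univ φ) (hd : Differentiable ℝ φ)
    {x : PiLp 2 K} {v : PiLp 2 G} {y₁ y₂ : ∀ k, G k} (h₁ : ∀ k, v k ∈ subdiff (ℓ k) (y₁ k))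
    (h₂ : ∀ k, v k ∈ subdiff (g k) (y₂ k)) (hy : ∀ k, y₁ k + y₂ k = ∑ i, L k i (x i) - r k)
    (hz : ∀ i, z i = ∑ k, ContinuousLinearMap.adjoint (L k i) (v k) + gradient φ x i) :
    x ∈ primalSolutions (fun _ _ => 0) g ℓ L z r φ := by
  choose a ha ha' using fun k => (hℓ k).exists_real_of_mem_subdiff (h₁ k)
  choose b hb hb' using fun k => (hg k).exists_real_of_mem_subdiff (h₂ k)
  intro x'
  have hlin : ∀ x : PiLp 2 K, ∑ i, ((0 : EReal) - ((⟪x i, z i⟫ : ℝ) : EReal)) =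
      ((-∑ i, ⟪x i, z i⟫ : ℝ) : EReal) := by
    intro x
    rw [← Finset.sum_neg_distrib, ereal_coe_sum]
    simp
  have hup : ∑ k, infConv (ℓ k) (g k) (∑ i, L k i (x i) - r k) ≤ ((∑ k, (a k + b k) : ℝ) : EReal) := by
    rw [ereal_coe_sum]
    refine Finset.sum_le_sum fun k _ => (iInf_le _ (y₁ k)).trans (le_of_eq ?_)
    rw [← hy, add_sub_cancel_left, ha, hb, EReal.coe_add]
  have hlow : ((∑ k, (a k + b k + ⟪∑ i, L k i (x' i) - ∑ i, L k i (x i), v k⟫) : ℝ) : EReal) ≤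
      ∑ k, infConv (ℓ k) (g k) (∑ i, L k i (x' i) - r k) := by
    rw [ereal_coe_sum]
    refine Finset.sum_le_sum fun k _ => le_iInf fun y => ?_
    refine le_trans (le_of_eq ?_) (add_le_add (ha' k y) (hb' k (∑ i, L k i (x' i) - r k - y)))
    rw [← EReal.coe_add]
    congr 1
    have e : ∑ i, L k i (x' i) - ∑ i, L k i (x i) =
        (y - y₁ k) + (∑ i, L k i (x' i) - r k - y - y₂ k) := by
      have h3 : ∑ i, L k i (x i) = y₁ k + y₂ k + r k := by rw [hy]; abel
      rw [h3]; abel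
    rw [e, inner_add_left]; ring
  -- Subgradient inequalities bound the objective below by an affine function of x' plus a constant,
  -- tight at x; the Kuhn–Tucker equation for z cancels the slope.
  have hkey : -∑ i, ⟪x i, z i⟫ + ∑ k, (a k + b k) + φ x ≤ -∑ i, ⟪x' i, z i⟫ +
      ∑ k, (a k + b k + ⟪∑ i, L k i (x' i) - ∑ i, L k i (x i), v k⟫) + φ x' := by
    have h3 := ConvexOn.add_inner_gradient_le hφ hd x x'
    have h4 : ∑ k, ⟪∑ i, L k i (x' i) - ∑ i, L k i (x i), v k⟫ =
        ∑ i, ⟪x' i - x i, ∑ k, ContinuousLinearMap.adjoint (L k i) (v k)⟫ := by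
      simp_rw [← Finset.sum_sub_distrib, ← map_sub, sum_inner, inner_sum,
        ContinuousLinearMap.adjoint_inner_right]
      exact Finset.sum_comm
    have h5 : ∑ i, ⟪x' i, z i⟫ - ∑ i, ⟪x i, z i⟫ =
        ∑ i, ⟪x' i - x i, ∑ k, ContinuousLinearMap.adjoint (L k i) (v k)⟫ +
          ⟪x' - x, gradient φ x⟫ := by
      rw [PiLp.inner_apply, ← Finset.sum_sub_distrib, ← Finset.sum_add_distrib]
      refine Finset.sum_congr rfl fun i _ => ?_
      rw [← inner_sub_left, hz i, inner_add_right]; rfl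
    rw [Finset.sum_add_distrib (f := fun k => a k + b k), h4]
    linarith
  rw [primalObjective, primalObjective, hlin, hlin]
  calc _ ≤ ((-∑ i, ⟪x i, z i⟫ : ℝ) : EReal) + ((∑ k, (a k + b k) : ℝ) : EReal) + (φ x : EReal) := by
        gcongr
    _ ≤ ((-∑ i, ⟪x' i, z i⟫ : ℝ) : EReal) +
        ((∑ k, (a k + b k + ⟪∑ i, L k i (x' i) - ∑ i, L k i (x i), v k⟫) : ℝ) : EReal) +
          (φ x' : EReal) := by
        simp only [← EReal.coe_add]
        exact EReal.coe_le_coe_iff.2 hkey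
    _ ≤ _ := by gcongr

/-- The Kuhn–Tucker conditions imply dual optimality. -/
theorem mem_dualSolutions {g ℓ : ∀ k, G k → EReal} (hg : ∀ k, IsGammaZero (g k))
    (hℓ : ∀ k, IsGammaZero (ℓ k)) {L : ∀ (k : Fin s) (i : Fin m), K i →L[ℝ] G k} {z : ∀ i, K i}
    {r : ∀ k, G k} {φ : PiLp 2 K → ℝ} (hφ : ConvexOn ℝ Set.univ φ) (hd : Differentiable ℝ φ)
    {x : PiLp 2 K} {v : PiLp 2 G} {y₁ y₂ : ∀ k, G k} (h₁ : ∀ k, v k ∈ subdiff (ℓ k) (y₁ k))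
    (h₂ : ∀ k, v k ∈ subdiff (g k) (y₂ k)) (hy : ∀ k, y₁ k + y₂ k = ∑ i, L k i (x i) - r k)
    (hz : ∀ i, z i = ∑ k, ContinuousLinearMap.adjoint (L k i) (v k) + gradient φ x i) :
    v ∈ dualSolutions (fun _ _ => 0) g ℓ L z r φ := by
  choose a ha ha' using fun k => (hℓ k).exists_real_of_mem_subdiff (h₁ k)
  choose b hb hb' using fun k => (hg k).exists_real_of_mem_subdiff (h₂ k)
  intro v'
  have hgrad : gradient φ x ∈ subdiff (fun x : PiLp 2 K => (φ x : EReal)) x := fun y => by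
    rw [← EReal.coe_add]
    exact EReal.coe_le_coe_iff.2 (ConvexOn.add_inner_gradient_le hφ hd x y)
  have hres : WithLp.toLp 2 (fun i => z i - ∑ k, ContinuousLinearMap.adjoint (L k i) (v k)) =
      gradient φ x := by
    ext i
    change z i - ∑ k, ContinuousLinearMap.adjoint (L k i) (v k) = gradient φ x i
    rw [hz i]; abel
  have hup₁ : infConv (conj fun x : PiLp 2 K => (φ x : EReal))
      (fun u : PiLp 2 K => ∑ i, conj (fun _ : K i => (0 : EReal)) (u i)) (gradient φ x) ≤
        ((⟪gradient φ x, x⟫ - φ x : ℝ) : EReal) := by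
    refine (iInf_le _ (gradient φ x)).trans (le_of_eq ?_)
    rw [conj_eq_of_mem_subdiff (f := fun x : PiLp 2 K => (φ x : EReal)) (x := x) (r := φ x) rfl hgrad,
      sub_self]
    have : ∑ i, conj (fun _ : K i => (0 : EReal)) ((0 : PiLp 2 K) i) = 0 :=
      Finset.sum_eq_zero fun i _ => conj_zero
    exact (congrArg _ this).trans (add_zero _)
  have hup₂ : ∑ k, (conj (ℓ k) (v k) + conj (g k) (v k) + ((⟪v k, r k⟫ : ℝ) : EReal)) =
      ((∑ k, (⟪v k, y₁ k⟫ - a k + (⟪v k, y₂ k⟫ - b k) + ⟪v k, r k⟫) : ℝ) : EReal) := by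
    rw [ereal_coe_sum]
    refine Finset.sum_congr rfl fun k _ => ?_
    rw [conj_eq_of_mem_subdiff (ha k) (h₁ k), conj_eq_of_mem_subdiff (hb k) (h₂ k),
      EReal.coe_add, EReal.coe_add]
  set w : PiLp 2 K := WithLp.toLp 2
    (fun i => z i - ∑ k, ContinuousLinearMap.adjoint (L k i) (v' k)) with hw
  have hlow₁ : ((⟪w, x⟫ - φ x : ℝ) : EReal) ≤ infConv (conj fun x : PiLp 2 K => (φ x : EReal))
      (fun u : PiLp 2 K => ∑ i, conj (fun _ : K i => (0 : EReal)) (u i)) w := by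
    refine le_iInf fun y => ?_
    -- Bounding the conjugate of 0 by the linear function ⟪·, x⟫ avoids distinguishing whether w - y
    -- vanishes.
    have h3 : ((⟪w - y, x⟫ : ℝ) : EReal) ≤
        ∑ i, conj (fun _ : K i => (0 : EReal)) ((w - y : PiLp 2 K) i) := by
      rw [PiLp.inner_apply, ereal_coe_sum]
      refine Finset.sum_le_sum fun i _ => ?_
      have := coe_inner_sub_le_conj (f := fun _ : K i => (0 : EReal)) (x := x i) (r := 0)
        EReal.coe_zero.symm ((w - y : PiLp 2 K) i)
      rwa [sub_zero] at this
    refine le_trans (le_of_eq ?_) (add_le_add (coe_inner_sub_le_conj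
      (f := fun x : PiLp 2 K => (φ x : EReal)) (x := x) (r := φ x) rfl y) h3)
    rw [← EReal.coe_add, inner_sub_left]
    congr 1; ring
  have hlow₂ : ((∑ k, (⟪v' k, y₁ k⟫ - a k + (⟪v' k, y₂ k⟫ - b k) + ⟪v' k, r k⟫) : ℝ) : EReal) ≤
      ∑ k, (conj (ℓ k) (v' k) + conj (g k) (v' k) + ((⟪v' k, r k⟫ : ℝ) : EReal)) := by
    rw [ereal_coe_sum]
    refine Finset.sum_le_sum fun k _ => ?_
    rw [EReal.coe_add, EReal.coe_add]
    exact add_le_add (add_le_add (coe_inner_sub_le_conj (ha k) _) (coe_inner_sub_le_conj (hb k) _))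
      le_rfl
  -- The Fenchel–Young lower bound of the dual objective does not depend on v: the terms in ⟪v k, ∑
  -- i, L k i (x i)⟫ cancel. The bound is attained at the Kuhn–Tucker multiplier.
  have hconst : ∀ v : PiLp 2 G,
      ⟪(WithLp.toLp 2 (fun i => z i - ∑ k, ContinuousLinearMap.adjoint (L k i) (v k)) : PiLp 2 K), x⟫
        + ∑ k, (⟪v k, y₁ k⟫ - a k + (⟪v k, y₂ k⟫ - b k) + ⟪v k, r k⟫) =
      ∑ i, ⟪z i, x i⟫ - ∑ k, (a k + b k) := by
    intro v
    have h3 : ∑ i, ⟪∑ k, ContinuousLinearMap.adjoint (L k i) (v k), x i⟫ =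
        ∑ k, ⟪v k, ∑ i, L k i (x i)⟫ := by
      simp_rw [sum_inner, inner_sum, ContinuousLinearMap.adjoint_inner_left]
      exact Finset.sum_comm
    have h4 : ∑ k, (⟪v k, y₁ k⟫ - a k + (⟪v k, y₂ k⟫ - b k) + ⟪v k, r k⟫) =
        ∑ k, ⟪v k, ∑ i, L k i (x i)⟫ - ∑ k, (a k + b k) := by
      rw [← Finset.sum_sub_distrib]
      refine Finset.sum_congr rfl fun k _ => ?_
      have h5 : ∑ i, L k i (x i) = y₁ k + y₂ k + r k := by rw [hy]; abel
      rw [h5, inner_add_right, inner_add_right]; ring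
    rw [h4, PiLp.inner_apply]
    simp_rw [inner_sub_left]
    rw [Finset.sum_sub_distrib, h3]
    ring
  have hkey : ⟪gradient φ x, x⟫ - φ x +
      ∑ k, (⟪v k, y₁ k⟫ - a k + (⟪v k, y₂ k⟫ - b k) + ⟪v k, r k⟫) =
      ⟪w, x⟫ - φ x + ∑ k, (⟪v' k, y₁ k⟫ - a k + (⟪v' k, y₂ k⟫ - b k) + ⟪v' k, r k⟫) := by
    have h3 := hconst v
    rw [hres] at h3
    have h4 := hconst v'
    rw [← hw] at h4
    linarith
  rw [dualObjective, dualObjective, hres, hup₂]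
  refine (add_le_add hup₁ le_rfl).trans ?_
  rw [← EReal.coe_add, hkey, EReal.coe_add]
  exact add_le_add hlow₁ hlow₂

end BlockLemmas

/-! ### Assembling components into primal-dual vectors, and the algorithm as one operator step. -/

section BlockVectors

variable {m s : ℕ} {K : Fin m → Type*} {G : Fin s → Type*}
  [∀ i, NormedAddCommGroup (K i)] [∀ k, NormedAddCommGroup (G k)]

/-- The primal-dual vector with given components. -/
def pdVec (f : ∀ i, K i) (h : ∀ k, G k) : WithLp 2 (PiLp 2 K × PiLp 2 G) :=
  WithLp.toLp 2 (WithLp.toLp 2 f, WithLp.toLp 2 h)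

theorem norm_pdVec_sq (f : ∀ i, K i) (h : ∀ k, G k) :
    ‖pdVec f h‖ ^ 2 = ∑ i, ‖f i‖ ^ 2 + ∑ k, ‖h k‖ ^ 2 := by
  rw [WithLp.prod_norm_sq_eq_of_L2, PiLp.norm_sq_eq_of_L2, PiLp.norm_sq_eq_of_L2]
  rfl

variable [∀ i, InnerProductSpace ℝ (K i)] [∀ k, InnerProductSpace ℝ (G k)]

/-- The embedding of a primal component into the primal-dual space. -/
noncomputable def pdInl (i : Fin m) : K i →L[ℝ] WithLp 2 (PiLp 2 K × PiLp 2 G) :=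
  ((WithLp.prodContinuousLinearEquiv 2 ℝ (PiLp 2 K) (PiLp 2 G)).symm :
      PiLp 2 K × PiLp 2 G →L[ℝ] WithLp 2 (PiLp 2 K × PiLp 2 G)) ∘L
    ContinuousLinearMap.inl ℝ (PiLp 2 K) (PiLp 2 G) ∘L
    ((PiLp.continuousLinearEquiv 2 ℝ K).symm : (∀ i, K i) →L[ℝ] PiLp 2 K) ∘L
    ContinuousLinearMap.single ℝ K i

/-- The embedding of a dual component into the primal-dual space. -/
noncomputable def pdInr (k : Fin s) : G k →L[ℝ] WithLp 2 (PiLp 2 K × PiLp 2 G) :=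
  ((WithLp.prodContinuousLinearEquiv 2 ℝ (PiLp 2 K) (PiLp 2 G)).symm :
      PiLp 2 K × PiLp 2 G →L[ℝ] WithLp 2 (PiLp 2 K × PiLp 2 G)) ∘L
    ContinuousLinearMap.inr ℝ (PiLp 2 K) (PiLp 2 G) ∘L
    ((PiLp.continuousLinearEquiv 2 ℝ G).symm : (∀ k, G k) →L[ℝ] PiLp 2 G) ∘L
    ContinuousLinearMap.single ℝ G k

theorem pdInl_eq (i : Fin m) (y : K i) :
    (pdInl i y : WithLp 2 (PiLp 2 K × PiLp 2 G)) = pdVec (Pi.single i y) 0 := rfl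

theorem pdInr_eq (k : Fin s) (y : G k) :
    (pdInr k y : WithLp 2 (PiLp 2 K × PiLp 2 G)) = pdVec 0 (Pi.single k y) := rfl

/-- Writing the vector as a finite sum of continuous linear images of its components reduces
measurability, integrability and conditional expectation to the components. -/
theorem pdVec_eq_sum (f : ∀ i, K i) (h : ∀ k, G k) :
    pdVec f h = ∑ i, pdInl i (f i) + ∑ k, pdInr k (h k) := by
  have h1 : ∀ F : Fin m → ∀ i, K i, (∑ j, pdVec (F j) 0 : WithLp 2 (PiLp 2 K × PiLp 2 G)) =
      pdVec (∑ j, F j) 0 := fun F =>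
    (map_sum (((WithLp.prodContinuousLinearEquiv 2 ℝ (PiLp 2 K) (PiLp 2 G)).symm :
      PiLp 2 K × PiLp 2 G →L[ℝ] WithLp 2 (PiLp 2 K × PiLp 2 G)) ∘L
      ContinuousLinearMap.inl ℝ (PiLp 2 K) (PiLp 2 G) ∘L
      ((PiLp.continuousLinearEquiv 2 ℝ K).symm : (∀ i, K i) →L[ℝ] PiLp 2 K)) F Finset.univ).symm
  have h2 : ∀ F : Fin s → ∀ k, G k, (∑ j, pdVec 0 (F j) : WithLp 2 (PiLp 2 K × PiLp 2 G)) =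
      pdVec 0 (∑ j, F j) := fun F =>
    (map_sum (((WithLp.prodContinuousLinearEquiv 2 ℝ (PiLp 2 K) (PiLp 2 G)).symm :
      PiLp 2 K × PiLp 2 G →L[ℝ] WithLp 2 (PiLp 2 K × PiLp 2 G)) ∘L
      ContinuousLinearMap.inr ℝ (PiLp 2 K) (PiLp 2 G) ∘L
      ((PiLp.continuousLinearEquiv 2 ℝ G).symm : (∀ k, G k) →L[ℝ] PiLp 2 G)) F Finset.univ).symm
  simp_rw [pdInl_eq, pdInr_eq, h1, h2, Finset.univ_sum_single]
  change _ = pdVec (f + 0) (0 + h)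
  rw [add_zero, zero_add]

theorem inner_pdInl (w : WithLp 2 (PiLp 2 K × PiLp 2 G)) (i : Fin m) (y : K i) :
    ⟪w, pdInl i y⟫ = ⟪w.fst i, y⟫ := by
  rw [pdInl_eq, WithLp.prod_inner_apply, PiLp.inner_apply, PiLp.inner_apply,
    Finset.sum_eq_single i]
  · simp [pdVec]
  · intro j _ hj
    simp [pdVec, Pi.single_eq_of_ne hj]
  · simp

theorem inner_pdInr (w : WithLp 2 (PiLp 2 K × PiLp 2 G)) (k : Fin s) (y : G k) :
    ⟪w, pdInr k y⟫ = ⟪w.snd k, y⟫ := by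
  rw [pdInr_eq, WithLp.prod_inner_apply, PiLp.inner_apply, PiLp.inner_apply,
    Finset.sum_eq_single (s := (Finset.univ : Finset (Fin s))) k]
  · simp [pdVec]
  · intro j _ hj
    simp [pdVec, Pi.single_eq_of_ne hj]
  · simp

theorem continuous_fst_apply (i : Fin m) :
    Continuous fun w : WithLp 2 (PiLp 2 K × PiLp 2 G) => w.fst i :=
  (PiLp.proj (𝕜 := ℝ) 2 K i).continuous.comp (continuous_fst.comp
    (WithLp.prodContinuousLinearEquiv 2 ℝ (PiLp 2 K) (PiLp 2 G)).continuous)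

theorem continuous_snd_apply (k : Fin s) :
    Continuous fun w : WithLp 2 (PiLp 2 K × PiLp 2 G) => w.snd k :=
  (PiLp.proj (𝕜 := ℝ) 2 G k).continuous.comp (continuous_snd.comp
    (WithLp.prodContinuousLinearEquiv 2 ℝ (PiLp 2 K) (PiLp 2 G)).continuous)

variable {Ω : Type*}

theorem stronglyMeasurable_pdVec {m0 : MeasurableSpace Ω} {f : ∀ i, Ω → K i} {h : ∀ k, Ω → G k}
    (hf : ∀ i, StronglyMeasurable (f i)) (hh : ∀ k, StronglyMeasurable (h k)) :
    StronglyMeasurable fun ω => pdVec (fun i => f i ω) fun k => h k ω := by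
  simp_rw [pdVec_eq_sum]
  have h1 : ∀ i, StronglyMeasurable fun ω =>
      (pdInl i : K i →L[ℝ] WithLp 2 (PiLp 2 K × PiLp 2 G)) (f i ω) := fun i =>
    (pdInl i : K i →L[ℝ] WithLp 2 (PiLp 2 K × PiLp 2 G)).continuous.comp_stronglyMeasurable (hf i)
  have h2 : ∀ k, StronglyMeasurable fun ω =>
      (pdInr k : G k →L[ℝ] WithLp 2 (PiLp 2 K × PiLp 2 G)) (h k ω) := fun k =>
    (pdInr k : G k →L[ℝ] WithLp 2 (PiLp 2 K × PiLp 2 G)).continuous.comp_stronglyMeasurable (hh k)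
  exact (Finset.stronglyMeasurable_fun_sum _ fun i _ => h1 i).add
    (Finset.stronglyMeasurable_fun_sum _ fun k _ => h2 k)

theorem memLp_pdVec {m0 : MeasurableSpace Ω} {P : Measure Ω} {f : ∀ i, Ω → K i}
    {h : ∀ k, Ω → G k} (hf : ∀ i, MemLp (f i) 2 P) (hh : ∀ k, MemLp (h k) 2 P) :
    MemLp (fun ω => pdVec (fun i => f i ω) fun k => h k ω) 2 P := by
  simp_rw [pdVec_eq_sum]
  have h1 : ∀ i, MemLp (fun ω =>
      (pdInl i : K i →L[ℝ] WithLp 2 (PiLp 2 K × PiLp 2 G)) (f i ω)) 2 P := fun i =>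
    (pdInl i : K i →L[ℝ] WithLp 2 (PiLp 2 K × PiLp 2 G)).comp_memLp' (hf i)
  have h2 : ∀ k, MemLp (fun ω =>
      (pdInr k : G k →L[ℝ] WithLp 2 (PiLp 2 K × PiLp 2 G)) (h k ω)) 2 P := fun k =>
    (pdInr k : G k →L[ℝ] WithLp 2 (PiLp 2 K × PiLp 2 G)).comp_memLp' (hh k)
  exact (memLp_finsetSum Finset.univ fun i _ => h1 i).add
    (memLp_finsetSum Finset.univ fun k _ => h2 k)

theorem condExp_sum_clm {H ι : Type*} [Fintype ι] {X : ι → Type*} [NormedAddCommGroup H]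
    [NormedSpace ℝ H] [CompleteSpace H] [∀ i, NormedAddCommGroup (X i)]
    [∀ i, NormedSpace ℝ (X i)] [∀ i, CompleteSpace (X i)]
    {m' m0 : MeasurableSpace Ω} {P : Measure Ω} (T : ∀ i, X i →L[ℝ] H) {f : ∀ i, Ω → X i}
    (hf : ∀ i, Integrable (f i) P) :
    P[fun ω => ∑ i, T i (f i ω) | m'] =ᵐ[P] fun ω => ∑ i, T i ((P[f i | m']) ω) := by
  have e : (fun ω => ∑ i, T i (f i ω)) = ∑ i, T i ∘ f i := by
    funext ω; simp
  rw [e]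
  filter_upwards [condExp_finsetSum (m := m') (s := Finset.univ)
      (fun i _ => (T i).integrable_comp (hf i)),
    ae_all_iff.2 fun i => (T i).comp_condExp_comm (m := m') (hf i)] with ω h1 h2
  refine h1.trans ?_
  rw [Finset.sum_apply]
  exact Finset.sum_congr rfl fun i _ => (h2 i).symm

theorem condExp_pdVec [∀ i, CompleteSpace (K i)] [∀ k, CompleteSpace (G k)]
    {m' m0 : MeasurableSpace Ω} {P : Measure Ω} {f : ∀ i, Ω → K i}
    {h : ∀ k, Ω → G k} (hf : ∀ i, Integrable (f i) P) (hh : ∀ k, Integrable (h k) P) :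
    P[fun ω => pdVec (fun i => f i ω) fun k => h k ω | m'] =ᵐ[P]
      fun ω => pdVec (fun i => (P[f i | m']) ω) fun k => (P[h k | m']) ω := by
  simp_rw [pdVec_eq_sum]
  let T : ∀ i, K i →L[ℝ] WithLp 2 (PiLp 2 K × PiLp 2 G) := fun i => pdInl i
  let T' : ∀ k, G k →L[ℝ] WithLp 2 (PiLp 2 K × PiLp 2 G) := fun k => pdInr k
  have hT : Integrable (fun ω => ∑ i, T i (f i ω)) P :=
    integrable_finsetSum _ fun i _ => (T i).integrable_comp (hf i)
  have hT' : Integrable (fun ω => ∑ k, T' k (h k ω)) P :=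
    integrable_finsetSum _ fun k _ => (T' k).integrable_comp (hh k)
  filter_upwards [condExp_add hT hT' m', condExp_sum_clm (m' := m') T hf,
    condExp_sum_clm (m' := m') T' hh] with ω h1 h2 h3
  exact h1.trans (by rw [Pi.add_apply, h2, h3])

/-- The product of the subdifferentials on the Hilbert direct sum. -/
def blockSubdiff (g : ∀ k, G k → EReal) (y : PiLp 2 G) : Set (PiLp 2 G) :=
  {q | ∀ k, q k ∈ subdiff (g k) (y k)}

theorem blockSubdiff_monotone {g : ∀ k, G k → EReal} (hg : ∀ k, IsGammaZero (g k))
    {x y u v : PiLp 2 G} (hu : u ∈ blockSubdiff g x) (hv : v ∈ blockSubdiff g y) :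
    0 ≤ ⟪x - y, u - v⟫ := by
  rw [PiLp.inner_apply]
  exact Finset.sum_nonneg fun k _ => subdiff_monotone (hg k) (hu k) (hv k)

/-- Partial gradients are subgradients of the summands of a separable convex function. -/
theorem add_inner_gradient_le_of_separable [∀ i, CompleteSpace (K i)] {φ : PiLp 2 K → ℝ}
    (hφ : ConvexOn ℝ Set.univ φ) (hd : Differentiable ℝ φ) {h : ∀ i, K i → ℝ}
    (hsep : ∀ u : PiLp 2 K, φ u = ∑ i, h i (u i)) (x : PiLp 2 K) (j : Fin m) (y : K j) :
    h j (x j) + ⟪y - x j, gradient φ x j⟫ ≤ h j y := by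
  -- Only coordinate j is perturbed, so all other summands cancel.
  have h1 := ConvexOn.add_inner_gradient_le hφ hd x (x + WithLp.toLp 2 (Pi.single j (y - x j)))
  have h2 : ⟪(WithLp.toLp 2 (Pi.single j (y - x j)) : PiLp 2 K), gradient φ x⟫ =
      ⟪y - x j, gradient φ x j⟫ := by
    rw [PiLp.inner_apply, Finset.sum_eq_single j]
    · simp
    · intro i _ hi
      simp [Pi.single_eq_of_ne hi]
    · simp
  have h3 : ∑ i, h i ((x + WithLp.toLp 2 (Pi.single j (y - x j)) : PiLp 2 K) i) - ∑ i, h i (x i) =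
      h j y - h j (x j) := by
    rw [← Finset.sum_sub_distrib, Finset.sum_eq_single j]
    · simp
    · intro i _ hi
      simp [Pi.single_eq_of_ne hi]
    · simp
  rw [add_sub_cancel_left, h2, hsep, hsep] at h1
  linarith

variable [∀ i, CompleteSpace (K i)] [∀ k, CompleteSpace (G k)]

theorem exists_sub_mem_blockSubdiff {g : ∀ k, G k → EReal} (hg : ∀ k, IsGammaZero (g k))
    {y₀ u₀ : ∀ k, G k} (hu₀ : ∀ k, u₀ k ∈ subdiff (g k) (y₀ k)) {W : ∀ k, G k →L[ℝ] G k}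
    (hW : ∀ k, IsSAStronglyPositive (W k)) (x : PiLp 2 G) :
    ∃ y, x - blockDiag W y ∈ blockSubdiff g y := by
  choose y hy using fun k => (hg k).exists_sub_mem_subdiff (hu₀ k) (hW k) (x k)
  exact ⟨WithLp.toLp 2 y, hy⟩

/-- One step of the algorithm as a forward-backward step in the primal-dual metric. -/
theorem IsIteration.mem_pdOperator {V : ∀ i, K i →L[ℝ] K i} {W : ∀ k, G k →L[ℝ] G k}
    {L : ∀ (k : Fin s) (i : Fin m), K i →L[ℝ] G k} {z : ∀ i, K i} {r : ∀ k, G k}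
    {g : ∀ k, G k → EReal} {α lam : ℕ → ℝ} {a : ∀ i, ℕ → K i} {b : ∀ k, ℕ → G k}
    {x σ y p c : ∀ i, ℕ → K i} {v q d : ∀ k, ℕ → G k}
    (h : IsIteration V W L z r g α lam a b x σ y p c v q d) (hg : ∀ k, IsGammaZero (g k))
    {y₀ u₀ : ∀ k, G k} (hu₀ : ∀ k, u₀ k ∈ subdiff (g k) (y₀ k))
    (hV : ∀ i, IsSAStronglyPositive (V i)) (hW : ∀ k, IsSAStronglyPositive (W k)) (n : ℕ) :
    pdMetric (blockDiag V) (blockDiag W) (blockOp L) (pdVec (fun i => c i n) fun k => d k n) -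
        pdVec (fun i => a i n) (fun k => b k n) -
        pdMetric (blockDiag V) (blockDiag W) (blockOp L) (pdVec (fun i => p i n) fun k => q k n) ∈
      pdOperator (blockOp L) (blockSubdiff g) (WithLp.toLp 2 z) (WithLp.toLp 2 r)
        (pdVec (fun i => p i n) fun k => q k n) := by
  have hVi := (blockDiag_isSAStronglyPositive V hV).isInvertible
  have hWi := (blockDiag_isSAStronglyPositive W hW).isInvertible
  choose Y hY1 hY2 using fun k => exists_prox_conj_eq (hg k) (hu₀ k) (hW k)
    (d k n + W k (∑ i, L k i (y i n) - b k n - r k))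
  let pp : PiLp 2 K := WithLp.toLp 2 fun i => p i n
  let cc : PiLp 2 K := WithLp.toLp 2 fun i => c i n
  let aa : PiLp 2 K := WithLp.toLp 2 fun i => a i n
  let yy : PiLp 2 K := WithLp.toLp 2 fun i => y i n
  let zz : PiLp 2 K := WithLp.toLp 2 z
  let qq : PiLp 2 G := WithLp.toLp 2 fun k => q k n
  let dd : PiLp 2 G := WithLp.toLp 2 fun k => d k n
  let bb : PiLp 2 G := WithLp.toLp 2 fun k => b k n
  let rr : PiLp 2 G := WithLp.toLp 2 r
  let YY : PiLp 2 G := WithLp.toLp 2 Y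
  have hpp : pp = cc - blockDiag V (aa - zz) -
      blockDiag V (ContinuousLinearMap.adjoint (blockOp L) qq) := by
    ext i
    change p i n = c i n - V i (a i n - z i) -
      V i (ContinuousLinearMap.adjoint (blockOp L) qq i)
    rw [adjoint_blockOp_apply, h.eq_p, h.eq_s]
  have hyy : yy = cc - blockDiag V (aa - zz) -
      blockDiag V (ContinuousLinearMap.adjoint (blockOp L) dd) := by
    ext i
    change y i n = c i n - V i (a i n - z i) -
      V i (ContinuousLinearMap.adjoint (blockOp L) dd i)
    rw [adjoint_blockOp_apply, h.eq_y, h.eq_s]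
  have hqq : qq = dd + blockDiag W (blockOp L yy - bb - rr) - blockDiag W YY := by
    ext k
    change q k n = d k n + W k (blockOp L yy k - b k n - r k) - W k (Y k)
    rw [blockOp_apply, h.eq_q, hY1]
  constructor
  · change (blockDiag V).inverse cc - aa - (blockDiag V).inverse pp =
      -zz + ContinuousLinearMap.adjoint (blockOp L) qq
    rw [hpp, map_sub, map_sub, hVi.inverse_apply_self, hVi.inverse_apply_self]
    abel
  · change qq ∈ blockSubdiff g (((blockDiag W).inverse dd -
      blockOp L (blockDiag V (ContinuousLinearMap.adjoint (blockOp L) dd))) - bb -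
      ((blockDiag W).inverse qq -
        blockOp L (blockDiag V (ContinuousLinearMap.adjoint (blockOp L) qq))) - rr + blockOp L pp)
    have h1 : (blockDiag W).inverse qq = (blockDiag W).inverse dd + (blockOp L yy - bb - rr) - YY := by
      conv_lhs => rw [hqq]
      rw [map_sub, map_add, hWi.inverse_apply_self, hWi.inverse_apply_self]
    -- The predictor y uses the old dual point d and p uses the new one q. The difference is
    -- precisely the L V L* part of the metric, so the argument of ∂g collapses to the Moreau point
    -- Y.
    have h2 : blockOp L yy = blockOp L pp +
        blockOp L (blockDiag V (ContinuousLinearMap.adjoint (blockOp L) qq)) -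
        blockOp L (blockDiag V (ContinuousLinearMap.adjoint (blockOp L) dd)) := by
      rw [← map_add, ← map_sub, hyy]
      congr 1
      rw [hpp]; abel
    have h3 : ((blockDiag W).inverse dd -
        blockOp L (blockDiag V (ContinuousLinearMap.adjoint (blockOp L) dd))) - bb -
        ((blockDiag W).inverse qq -
        blockOp L (blockDiag V (ContinuousLinearMap.adjoint (blockOp L) qq))) - rr + blockOp L pp
        = YY := by
      rw [h1, h2]; abel
    rw [h3]
    intro k
    change q k n ∈ subdiff (g k) (Y k)
    rw [h.eq_q, hY1]
    exact hY2 k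

end BlockVectors

end StochPD

/-! ### The convergence theorem for the stochastic primal-dual algorithm. -/

theorem mainTheorem5
    {m s : ℕ} (hm : 0 < m) (hs : 0 < s)
    -- the Hilbert spaces
    {K : Fin m → Type*} {G : Fin s → Type*}
    [∀ i, NormedAddCommGroup (K i)] [∀ i, InnerProductSpace ℝ (K i)] [∀ i, CompleteSpace (K i)]
    [∀ i, TopologicalSpace.SeparableSpace (K i)] [∀ i, MeasurableSpace (K i)]
    [∀ i, BorelSpace (K i)]
    [∀ k, NormedAddCommGroup (G k)] [∀ k, InnerProductSpace ℝ (G k)] [∀ k, CompleteSpace (G k)]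
    [∀ k, TopologicalSpace.SeparableSpace (G k)] [∀ k, MeasurableSpace (G k)]
    [∀ k, BorelSpace (G k)]
    -- the minimization problem, with `f i = 0`
    (z : ∀ i, K i) (r : ∀ k, G k)
    (g ℓ : ∀ k, G k → EReal) (hg : ∀ k, IsGammaZero (g k)) (hℓ : ∀ k, IsGammaZero (ℓ k))
    (hℓsc : ∀ k, IsStronglyConvex (ℓ k))
    (L : ∀ (k : Fin s) (i : Fin m), K i →L[ℝ] G k)
    (φ : PiLp 2 K → ℝ) (hφconv : ConvexOn ℝ Set.univ φ) (hφdiff : Differentiable ℝ φ)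
    (hφlip : ∃ C : ℝ≥0, LipschitzWith C (gradient φ))
    (hincl : ∃ x : PiLp 2 K, SolvesInclusion (fun _ _ => 0) g ℓ L z r φ x)
    (hprimal : (primalSolutions (fun _ _ => 0) g ℓ L z r φ).Nonempty)
    -- the metrics and the constants
    (V : ∀ i, K i →L[ℝ] K i) (hV : ∀ i, IsSAStronglyPositive (V i))
    (W : ∀ k, G k →L[ℝ] G k) (hW : ∀ k, IsSAStronglyPositive (W k))
    (ν₀ μ₀ : ℝ) (hν₀ : 0 < ν₀) (hμ₀ : 0 < μ₀)
    (hcoφ : ∀ x y : PiLp 2 K,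
      ν₀ * ∑ i, sqNorm (V i) (gradient φ x i - gradient φ y i) ≤
        ∑ i, inner ℝ (x i - y i) (gradient φ x i - gradient φ y i))
    (hcoℓ : ∀ v w : ∀ k, G k,
      μ₀ * ∑ k, sqNorm (W k) (gradConj (ℓ k) (v k) - gradConj (ℓ k) (w k)) ≤
        ∑ k, inner ℝ (v k - w k) (gradConj (ℓ k) (v k) - gradConj (ℓ k) (w k)))
    (hβ : 1 < 2 * betaConst V W L ν₀ μ₀)
    (ε : ℝ) (hε0 : 0 < ε) (hε1 : ε < min 1 (betaConst V W L ν₀ μ₀))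
    (lam α : ℕ → ℝ) (hlam : ∀ n, lam n ∈ Set.Icc ε 1) (hα : ∀ n, α n ∈ Set.Icc 0 (1 - ε))
    -- the random inputs and the iterates
    {Ω : Type*} [MeasurableSpace Ω] (P : Measure Ω) [IsProbabilityMeasure P]
    (a : ∀ i, ℕ → Ω → K i) (b : ∀ k, ℕ → Ω → G k)
    (ha : ∀ i n, Measurable (a i n)) (ha2 : ∀ i n, MemLp (a i n) 2 P)
    (hb : ∀ k n, Measurable (b k n)) (hb2 : ∀ k n, MemLp (b k n) 2 P)
    (x σ y p c : ∀ i, ℕ → Ω → K i) (v q d : ∀ k, ℕ → Ω → G k)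
    (hx0 : ∀ i, Measurable (x i 0)) (hx02 : ∀ i, MemLp (x i 0) 2 P)
    (hv0 : ∀ k, Measurable (v k 0)) (hv02 : ∀ k, MemLp (v k 0) 2 P)
    (hiter : ∀ ω, IsIteration V W L z r g α lam (fun i n => a i n ω) (fun k n => b k n ω)
      (fun i n => x i n ω) (fun i n => σ i n ω) (fun i n => y i n ω) (fun i n => p i n ω)
      (fun i n => c i n ω) (fun k n => v k n ω) (fun k n => q k n ω) (fun k n => d k n ω))
    -- (i) unbiasedness
    (hmean_a : ∀ n i, P[a i n | historySigma x v n] =ᵐ[P]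
      fun ω => gradient φ (WithLp.toLp 2 fun i' => c i' n ω) i)
    (hmean_b : ∀ n k, P[b k n | historySigma x v n] =ᵐ[P] fun ω => gradConj (ℓ k) (d k n ω))
    -- (ii) summable conditional variances
    (hvar : ∀ᵐ ω ∂P, Summable fun n =>
      (P[fun ω' => ∑ i, ‖a i n ω' - gradient φ (WithLp.toLp 2 fun i' => c i' n ω') i‖ ^ 2 +
          ∑ k, ‖b k n ω' - gradConj (ℓ k) (d k n ω')‖ ^ 2 | historySigma x v n]) ω)
    -- (iii) bounded increments (with `x_{-1} = x_0`, `v_{-1} = v_0`) and summable inertia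
    (hbdd_x : ∀ᵐ ω ∂P, ∀ i, BddAbove (Set.range fun n => ‖x i n ω - x i (n - 1) ω‖))
    (hbdd_v : ∀ᵐ ω ∂P, ∀ k, BddAbove (Set.range fun n => ‖v k n ω - v k (n - 1) ω‖))
    (hαsum : Summable α) :
    ∃ (xbar : ∀ i, Ω → K i) (vbar : ∀ k, Ω → G k),
      (∀ i, Measurable (xbar i)) ∧ (∀ k, Measurable (vbar k)) ∧
      (∀ᵐ ω ∂P,
        WithLp.toLp 2 (fun i => xbar i ω) ∈ primalSolutions (fun _ _ => 0) g ℓ L z r φ ∧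
        WithLp.toLp 2 (fun k => vbar k ω) ∈ dualSolutions (fun _ _ => 0) g ℓ L z r φ) ∧
      -- weak convergence
      (∀ᵐ ω ∂P, (∀ i, WeaklyTendsto (fun n => x i n ω) (xbar i ω)) ∧
        ∀ k, WeaklyTendsto (fun n => v k n ω) (vbar k ω)) ∧
      -- strong convergence under uniform convexity
      (∀ᵐ ω ∂P,
        UniformlyConvexAt (fun u => (φ u : EReal)) (WithLp.toLp 2 fun i => xbar i ω) →
          ∀ i, Filter.Tendsto (fun n => x i n ω) Filter.atTop (nhds (xbar i ω))) ∧
      (∀ j, ∀ᵐ ω ∂P, UniformlyConvexAt (conj (ℓ j)) (vbar j ω) →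
        Filter.Tendsto (fun n => v j n ω) Filter.atTop (nhds (vbar j ω))) ∧
      (∀ h : ∀ i, K i → ℝ, (∀ i, ConvexOn ℝ Set.univ (h i)) → (∀ i, Differentiable ℝ (h i)) →
        (∀ u : PiLp 2 K, φ u = ∑ i, h i (u i)) →
        ∀ j, ∀ᵐ ω ∂P, UniformlyConvexAt (fun u => (h j u : EReal)) (xbar j ω) →
          Filter.Tendsto (fun n => x j n ω) Filter.atTop (nhds (xbar j ω))) := by
  obtain ⟨xh, vh, hvh, hzh⟩ := hincl
  -- the Kuhn–Tucker point
  have hpar : ∀ k, ∃ y₁ y₂, vh k ∈ subdiff (ℓ k) y₁ ∧ vh k ∈ subdiff (g k) y₂ ∧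
      y₁ + y₂ = ∑ j, L k j (xh j) - r k := fun k => by
    obtain ⟨y₁, h1, y₂, h2, h3⟩ := Set.mem_add.1 (hvh k)
    exact ⟨y₁, y₂, h1, h2, h3⟩
  choose yl yg hyl hyg hylg using hpar
  have hzh' : ∀ i, z i = ∑ k, ContinuousLinearMap.adjoint (L k i) (vh k) + gradient φ xh i := by
    intro i
    obtain ⟨u, hu, w, hw, huw⟩ := Set.mem_add.1 (hzh i)
    -- A subgradient of the zero function vanishes: test it at `xh i + u`.
    have hu0 : u = 0 := by
      have h1 := hu (xh i + u)
      rw [add_sub_cancel_left, zero_add, real_inner_self_eq_norm_sq] at h1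
      have h2 : ‖u‖ ^ 2 ≤ 0 := EReal.coe_le_coe_iff.1 h1
      exact norm_eq_zero.1 (by nlinarith [norm_nonneg u])
    rw [← huw, hu0, zero_add]
    exact hw
  have hgradConj : ∀ k v, v ∈ subdiff (ℓ k) (gradConj (ℓ k) v) := fun k v =>
    ((hℓsc k).mem_subdiff_gradConj (hℓ k) (hyl k) v).1
  have hgradConj' : ∀ k, gradConj (ℓ k) (vh k) = yl k := fun k =>
    (((hℓsc k).mem_subdiff_gradConj (hℓ k) (hyl k) (vh k)).2 _ (hyl k)).symm
  -- the metric inclusion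
  let Vb := blockDiag V
  let Wb := blockDiag W
  let Lb := blockOp L
  have hVb : IsSAStronglyPositive Vb := blockDiag_isSAStronglyPositive V hV
  have hWb : IsSAStronglyPositive Wb := blockDiag_isSAStronglyPositive W hW
  let B₂ : PiLp 2 G → PiLp 2 G := fun v => WithLp.toLp 2 fun k => gradConj (ℓ k) (v k)
  let zz : PiLp 2 K := WithLp.toLp 2 z
  let rr : PiLp 2 G := WithLp.toLp 2 r
  let B : WithLp 2 (PiLp 2 K × PiLp 2 G) → WithLp 2 (PiLp 2 K × PiLp 2 G) :=
    fun w => WithLp.toLp 2 (gradient φ w.fst, B₂ w.snd)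
  obtain ⟨κ, cc, γ, hMI⟩ : ∃ κ c γ, MetricInclusion (pdOperator Lb (blockSubdiff g) zz rr) B
      (pdMetric Vb Wb Lb) κ c γ := by
    -- Here θ is 1 - ‖√W L √V‖², so the two terms of the minimum defining β are ν₀ and μ₀ θ.
    refine exists_metricInclusion hVb hWb
      (fun x y u v hu hv => blockSubdiff_monotone hg hu hv)
      (exists_sub_mem_blockSubdiff hg hyg hW) zz rr hν₀ hμ₀ (fun x y => ?_) (fun v w => ?_)
      (opSqrt_bound hVb hWb Lb) (min_le_left _ _) (min_le_right _ _) hβ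
    · have h1 := hcoφ x y
      rw [PiLp.inner_apply, PiLp.inner_apply]
      exact h1
    · have h1 := hcoℓ v w
      rw [PiLp.inner_apply, PiLp.inner_apply]
      exact h1
  have hzero : ∀ w ∈ zeroSet (pdOperator Lb (blockSubdiff g) zz rr) B,
      (∀ i, z i = ∑ k, ContinuousLinearMap.adjoint (L k i) (w.snd k) + gradient φ w.fst i) ∧
      ∃ y₂ : ∀ k, G k, (∀ k, w.snd k ∈ subdiff (g k) (y₂ k)) ∧
        ∀ k, gradConj (ℓ k) (w.snd k) + y₂ k = ∑ i, L k i (w.fst i) - r k := by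
    rintro w ⟨h1, h2⟩
    constructor
    · intro i
      have h3 : -(gradient φ w.fst i) = -z i + ContinuousLinearMap.adjoint Lb w.snd i :=
        congrArg (fun u : PiLp 2 K => u i) h1
      rw [adjoint_blockOp_apply] at h3
      rw [← sub_eq_zero, ← sub_eq_zero.2 h3]; abel
    · refine ⟨fun k => -(gradConj (ℓ k) (w.snd k)) - r k + Lb w.fst k, h2, fun k => ?_⟩
      change gradConj (ℓ k) (w.snd k) + (-(gradConj (ℓ k) (w.snd k)) - r k + blockOp L w.fst k) = _
      rw [blockOp_apply]; abel
  have hne : (zeroSet (pdOperator Lb (blockSubdiff g) zz rr) B).Nonempty := by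
    refine ⟨pdVec (fun i => xh i) vh, ?_, fun k => ?_⟩
    · change -gradient φ xh = -zz + ContinuousLinearMap.adjoint Lb (WithLp.toLp 2 vh)
      ext i
      change -(gradient φ xh i) = -z i + ContinuousLinearMap.adjoint Lb (WithLp.toLp 2 vh) i
      rw [adjoint_blockOp_apply, hzh' i]
      change _ = -(_ + _) + ∑ k, ContinuousLinearMap.adjoint (L k i) (vh k)
      abel
    · change vh k ∈ subdiff (g k) (-(gradConj (ℓ k) (vh k)) - r k + Lb xh k)
      have h1 : -(gradConj (ℓ k) (vh k)) - r k + Lb xh k = yg k := by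
        change -(gradConj (ℓ k) (vh k)) - r k + blockOp L xh k = yg k
        rw [blockOp_apply, hgradConj', eq_sub_of_add_eq' (hylg k)]; abel
      rw [h1]; exact hyg k
  -- the iteration in the primal-dual space
  let Z : ℕ → Ω → WithLp 2 (PiLp 2 K × PiLp 2 G) := fun n ω =>
    pdVec (fun i => x i n ω) fun k => v k n ω
  let Wn : ℕ → Ω → WithLp 2 (PiLp 2 K × PiLp 2 G) := fun n ω =>
    pdVec (fun i => c i n ω) fun k => d k n ω
  let T : ℕ → Ω → WithLp 2 (PiLp 2 K × PiLp 2 G) := fun n ω =>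
    pdVec (fun i => p i n ω) fun k => q k n ω
  let An : ℕ → Ω → WithLp 2 (PiLp 2 K × PiLp 2 G) := fun n ω =>
    pdVec (fun i => a i n ω) fun k => b k n ω
  have hW' : ∀ n ω, Wn n ω = Z n ω + α n • (Z n ω - Z (n - 1) ω) := by
    intro n ω
    have e1 : (fun i => c i n ω) = fun i => x i n ω + α n • (x i n ω - x i (n - 1) ω) :=
      funext fun i => (hiter ω).eq_c i n
    have e2 : (fun k => d k n ω) = fun k => v k n ω + α n • (v k n ω - v k (n - 1) ω) :=
      funext fun k => (hiter ω).eq_d k n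
    change pdVec (fun i => c i n ω) (fun k => d k n ω) = _
    rw [e1, e2]
    rfl
  have hT : ∀ n ω, pdMetric Vb Wb Lb (Wn n ω) - An n ω - pdMetric Vb Wb Lb (T n ω) ∈
      pdOperator Lb (blockSubdiff g) zz rr (T n ω) := fun n ω =>
    (hiter ω).mem_pdOperator hg hyg hV hW n
  have hZ : ∀ n ω, Z (n + 1) ω = Z n ω + lam n • (T n ω - Z n ω) := by
    intro n ω
    have e1 : (fun i => x i (n + 1) ω) = fun i => x i n ω + lam n • (p i n ω - x i n ω) :=
      funext fun i => (hiter ω).eq_x i n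
    have e2 : (fun k => v k (n + 1) ω) = fun k => v k n ω + lam n • (q k n ω - v k n ω) :=
      funext fun k => (hiter ω).eq_v k n
    change pdVec (fun i => x i (n + 1) ω) (fun k => v k (n + 1) ω) = _
    rw [e1, e2]
    rfl
  -- measurability of the iterates
  have hAm : ∀ n, StronglyMeasurable (An n) := fun n =>
    stronglyMeasurable_pdVec (fun i => (ha i n).stronglyMeasurable)
      fun k => (hb k n).stronglyMeasurable
  have hZm : ∀ n, StronglyMeasurable (Z n) ∧ StronglyMeasurable (Z (n - 1)) := by
    intro n
    induction n with
    | zero =>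
      have h0 : StronglyMeasurable (Z 0) :=
        stronglyMeasurable_pdVec (fun i => (hx0 i).stronglyMeasurable)
          fun k => (hv0 k).stronglyMeasurable
      exact ⟨h0, h0⟩
    | succ n ih =>
      refine ⟨?_, ih.1⟩
      -- Measurability is read off from the Lipschitz resolvent, since the proximity operator is
      -- defined by a choice.
      have h1 : Z (n + 1) = fun ω => Z n ω + lam n • (hMI.resolvent (pdMetric Vb Wb Lb
          (Z n ω + α n • (Z n ω - Z (n - 1) ω)) - An n ω) - Z n ω) := by
        funext ω
        rw [hZ, hMI.eq_resolvent (hT n ω), hW']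
      rw [h1]
      have h2 : StronglyMeasurable fun ω => pdMetric Vb Wb Lb
          (Z n ω + α n • (Z n ω - Z (n - 1) ω)) - An n ω :=
        ((pdMetric Vb Wb Lb).continuous.comp_stronglyMeasurable
          (ih.1.add ((ih.1.sub ih.2).const_smul (α n)))).sub (hAm n)
      exact ih.1.add (((hMI.lipschitz_resolvent.continuous.comp_stronglyMeasurable h2).sub
        ih.1).const_smul (lam n))
  have hxm : ∀ i n, Measurable (x i n) := fun i n =>
    ((continuous_fst_apply i).comp_stronglyMeasurable (hZm n).1).measurable
  have hvm : ∀ k n, Measurable (v k n) := fun k n =>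
    ((continuous_snd_apply k).comp_stronglyMeasurable (hZm n).1).measurable
  let ℱ : Filtration ℕ ‹MeasurableSpace Ω› :=
    { seq := historySigma x v
      mono' := by
        intro n n' hn
        refine iSup_le fun j => ?_
        exact le_iSup (fun j : Fin (n' + 1) => (⨆ i, MeasurableSpace.comap (x i j) inferInstance) ⊔
          (⨆ k, MeasurableSpace.comap (v k j) inferInstance))
          (⟨j, j.2.trans_le (Nat.succ_le_succ hn)⟩ : Fin (n' + 1))
      le' := by
        intro n
        refine iSup_le fun j => sup_le (iSup_le fun i => ?_) (iSup_le fun k => ?_)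
        · exact (hxm i j).comap_le
        · exact (hvm k j).comap_le }
  have hlast : ∀ n, (⨆ i, MeasurableSpace.comap (x i n) inferInstance) ⊔
      (⨆ k, MeasurableSpace.comap (v k n) inferInstance) ≤ historySigma x v n := fun n =>
    le_iSup (fun j : Fin (n + 1) => (⨆ i, MeasurableSpace.comap (x i j) inferInstance) ⊔
      (⨆ k, MeasurableSpace.comap (v k j) inferInstance)) (Fin.last n)
  have hxF : ∀ i n, Measurable[historySigma x v n] (x i n) := fun i n =>
    measurable_iff_comap_le.2 (((le_iSup (fun i => MeasurableSpace.comap (x i n) inferInstance) i).trans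
      le_sup_left).trans (hlast n))
  have hvF : ∀ k n, Measurable[historySigma x v n] (v k n) := fun k n =>
    measurable_iff_comap_le.2 (((le_iSup (fun k => MeasurableSpace.comap (v k n) inferInstance) k).trans
      le_sup_right).trans (hlast n))
  have hZad : StronglyAdapted ℱ Z := fun n =>
    stronglyMeasurable_pdVec (m0 := historySigma x v n) (fun i => (hxF i n).stronglyMeasurable)
      fun k => (hvF k n).stronglyMeasurable
  have hBA : ∀ n ω, An n ω - B (Wn n ω) =
      pdVec (fun i => a i n ω - gradient φ (WithLp.toLp 2 fun i' => c i' n ω) i)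
        fun k => b k n ω - gradConj (ℓ k) (d k n ω) := fun n ω => rfl
  have hmain := hMI.ae_weaklyTendsto (P := P) (ℱ := ℱ) hne hε0 hlam
    (fun n => ⟨(hα n).1, (hα n).2.trans (by linarith)⟩) hαsum hZad
    (memLp_pdVec hx02 hv02) (fun n => memLp_pdVec (fun i => ha2 i n) fun k => hb2 k n)
    hW' hT hZ
    (by
      intro n
      filter_upwards [condExp_pdVec (m' := historySigma x v n)
          (fun i => (ha2 i n).integrable (by norm_num))
          (fun k => (hb2 k n).integrable (by norm_num)),
        ae_all_iff.2 (hmean_a n), ae_all_iff.2 (hmean_b n)] with ω h1 h2 h3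
      refine h1.trans ?_
      simp_rw [h2, h3]
      rfl)
    (by
      have e : ∀ n, (fun ω' => ‖An n ω' - B (Wn n ω')‖ ^ 2) = fun ω' =>
          ∑ i, ‖a i n ω' - gradient φ (WithLp.toLp 2 fun i' => c i' n ω') i‖ ^ 2 +
            ∑ k, ‖b k n ω' - gradConj (ℓ k) (d k n ω')‖ ^ 2 := fun n =>
        funext fun ω' => by rw [hBA, norm_pdVec_sq]
      filter_upwards [hvar] with ω hω
      refine hω.congr fun n => ?_
      rw [← e n])
    (by
      filter_upwards [hbdd_x, hbdd_v] with ω h1 h2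
      choose R hR using h1
      choose R' hR' using h2
      have hsub : ∀ n, Z n ω - Z (n - 1) ω = pdVec (fun i => x i n ω - x i (n - 1) ω)
          fun k => v k n ω - v k (n - 1) ω := fun n => rfl
      refine ⟨∑ i, R i ^ 2 + ∑ k, R' k ^ 2 + 1, ?_⟩
      rintro _ ⟨n, rfl⟩
      have h3 : ‖Z n ω - Z (n - 1) ω‖ ^ 2 ≤ ∑ i, R i ^ 2 + ∑ k, R' k ^ 2 := by
        rw [hsub, norm_pdVec_sq]
        gcongr with i _ k _
        · exact hR i ⟨n, rfl⟩
        · exact hR' k ⟨n, rfl⟩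
      change ‖Z n ω - Z (n - 1) ω‖ ≤ _
      nlinarith [sq_nonneg (‖Z n ω - Z (n - 1) ω‖ - 1)])
  -- the limit
  obtain ⟨Ω₁, hΩ₁, hΩ₁m, hΩ₁sub⟩ := hmain.exists_measurable_mem
  choose! ζ hζ using hΩ₁sub
  -- The limits are chosen pointwise and set to 0 off a measurable set of full measure. Their
  -- measurability is recovered from that of the scalar limits ⟪x i n, y⟫ and ⟪v k n, y⟫.
  let zb : Ω → WithLp 2 (PiLp 2 K × PiLp 2 G) := Ω₁.indicator ζ
  have hzb : ∀ ω ∈ Ω₁, zb ω = ζ ω := fun ω hω => Set.indicator_of_mem hω _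
  have hxlim : ∀ ω ∈ Ω₁, ∀ i y, Tendsto (fun n => ⟪x i n ω, y⟫) atTop (𝓝 ⟪(zb ω).fst i, y⟫) := by
    intro ω hω i y
    rw [hzb ω hω, ← inner_pdInl]
    exact ((hζ ω hω).2.1 (pdInl i y)).congr fun n => inner_pdInl _ _ _
  have hvlim : ∀ ω ∈ Ω₁, ∀ k y, Tendsto (fun n => ⟪v k n ω, y⟫) atTop (𝓝 ⟪(zb ω).snd k, y⟫) := by
    intro ω hω k y
    rw [hzb ω hω, ← inner_pdInr]
    exact ((hζ ω hω).2.1 (pdInr k y)).congr fun n => inner_pdInr _ _ _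
  have hdiff : ∀ ω ∈ Ω₁, Tendsto (fun n => Wn n ω - Z n ω) atTop (𝓝 0) := fun ω hω =>
    (hζ ω hω).2.2.2.1
  have hsub_fst : ∀ ω ∈ Ω₁, ∀ i, Tendsto (fun n => c i n ω - x i n ω) atTop (𝓝 0) :=
    fun ω hω i => ((continuous_fst_apply i).tendsto 0).comp (hdiff ω hω)
  have hsub_snd : ∀ ω ∈ Ω₁, ∀ k, Tendsto (fun n => d k n ω - v k n ω) atTop (𝓝 0) :=
    fun ω hω k => ((continuous_snd_apply k).tendsto 0).comp (hdiff ω hω)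
  have hgrad_lim : ∀ ω ∈ Ω₁, Tendsto
      (fun n => gradient φ (WithLp.toLp 2 fun i' => c i' n ω)) atTop
      (𝓝 (gradient φ (zb ω).fst)) := by
    intro ω hω
    rw [hzb ω hω]
    exact ((WithLp.prod_continuous_ofLp 2 _ _).fst.tendsto _).comp (hζ ω hω).2.2.1
  have hconj_lim : ∀ ω ∈ Ω₁, ∀ k, Tendsto (fun n => gradConj (ℓ k) (d k n ω)) atTop
      (𝓝 (gradConj (ℓ k) ((zb ω).snd k))) := by
    intro ω hω k
    rw [hzb ω hω]
    exact ((continuous_snd_apply k).tendsto _).comp (hζ ω hω).2.2.1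
  have hbound : ∀ ω ∈ Ω₁, ∃ C, (∀ n, ‖(WithLp.toLp 2 fun i' => c i' n ω : PiLp 2 K)‖ ≤ C) ∧
      (∀ n i, ‖c i n ω‖ ≤ C) ∧ ∀ n k, ‖d k n ω‖ ≤ C := by
    intro ω hω
    obtain ⟨C, hC⟩ := (hζ ω hω).2.2.2.2
    have h1 : ∀ n, ‖(WithLp.toLp 2 fun i' => c i' n ω : PiLp 2 K)‖ ≤ C := fun n =>
      (WithLp.norm_fst_le (p := 2) (x := Wn n ω)).trans (hC n)
    have h2 : ∀ n, ‖(WithLp.toLp 2 fun k' => d k' n ω : PiLp 2 G)‖ ≤ C := fun n =>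
      (WithLp.norm_snd_le (p := 2) (x := Wn n ω)).trans (hC n)
    exact ⟨C, h1, fun n i => (PiLp.norm_apply_le _ i).trans (h1 n),
      fun n k => (PiLp.norm_apply_le _ k).trans (h2 n)⟩
  have hkkt : ∀ ω ∈ Ω₁, zb ω ∈ zeroSet (pdOperator Lb (blockSubdiff g) zz rr) B := fun ω hω => by
    rw [hzb ω hω]; exact (hζ ω hω).1
  refine ⟨fun i ω => (zb ω).fst i, fun k ω => (zb ω).snd k, fun i => ?_, fun k => ?_, ?_, ?_, ?_,
    fun j => ?_, fun h hconv _ hsep j => ?_⟩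
  · refine measurable_of_measurable_inner fun y => ?_
    refine measurable_of_tendsto_metrizable
      (f := fun n => Ω₁.indicator fun ω => ⟪x i n ω, y⟫) (fun n => ?_) ?_
    · exact ((hxm i n).inner measurable_const).indicator hΩ₁m
    · refine tendsto_pi_nhds.2 fun ω => ?_
      by_cases hω : ω ∈ Ω₁
      · simp only [Set.indicator_of_mem hω]
        exact hxlim ω hω i y
      · have h0 : zb ω = 0 := Set.indicator_of_notMem hω _
        simp only [Set.indicator_of_notMem hω, h0]
        simp
  · refine measurable_of_measurable_inner fun y => ?_
    refine measurable_of_tendsto_metrizable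
      (f := fun n => Ω₁.indicator fun ω => ⟪v k n ω, y⟫) (fun n => ?_) ?_
    · exact ((hvm k n).inner measurable_const).indicator hΩ₁m
    · refine tendsto_pi_nhds.2 fun ω => ?_
      by_cases hω : ω ∈ Ω₁
      · simp only [Set.indicator_of_mem hω]
        exact hvlim ω hω k y
      · have h0 : zb ω = 0 := Set.indicator_of_notMem hω _
        simp only [Set.indicator_of_notMem hω, h0]
        simp
  · filter_upwards [hΩ₁] with ω hω
    obtain ⟨h1, y₂, h2, h3⟩ := hzero _ (hkkt ω hω)
    exact ⟨mem_primalSolutions hg hℓ hφconv hφdiff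
        (fun k => hgradConj k ((zb ω).snd k)) h2 h3 h1,
      mem_dualSolutions hg hℓ hφconv hφdiff (fun k => hgradConj k ((zb ω).snd k)) h2 h3 h1⟩
  · filter_upwards [hΩ₁] with ω hω
    exact ⟨fun i => weaklyTendsto_iff.2 (hxlim ω hω i), fun k => weaklyTendsto_iff.2 (hvlim ω hω k)⟩
  · filter_upwards [hΩ₁] with ω hω huc i
    obtain ⟨C, hC, -, -⟩ := hbound ω hω
    -- The gradients are known to converge at the extrapolated points c, so strong convergence is
    -- proved for c and transferred to x by c - x → 0.
    have h1 := huc.tendsto (ConvexOn.add_inner_gradient_le hφconv hφdiff _)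
      (fun n => ConvexOn.add_inner_gradient_le hφconv hφdiff _) hC (hgrad_lim ω hω)
    have h2 : Tendsto (fun n => c i n ω) atTop (𝓝 ((zb ω).fst i)) :=
      ((PiLp.proj (𝕜 := ℝ) 2 K i).continuous.tendsto _).comp h1
    simpa using h2.sub (hsub_fst ω hω i)
  · filter_upwards [hΩ₁] with ω hω huc
    obtain ⟨C, -, -, hC⟩ := hbound ω hω
    -- The conjugate is finite everywhere because each u is a subgradient of ℓ j at the conjugate
    -- gradient; that gradient is in turn a subgradient of the conjugate at u.
    have hreal : ∀ u, conj (ℓ j) u = (((conj (ℓ j) u).toReal : ℝ) : EReal) := fun u => by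
      obtain ⟨e, he, -⟩ := (hℓ j).exists_real_of_mem_subdiff (hgradConj j u)
      rw [conj_eq_of_mem_subdiff he (hgradConj j u), EReal.toReal_coe]
    have hsubg : ∀ u y, (conj (ℓ j) u).toReal + ⟪y - u, gradConj (ℓ j) u⟫ ≤
        (conj (ℓ j) y).toReal := fun u y => by
      obtain ⟨e, he, -⟩ := (hℓ j).exists_real_of_mem_subdiff (hgradConj j u)
      have h1 := mem_subdiff_conj he (hgradConj j u) y
      rw [hreal u, hreal y, ← EReal.coe_add] at h1
      exact EReal.coe_le_coe_iff.1 h1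
    have hfun : conj (ℓ j) = fun u => (((conj (ℓ j) u).toReal : ℝ) : EReal) := funext hreal
    rw [hfun] at huc
    have h1 := huc.tendsto (hsubg _) (fun n => hsubg (d j n ω)) (fun n => hC n j)
      (hconj_lim ω hω j)
    simpa using h1.sub (hsub_snd ω hω j)
  · filter_upwards [hΩ₁] with ω hω huc
    obtain ⟨C, -, hC, -⟩ := hbound ω hω
    have h1 := huc.tendsto
      (add_inner_gradient_le_of_separable hφconv hφdiff hsep (zb ω).fst j)
      (fun n => add_inner_gradient_le_of_separable hφconv hφdiff hsep
        (WithLp.toLp 2 fun i' => c i' n ω) j) (fun n => hC n j)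
      (((PiLp.proj (𝕜 := ℝ) 2 K j).continuous.tendsto _).comp (hgrad_lim ω hω))
    simpa using h1.sub (hsub_fst ω hω j)
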